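/- Consider a single-server retrial system with two classes of customers and no waiting room. For $k=1,2$, external class-$k$ customers arrive according to independent Poisson processes of rates $\lambda_k>0$; their service times are independent with distribution function $F_k$ and mean $1/\mu_k$. A class-$k$ arrival that finds the server busy joins orbit $k$; whenever orbit $k$ is non-empty, its head-of-line customer retries after exponential times of rate $\alpha_k>0$ (irrespective of the orbit size), and enters service if the server is idle at the retrial. All these random variables are independent. The system is initially empty. Let $X_n^{(k)}$ be the number of customers in orbit $k$ just after the $n$-th departure. Put $$\rho_k=\frac{\lambda_k}{\mu_k},\qquad \hat\rho_k=\frac{\alpha_k}{\mu_k},\qquad \rho=\rho_1+\rho_2,\qquad \hat\rho=\hat\rho_1+\hat\rho_2 .$$ **Theorem 3.** Suppose that each $F_k$ is a distribution on $[0,\infty)$ with a density $f_k$ whose failure rate $r_k(x)=f_k(x)/(1-F_k(x))$, defined for all $x$ with $1-F_k(x)>0$, satisfies $\inf_{x\ge 0} r_k(x)>0$, and that $$\hat\rho_1>\rho_1(\rho+\hat\rho),\qquad \rho>\frac{\hat\rho_2}{\rho_2+\hat\rho_2}.$$ Consider the associated single-orbit system with the same service time distributions, in which class-1 customers arrive externally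 at rate $\lambda_1$, join the orbit if they find the server busy, and are retried from the non-empty orbit at constant rate $\alpha_1$, while class-2 customers arrive according to a Poisson process of rate $\lambda_2+\alpha_2$ and are lost if they find the server busy. Then the orbit size of this system just after departures is a Markov chain on $\{0,1,2,\dots\}$ with a unique stationary distribution $\pi$, and the distribution of $X_n^{(1)}$ converges to $\pi$ in total variation as $n\to\infty$: $$\sup_{A\subseteq\{0,1,2,\dots\}}\bigl|\mathsf P(X_n^{(1)}\in A)-\pi(A)\bigr|\longrightarrow 0 .$$ -/

import Mathlib

open MeasureTheory ProbabilityTheory Filter Topology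

namespace Retrial

noncomputable section

/-! Classes 1 and 2 of customers are indexed by `0 : Fin 2` and `1 : Fin 2`.
`lam k` is the external arrival rate, `al k` the retrial rate of orbit `k` and `F k` the law of the
service time of class `k`. -/

/-! ### Service times and load coefficients -/

/-- Class `𝒟`: laws on `[0, ∞)` with a density `f` (with respect to Lebesgue measure) whose failure
rate `r x = f x / (1 - F x)`, defined where `1 - F x > 0`, satisfies `inf_{x ≥ 0} r x > 0`. -/
def ClassD (μ : Measure ℝ) : Prop :=
  μ (Set.Iio 0) = 0 ∧
  ∃ f : ℝ → ℝ, Measurable f ∧ (∀ x, 0 ≤ f x) ∧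
    μ = volume.withDensity (fun x => ENNReal.ofReal (f x)) ∧
    ∃ c : ℝ, 0 < c ∧ ∀ x : ℝ, 0 ≤ x → 0 < 1 - cdf μ x → c ≤ f x / (1 - cdf μ x)

/-- Service rate `1 / E S`. -/
def serviceRate (μ : Measure ℝ) : ℝ := 1 / ∫ x, x ∂μ

/-- `ρ_k = λ_k / μ_k`. -/
def rho (lam : Fin 2 → ℝ) (F : Fin 2 → Measure ℝ) (k : Fin 2) : ℝ := lam k / serviceRate (F k)

/-- `ρ̂_k = α_k / μ_k`. -/
def rhoHat (al : Fin 2 → ℝ) (F : Fin 2 → Measure ℝ) (k : Fin 2) : ℝ := al k / serviceRate (F k)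

/-- Number of points of the stream with successive gaps `gap 0, gap 1, …` in `[0, s]`. -/
def arrivalsBy (gap : ℕ → ℝ) (s : ℝ) : ℕ :=
  Set.ncard {i : ℕ | ∑ l ∈ Finset.range (i + 1), gap l ≤ s}

/-! ### The two-orbit system

The evolution between two consecutive departures consists of an idle period followed by a service.
Arrival streams are Poisson and retrial times are exponential, so by lack of memory the residual
times at the beginning of the idle period and of the service are fresh exponential variables. -/

/-- The random ingredients of one cycle. -/
inductive Ingredient : Type
  /-- time from the last departure to the next external arrival of class `k` -/
  | arrival (k : Fin 2)
  /-- time from the last departure to the next attempt from orbit `k` (if it is not empty) -/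
  | retrial (k : Fin 2)
  /-- service time, if the customer to be served is of class `k` -/
  | service (k : Fin 2)
  /-- `i`-th gap in the stream of external class-`k` arrivals after the start of the service -/
  | gap (k : Fin 2) (i : ℕ)

/-- Law of each ingredient. -/
def ingredientLaw (lam al : Fin 2 → ℝ) (F : Fin 2 → Measure ℝ) : Ingredient → Measure ℝ
  | .arrival k => expMeasure (lam k)
  | .retrial k => expMeasure (al k)
  | .service k => F k
  | .gap k _ => expMeasure (lam k)

/-- Law of one cycle: the ingredients are independent. -/
def cycleLaw (lam al : Fin 2 → ℝ) (F : Fin 2 → Measure ℝ) : Measure (Ingredient → ℝ) :=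
  Measure.infinitePi (ingredientLaw lam al F)

/-- Origin of the customer that ends the idle period. -/
inductive Origin : Type
  | external (k : Fin 2)
  | orbital (k : Fin 2)

/-- Class of the customer. -/
def Origin.cls : Origin → Fin 2
  | .external k => k
  | .orbital k => k

/-- Time after the last departure at which the given origin would supply a customer. -/
def Origin.clock (w : Ingredient → ℝ) : Origin → ℝ
  | .external k => w (.arrival k)
  | .orbital k => w (.retrial k)

/-- External streams are always active, an orbit only if it is not empty. -/
def Origin.Active (x : Fin 2 → ℕ) : Origin → Prop
  | .external _ => True
  | .orbital k => 0 < x k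

/-- Origin `o` is active and is the first one to supply a customer. -/
def IsFirst (x : Fin 2 → ℕ) (w : Ingredient → ℝ) (o : Origin) : Prop :=
  o.Active x ∧ ∀ o' : Origin, o'.Active x → o.clock w ≤ o'.clock w

open Classical in
/-- Origin of the customer that seizes the server (ties, of probability zero, are broken
arbitrarily). -/
def entering (x : Fin 2 → ℕ) (w : Ingredient → ℝ) : Origin :=
  if IsFirst x w (.external 0) then .external 0
  else if IsFirst x w (.external 1) then .external 1
  else if IsFirst x w (.orbital 0) then .orbital 0
  else .orbital 1

open Classical in
/-- Orbit sizes just after the next departure, given the orbit sizes `x` just after the last one: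
an orbital customer leaves its orbit when it seizes the server, and every external customer that
arrives during the service joins the orbit of its class. -/
def step (x : Fin 2 → ℕ) (w : Ingredient → ℝ) : Fin 2 → ℕ :=
  fun j =>
    (x j - if entering x w = .orbital j then 1 else 0) +
      arrivalsBy (fun i => w (.gap j i)) (w (.service (entering x w).cls))

/-- Orbit sizes `X_n = (X_n^{(1)}, X_n^{(2)})` just after the `n`-th departure in the system that
is initially empty (`X_0 = 0`), driven by the cycles `ξ 0, ξ 1, …`. -/
def orbits {Ω : Type*} (ξ : ℕ → Ω → Ingredient → ℝ) : ℕ → Ω → Fin 2 → ℕ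
  | 0, _ => 0
  | n + 1, ω => step (orbits ξ n ω) (ξ n ω)

/-! ### The associated single-orbit system

Class-1 customers arrive at rate `λ₁`, join the orbit if the server is busy and retry at rate `α₁`.
Class-2 customers arrive at rate `λ₂ + α₂` and are lost if the server is busy. -/

/-- The random ingredients of one cycle of the single-orbit system. -/
inductive AuxIngredient : Type
  /-- time from the last departure to the next external arrival of class `k` -/
  | arrival (k : Fin 2)
  /-- time from the last departure to the next attempt from the orbit (if it is not empty) -/
  | retrial
  /-- service time, if the customer to be served is of class `k` -/
  | service (k : Fin 2)
  /-- `i`-th gap in the stream of class-1 arrivals after the start of the service -/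
  | gap (i : ℕ)

/-- Law of each ingredient. -/
def auxIngredientLaw (lam al : Fin 2 → ℝ) (F : Fin 2 → Measure ℝ) : AuxIngredient → Measure ℝ
  | .arrival 0 => expMeasure (lam 0)
  | .arrival 1 => expMeasure (lam 1 + al 1)
  | .retrial => expMeasure (al 0)
  | .service k => F k
  | .gap _ => expMeasure (lam 0)

/-- Law of one cycle: the ingredients are independent. -/
def auxCycleLaw (lam al : Fin 2 → ℝ) (F : Fin 2 → Measure ℝ) : Measure (AuxIngredient → ℝ) :=
  Measure.infinitePi (auxIngredientLaw lam al F)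

open Classical in
/-- Orbit size just after the next departure, given the orbit size `x` just after the last one. -/
def auxStep (x : ℕ) (w : AuxIngredient → ℝ) : ℕ :=
  if 0 < x ∧ w .retrial < w (.arrival 0) ∧ w .retrial < w (.arrival 1) then
    -- an orbital customer (of class 1) seizes the server
    (x - 1) + arrivalsBy (fun i => w (.gap i)) (w (.service 0))
  else if w (.arrival 0) ≤ w (.arrival 1) then
    -- an external class-1 customer seizes the server
    x + arrivalsBy (fun i => w (.gap i)) (w (.service 0))
  else
    -- a class-2 customer seizes the server
    x + arrivalsBy (fun i => w (.gap i)) (w (.service 1))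

/-- Transition kernel of the orbit size of the single-orbit system at departure instants. -/
def auxKernel (lam al : Fin 2 → ℝ) (F : Fin 2 → Measure ℝ) : Kernel ℕ ℕ :=
  Kernel.ofFunOfCountable fun x => (auxCycleLaw lam al F).map (auxStep x)

/-- `π` is a stationary distribution of the orbit size of the single-orbit system at departure
instants. -/
def IsStationary (lam al : Fin 2 → ℝ) (F : Fin 2 → Measure ℝ) (π : Measure ℕ) : Prop :=
  IsProbabilityMeasure π ∧ Kernel.Invariant (auxKernel lam al F) π

/-- Total variation distance of two probability measures. -/
def tvDist {α : Type*} [MeasurableSpace α] (μ ν : Measure α) : ℝ :=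
  ⨆ A : {A : Set α // MeasurableSet A}, |μ.real A.1 - ν.real A.1|

end

end Retrial

/-! The argument is a comparison between the first orbit and the single-orbit system. While the
second orbit is non-empty, its retrials act on the first orbit exactly like extra class-2 arrivals
that would be lost on a busy server: either kind starts a service with law `F 1` and leaves the
first orbit unchanged, apart from the class-1 arrivals during that service. So one cycle of the
first orbit is then one step of `auxKernel` (`map_step_zero_eq_map_auxStep`). It remains to show
that the second orbit is rarely empty at late times and that the single-orbit chain forgets its
initial state.

Stability of the first orbit: the first load condition makes its mean increment negative whenever it
is non-empty, whether or not the second orbit is empty. A failure rate bounded below gives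
exponential moments of the service times, hence of the numbers of arrivals, so for small `θ` the
function `exp (θ * x 0)` satisfies a geometric drift inequality (`exists_drift_orbit_zero`). Applied
to states with a non-empty second orbit, the inequality passes to `auxKernel`, and with a one-step
minorization it yields geometric ergodicity through a weighted-seminorm contraction
(`HarrisPair.contraction`, `HarrisPair.geometric_ergodicity`).

Escape of the second orbit: the second load condition provides `κ > 0` for which `x 1 + κ * x 0` has
positive mean increment for every pattern of empty orbits (`exists_drift_direction`). Increments
depend on the state only through this finite pattern and are bounded below, so `exp (-θ' * (x 1 + κ
* x 0))` decays geometrically in mean. As the first orbit is tight, the probability that the second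
is empty tends to zero (`tendsto_orbitLaw_orbit_one_empty`).

Conclusion: from time `n` to `n + m`, replacing true transitions by `auxKernel` costs at most twice
the sum of the probabilities that the second orbit is empty, while `m` steps of `auxKernel` come
within `C * a ^ m * (1 + D)` of `π`, uniformly in `n`. Fixing `m` large and then letting `n` grow
gives convergence in total variation. -/

namespace Retrial

/-! ### A Harris theorem for Markov kernels on `ℕ` -/

section Harris

/-- The Markov operator of a kernel on `ℕ`. -/
noncomputable def markovOp (Q : Kernel ℕ ℕ) (φ : ℕ → ℝ) : ℕ → ℝ := fun x => ∫ y, φ y ∂(Q x)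

/-- A geometric drift condition for `V`, together with a one-step minorization on sublevel sets. -/
structure HarrisPair (Q : Kernel ℕ ℕ) (V : ℕ → ℝ) (γ K : ℝ) : Prop where
  nonneg : ∀ x, 0 ≤ V x
  integrable : ∀ x, Integrable V (Q x)
  drift : ∀ x, ∫ y, V y ∂(Q x) ≤ γ * V x + K
  gamma_nonneg : 0 ≤ γ
  gamma_lt_one : γ < 1
  const_nonneg : 0 ≤ K
  minor : ∀ R : ℝ, ∃ (r : ℕ) (ε : ℝ), 0 < ε ∧ ∀ x, V x ≤ R → ε ≤ (Q x).real {r}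

variable {Q : Kernel ℕ ℕ} {V : ℕ → ℝ} {γ K : ℝ}

/-- A function whose oscillation is dominated by `w x + w y` is, up to a constant, dominated
by `w`. -/
lemma exists_shift_abs_le {w φ : ℕ → ℝ}
    (h : ∀ x y, |φ x - φ y| ≤ w x + w y) : ∃ c, ∀ x, |φ x + c| ≤ w x := by
  have hb : BddBelow (Set.range fun x => w x - φ x) := by
    refine ⟨-(φ 0) - w 0, ?_⟩
    rintro _ ⟨x, rfl⟩
    have := abs_le.1 (h x 0)
    simp only
    linarith [this.2]
  -- This is the largest shift keeping `φ + c` below `w`; the oscillation bound, read as `-w x - φ x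
  -- ≤ w y - φ y`, keeps it above `-w`.
  refine ⟨⨅ x, (w x - φ x), fun x => abs_le.2 ⟨?_, ?_⟩⟩
  · have : -w x - φ x ≤ ⨅ x, (w x - φ x) := by
      refine le_ciInf fun y => ?_
      have := abs_le.1 (h y x)
      linarith [this.2]
    linarith
  · have := ciInf_le hb x
    linarith

lemma integrable_of_abs_le_nat {μ : Measure ℕ} {f g : ℕ → ℝ} (hg : Integrable g μ)
    (h : ∀ x, |f x| ≤ g x) : Integrable f μ :=
  hg.mono' (measurable_of_countable f).aestronglyMeasurable (ae_of_all _ h)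

lemma integral_bind_markovOp {μ : Measure ℕ} {f : ℕ → ℝ} (hf : Integrable f (μ.bind Q)) :
    ∫ x, f x ∂(μ.bind Q) = ∫ x, markovOp Q f x ∂μ := by
  rw [Measure.comp_eq_comp_const_apply] at hf ⊢
  rw [Kernel.integral_comp hf]
  simp [markovOp]

lemma HarrisPair.integrable_bind (h : HarrisPair Q V γ K) {μ : Measure ℕ} [IsProbabilityMeasure μ]
    (hμ : Integrable V μ) : Integrable V (μ.bind Q) := by
  rw [Measure.integrable_comp_iff (measurable_of_countable V).aestronglyMeasurable]
  refine ⟨ae_of_all _ h.integrable, integrable_of_abs_le_nat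
    ((hμ.const_mul γ).add (integrable_const K)) fun x => ?_⟩
  simp only [Real.norm_eq_abs, abs_of_nonneg (h.nonneg _)]
  rw [abs_of_nonneg (integral_nonneg h.nonneg)]
  exact h.drift x

variable [IsMarkovKernel Q]

lemma mul_le_integral_of_atom {μ : Measure ℕ} [IsFiniteMeasure μ] {h : ℕ → ℝ} (h0 : ∀ x, 0 ≤ h x)
    (hi : Integrable h μ) {ε : ℝ} {r : ℕ} (hr : ε ≤ μ.real {r}) : ε * h r ≤ ∫ y, h y ∂μ := by
  calc ε * h r ≤ μ.real {r} * h r := mul_le_mul_of_nonneg_right hr (h0 r)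
    _ = ∫ y in {r}, h y ∂μ := by rw [integral_singleton, smul_eq_mul]
    _ ≤ ∫ y, h y ∂μ := setIntegral_le_integral hi (ae_of_all _ h0)

/-- Both `w + ψ` and `w - ψ` are nonnegative, so each integral is at least its contribution at the
atom. Two measures sharing the atom then have the same term `ε * ψ r` removed, and it cancels in
their difference. -/
lemma abs_integral_sub_atom_le {μ : Measure ℕ} [IsFiniteMeasure μ] {ψ w : ℕ → ℝ}
    (hψ : ∀ x, |ψ x| ≤ w x) (hi : Integrable w μ) {ε : ℝ} {r : ℕ} (hr : ε ≤ μ.real {r}) :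
    |∫ y, ψ y ∂μ - ε * ψ r| ≤ ∫ y, w y ∂μ - ε * w r := by
  have hψi := integrable_of_abs_le_nat hi hψ
  have h1 := mul_le_integral_of_atom (h := fun x => w x + ψ x)
    (fun x => by linarith [(abs_le.1 (hψ x)).1]) (hi.add hψi) hr
  have h2 := mul_le_integral_of_atom (h := fun x => w x - ψ x)
    (fun x => by linarith [(abs_le.1 (hψ x)).2]) (hi.sub hψi) hr
  rw [integral_add hi hψi] at h1
  rw [integral_sub hi hψi] at h2
  rw [abs_le]
  constructor <;> linarith

lemma HarrisPair.integral_weight_le (h : HarrisPair Q V γ K) {β : ℝ} (hβ : 0 ≤ β) (x : ℕ) :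
    ∫ y, (1 + β * V y) ∂(Q x) ≤ 1 + β * (γ * V x + K) := by
  rw [integral_add (integrable_const _) ((h.integrable x).const_mul _), integral_const_mul]
  simp only [integral_const, probReal_univ, smul_eq_mul, mul_one]
  gcongr
  exact h.drift x

/-- The Markov operator contracts the weighted oscillation seminorm. -/
lemma HarrisPair.contraction (h : HarrisPair Q V γ K) :
    ∃ β a : ℝ, 0 < β ∧ 0 < a ∧ a < 1 ∧ ∀ (M : ℝ) (φ : ℕ → ℝ), 0 ≤ M →
      (∀ x y, |φ x - φ y| ≤ M * ((1 + β * V x) + (1 + β * V y))) →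
      ∀ x y, |markovOp Q φ x - markovOp Q φ y| ≤ a * M * ((1 + β * V x) + (1 + β * V y)) := by
  have hK := h.const_nonneg
  have hγ := h.gamma_nonneg
  have hγ1 := h.gamma_lt_one
  -- The threshold gives `(1 + γ) / 2 * R + 2 * K = R - 1`, so the drift strictly contracts the
  -- weights once `V x + V y ≥ R`.
  set R : ℝ := (2 * K + 1) / (1 - γ) * 2 with hR
  have hRpos : 0 < R := by
    have : 0 < 1 - γ := by linarith
    positivity
  have hRK : (1 - γ) * R = 2 * (2 * K + 1) := by
    rw [hR]; field_simp [(by linarith : (1 - γ) ≠ 0)]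
  obtain ⟨r, ε, hε, hmin⟩ := h.minor R
  set δ : ℝ := min ε 1 with hδ
  have hδ0 : 0 < δ := lt_min hε one_pos
  have hδ1 : δ ≤ 1 := min_le_right _ _
  -- The weight is small enough that `2 * β * K ≤ δ`: the additive drift constants use up at most
  -- half of the gain `2 * δ` from the common atom.
  set β : ℝ := δ / (2 * K + 1) with hβ
  have hβ0 : 0 < β := by positivity
  have hβK : β * (2 * K + 1) = δ := by rw [hβ]; field_simp
  set a1 : ℝ := (2 + β * ((1 + γ) / 2 * R + 2 * K)) / (2 + β * R) with ha1
  have hγ' : (1 + γ) / 2 < 1 := by linarith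
  have hden : 0 < 2 + β * R := by positivity
  have ha1lt : a1 < 1 := by
    rw [ha1, div_lt_one hden]
    have : (1 + γ) / 2 * R + 2 * K < R := by nlinarith
    nlinarith
  have ha1mul : a1 * (2 + β * R) = 2 + β * ((1 + γ) / 2 * R + 2 * K) := by
    rw [ha1]; field_simp
  have ha1pos : 0 < a1 := by
    rw [ha1]; positivity
  set a : ℝ := max (max a1 ((1 + γ) / 2)) (1 - δ / 2) with ha
  have haa1 : a1 ≤ a := (le_max_left _ _).trans (le_max_left _ _)
  have haγ : (1 + γ) / 2 ≤ a := (le_max_right _ _).trans (le_max_left _ _)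
  have haδ : 1 - δ / 2 ≤ a := le_max_right _ _
  refine ⟨β, a, hβ0, ha1pos.trans_le haa1, max_lt (max_lt ha1lt hγ') (by linarith), ?_⟩
  intro M φ hM hφ x y
  have hV := h.nonneg
  obtain ⟨c, hc⟩ := exists_shift_abs_le (w := fun x => M * (1 + β * V x))
    (fun x y => by rw [← mul_add]; exact hφ x y)
  have hwi : ∀ x, Integrable (fun y => M * (1 + β * V y)) (Q x) := fun x =>
    ((integrable_const _).add ((h.integrable x).const_mul _)).const_mul _
  have hshift : ∀ x, markovOp Q φ x = ∫ y, (φ y + c) ∂(Q x) - c := fun x => by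
    have h1 := integrable_of_abs_le_nat (hwi x) hc
    have h2 : Integrable φ (Q x) := by
      convert! h1.sub (integrable_const c) using 1
      ext y
      simp
    rw [integral_add h2 (integrable_const _)]
    simp [markovOp]
  have hint : ∀ x, ∫ y, M * (1 + β * V y) ∂(Q x) ≤ M * (1 + β * (γ * V x + K)) := fun x => by
    rw [integral_const_mul]
    exact mul_le_mul_of_nonneg_left (h.integral_weight_le hβ0.le x) hM
  rw [hshift x, hshift y, sub_sub_sub_cancel_right, mul_comm a M, mul_assoc]
  have hx := hV x
  have hy := hV y
  -- For large `V x + V y` the drift alone contracts. Otherwise both points lie in the sublevel set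
  -- of `R`, and the two transition laws share an atom of mass at least `δ` at `r`.
  rcases le_or_gt R (V x + V y) with hxy | hxy
  · have b1 : ∀ x, |∫ y, (φ y + c) ∂(Q x)| ≤ M * (1 + β * (γ * V x + K)) := fun x =>
      (abs_integral_le_integral_abs).trans ((integral_mono
        (integrable_of_abs_le_nat (hwi x) hc).abs (hwi x) hc).trans (hint x))
    refine (abs_sub _ _).trans ((add_le_add (b1 x) (b1 y)).trans ?_)
    rw [← mul_add]
    refine mul_le_mul_of_nonneg_left ?_ hM
    have e1 : a * (2 + β * R) ≥ 2 + β * ((1 + γ) / 2 * R + 2 * K) := by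
      rw [← ha1mul]; exact mul_le_mul_of_nonneg_right haa1 hden.le
    have e2 : 0 ≤ β * (V x + V y - R) := mul_nonneg hβ0.le (by linarith)
    have e3 := mul_le_mul_of_nonneg_right haγ e2
    have e4 : 0 ≤ (1 - γ) * (β * (V x + V y)) :=
      mul_nonneg (by linarith) (mul_nonneg hβ0.le (by linarith))
    nlinarith
  · have hmx : δ ≤ (Q x).real {r} := (min_le_left _ _).trans (hmin x (by linarith))
    have hmy : δ ≤ (Q y).real {r} := (min_le_left _ _).trans (hmin y (by linarith))
    have b1 := abs_integral_sub_atom_le hc (hwi x) hmx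
    have b2 := abs_integral_sub_atom_le hc (hwi y) hmy
    have b3 : |∫ z, (φ z + c) ∂(Q x) - ∫ z, (φ z + c) ∂(Q y)| ≤
        M * (1 + β * (γ * V x + K)) + M * (1 + β * (γ * V y + K)) -
          2 * (δ * (M * (1 + β * V r))) := by
      have := hint x
      have := hint y
      rw [abs_le] at b1 b2 ⊢
      constructor <;> linarith [b1.1, b1.2, b2.1, b2.2]
    refine b3.trans ?_
    have hr := hV r
    have e0 : M * (1 + β * (γ * V x + K)) + M * (1 + β * (γ * V y + K)) -
        2 * (δ * (M * (1 + β * V r))) =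
        M * ((1 + β * (γ * V x + K)) + (1 + β * (γ * V y + K)) - 2 * (δ * (1 + β * V r))) := by
      ring
    rw [e0]
    refine mul_le_mul_of_nonneg_left ?_ hM
    have e1 : 0 ≤ δ * (β * V r) := by positivity
    have e2 : 0 ≤ β * (V x + V y) := mul_nonneg hβ0.le (by linarith)
    have e3 := mul_le_mul_of_nonneg_right haγ e2
    nlinarith

lemma integrable_of_bdd_nat {μ : Measure ℕ} [IsFiniteMeasure μ] {φ : ℕ → ℝ} {B : ℝ}
    (h : ∀ x, |φ x| ≤ B) : Integrable φ μ :=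
  Integrable.of_bound (measurable_of_countable φ).aestronglyMeasurable B (ae_of_all _ h)

lemma abs_markovOp_le {φ : ℕ → ℝ} {B : ℝ} (h : ∀ x, |φ x| ≤ B) (x : ℕ) : |markovOp Q φ x| ≤ B := by
  refine abs_integral_le_integral_abs.trans ?_
  refine (integral_mono (integrable_of_bdd_nat h).abs (integrable_const B) h).trans ?_
  simp

lemma abs_markovOp_iterate_le {B : ℝ} (n : ℕ) : ∀ {φ : ℕ → ℝ}, (∀ x, |φ x| ≤ B) →
    ∀ x, |(markovOp Q)^[n] φ x| ≤ B := by
  induction n with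
  | zero => exact fun h x => h x
  | succ n ih =>
    intro φ h x
    rw [Function.iterate_succ_apply]
    exact ih (abs_markovOp_le h) x

lemma HarrisPair.integral_bind_le (h : HarrisPair Q V γ K) {μ : Measure ℕ} [IsProbabilityMeasure μ]
    (hμ : Integrable V μ) : ∫ x, V x ∂(μ.bind Q) ≤ γ * ∫ x, V x ∂μ + K := by
  rw [integral_bind_markovOp (h.integrable_bind hμ)]
  have hi : Integrable (fun x => γ * V x + K) μ := (hμ.const_mul γ).add (integrable_const K)
  refine (integral_mono (integrable_of_abs_le_nat hi fun x => ?_) hi h.drift).trans ?_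
  · rw [abs_of_nonneg (integral_nonneg h.nonneg)]
    exact h.drift x
  · rw [integral_add (hμ.const_mul γ) (integrable_const K), integral_const_mul]
    simp

/-- Law after `n` steps of the chain with kernel `Q` started at `0`. -/
noncomputable def iterLaw (Q : Kernel ℕ ℕ) : ℕ → Measure ℕ
  | 0 => Measure.dirac 0
  | n + 1 => (iterLaw Q n).bind Q

instance isProbabilityMeasure_iterLaw (n : ℕ) : IsProbabilityMeasure (iterLaw Q n) := by
  induction n with
  | zero => unfold iterLaw; infer_instance
  | succ n ih => unfold iterLaw; infer_instance

lemma HarrisPair.iterLaw_bound (h : HarrisPair Q V γ K) (n : ℕ) :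
    Integrable V (iterLaw Q n) ∧ ∫ x, V x ∂(iterLaw Q n) ≤ V 0 + K / (1 - γ) := by
  have h1 : 0 < 1 - γ := by linarith [h.gamma_lt_one]
  have h2 : 0 ≤ K / (1 - γ) := div_nonneg h.const_nonneg h1.le
  induction n with
  | zero =>
    unfold iterLaw
    refine ⟨integrable_dirac (by simp), ?_⟩
    simp [h2]
  | succ n ih =>
    unfold iterLaw
    refine ⟨h.integrable_bind ih.1, (h.integral_bind_le ih.1).trans ?_⟩
    have h3 : (1 - γ) * (K / (1 - γ)) = K := by field_simp
    nlinarith [mul_le_mul_of_nonneg_left ih.2 h.gamma_nonneg,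
      mul_nonneg h1.le (h.nonneg 0)]

lemma integral_iterLaw_add {B : ℝ} (n k : ℕ) : ∀ {φ : ℕ → ℝ}, (∀ x, |φ x| ≤ B) →
    ∫ x, φ x ∂(iterLaw Q (n + k)) = ∫ x, (markovOp Q)^[n] φ x ∂(iterLaw Q k) := by
  induction n with
  | zero => intro φ _; simp
  | succ n ih =>
    intro φ h
    rw [Function.iterate_succ_apply, ← ih (abs_markovOp_le h), add_right_comm]
    change ∫ x, φ x ∂((iterLaw Q (n + k)).bind Q) = _
    exact integral_bind_markovOp (integrable_of_bdd_nat h)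

lemma integral_iterLaw {B : ℝ} (n : ℕ) {φ : ℕ → ℝ} (h : ∀ x, |φ x| ≤ B) :
    ∫ x, φ x ∂(iterLaw Q n) = (markovOp Q)^[n] φ 0 := by
  have := integral_iterLaw_add (Q := Q) n 0 h
  simpa [iterLaw] using this

lemma integral_invariant_iterate {B : ℝ} {π : Measure ℕ} [IsProbabilityMeasure π]
    (hπ : Kernel.Invariant Q π) (n : ℕ) : ∀ {φ : ℕ → ℝ}, (∀ x, |φ x| ≤ B) →
    ∫ x, (markovOp Q)^[n] φ x ∂π = ∫ x, φ x ∂π := by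
  induction n with
  | zero => intro φ _; simp
  | succ n ih =>
    intro φ h
    rw [Function.iterate_succ_apply, ih (abs_markovOp_le h)]
    conv_rhs => rw [← hπ.def]
    rw [integral_bind_markovOp]
    exact integrable_of_bdd_nat h

/-- Geometric merging of the iterates of the Markov operator. -/
lemma HarrisPair.geometric_merging (h : HarrisPair Q V γ K) :
    ∃ β a : ℝ, 0 < β ∧ 0 < a ∧ a < 1 ∧ ∀ (n : ℕ) (φ : ℕ → ℝ), (∀ x, |φ x| ≤ 1) →
      ∀ x y, |(markovOp Q)^[n] φ x - (markovOp Q)^[n] φ y| ≤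
        a ^ n * ((1 + β * V x) + (1 + β * V y)) := by
  obtain ⟨β, a, hβ, ha, ha1, H⟩ := h.contraction
  refine ⟨β, a, hβ, ha, ha1, fun n φ hφ => ?_⟩
  induction n with
  | zero =>
    intro x y
    have h1 := mul_nonneg hβ.le (h.nonneg x)
    have h2 := mul_nonneg hβ.le (h.nonneg y)
    have := abs_sub (φ x) (φ y)
    have := hφ x
    have := hφ y
    simp only [Function.iterate_zero, id, pow_zero, one_mul]
    linarith
  | succ n ih =>
    intro x y
    rw [Function.iterate_succ_apply', pow_succ']
    exact H _ _ (by positivity) ih x y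

/-- The law after `n + k` steps is the law after `n` steps from the random state at time `k`, whose
`V`-moment is bounded uniformly in `k`. Uniformity in `k` serves twice: it makes the laws Cauchy,
and `k → ∞` replaces the second term by the invariant law. -/
lemma HarrisPair.merging_iterLaw (h : HarrisPair Q V γ K) :
    ∃ C a : ℝ, 0 ≤ C ∧ 0 < a ∧ a < 1 ∧ ∀ (n k : ℕ) (φ : ℕ → ℝ), (∀ x, |φ x| ≤ 1) →
      ∀ x, |(markovOp Q)^[n] φ x - ∫ y, φ y ∂(iterLaw Q (n + k))| ≤ C * a ^ n * (1 + V x) := by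
  obtain ⟨β, a, hβ, ha, ha1, H⟩ := h.geometric_merging
  have h1 : 0 < 1 - γ := by linarith [h.gamma_lt_one]
  have h2 : 0 ≤ K / (1 - γ) := div_nonneg h.const_nonneg h1.le
  have hV0 := h.nonneg 0
  set D := V 0 + K / (1 - γ) with hD
  refine ⟨2 + β + β * D, a, by positivity, ha, ha1, fun n k φ hφ x => ?_⟩
  rw [integral_iterLaw_add n k hφ]
  have hi : Integrable ((markovOp Q)^[n] φ) (iterLaw Q k) :=
    integrable_of_bdd_nat (abs_markovOp_iterate_le n hφ)
  have e : (markovOp Q)^[n] φ x - ∫ y, (markovOp Q)^[n] φ y ∂(iterLaw Q k) =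
      ∫ y, ((markovOp Q)^[n] φ x - (markovOp Q)^[n] φ y) ∂(iterLaw Q k) := by
    rw [integral_sub (integrable_const _) hi]; simp
  rw [e]
  obtain ⟨hVi, hVb⟩ := h.iterLaw_bound k
  have hw : Integrable (fun y => a ^ n * ((1 + β * V x) + (1 + β * V y))) (iterLaw Q k) :=
    ((integrable_const _).add ((integrable_const _).add (hVi.const_mul β))).const_mul _
  refine abs_integral_le_integral_abs.trans ((integral_mono
    ((integrable_const _).sub hi).abs hw (H n φ hφ x)).trans ?_)
  have hVi' : Integrable (fun y => 1 + β * V y) (iterLaw Q k) :=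
    (integrable_const _).add (hVi.const_mul β)
  rw [integral_const_mul, integral_add (integrable_const _) hVi',
    integral_add (integrable_const _) (hVi.const_mul β), integral_const_mul]
  simp only [integral_const, probReal_univ, smul_eq_mul, one_mul]
  have han : 0 < a ^ n := pow_pos ha n
  rw [mul_comm (2 + β + β * D), mul_assoc]
  refine mul_le_mul_of_nonneg_left ?_ han.le
  have hVx := h.nonneg x
  have := mul_le_mul_of_nonneg_left hVb hβ.le
  have : 0 ≤ β * D := by positivity
  have : 0 ≤ β * D * V x := by positivity
  nlinarith

/-- The probability measure on `ℕ` with the given mass function. -/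
noncomputable def massMeasure (p : ℕ → ℝ) : Measure ℕ :=
  Measure.sum fun y => ENNReal.ofReal (p y) • Measure.dirac y

lemma massMeasure_singleton (p : ℕ → ℝ) (y : ℕ) : massMeasure p {y} = ENNReal.ofReal (p y) := by
  rw [massMeasure, Measure.sum_apply _ (measurableSet_singleton y), tsum_eq_single y]
  · simp
  · intro z hz
    simp [hz]

lemma isProbabilityMeasure_massMeasure {p : ℕ → ℝ} (h0 : ∀ y, 0 ≤ p y) (hs : HasSum p 1) :
    IsProbabilityMeasure (massMeasure p) := by
  constructor
  rw [massMeasure, Measure.sum_apply _ MeasurableSet.univ]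
  simp only [Measure.smul_apply, measure_univ, smul_eq_mul, mul_one]
  rw [← ENNReal.ofReal_tsum_of_nonneg h0 hs.summable, hs.tsum_eq, ENNReal.ofReal_one]

/-- The mass of each point converges by merging. The moment bound dominates these masses by a
multiple of `(V y)⁻¹`, and its summability prevents escape of mass, so integrals of all bounded
functions converge. Invariance follows by comparing the limits at times `n + 1` and `n`. -/
lemma HarrisPair.exists_invariant (h : HarrisPair Q V γ K) (hV : ∀ x, 0 < V x)
    (hVs : Summable fun x => (V x)⁻¹) :
    ∃ π : Measure ℕ, IsProbabilityMeasure π ∧ Kernel.Invariant Q π ∧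
      ∀ (φ : ℕ → ℝ) (B : ℝ), (∀ x, |φ x| ≤ B) →
        Tendsto (fun n => ∫ x, φ x ∂(iterLaw Q n)) atTop (𝓝 (∫ x, φ x ∂π)) := by
  obtain ⟨C, a, hC, ha, ha1, H⟩ := h.merging_iterLaw
  set D := V 0 + K / (1 - γ) with hD
  have hbound : ∀ n y, (iterLaw Q n).real {y} ≤ D * (V y)⁻¹ := fun n y => by
    obtain ⟨hVi, hVb⟩ := h.iterLaw_bound n
    have := (mul_le_integral_of_atom (r := y) h.nonneg hVi le_rfl).trans hVb
    rw [← div_eq_mul_inv, le_div_iff₀ (hV y)]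
    exact this
  have hint : ∀ (φ : ℕ → ℝ) (B : ℝ), (∀ x, |φ x| ≤ B) → ∀ (μ : Measure ℕ) [IsProbabilityMeasure μ],
      ∫ x, φ x ∂μ = ∑' y, μ.real {y} * φ y := fun φ B hφ μ _ => by
    rw [integral_countable (integrable_of_bdd_nat hφ)]
    simp
  have hlim : ∀ y, ∃ p, Tendsto (fun n => (iterLaw Q n).real {y}) atTop (𝓝 p) := fun y => by
    refine cauchySeq_tendsto_of_complete ?_
    refine cauchySeq_of_le_tendsto_0 (fun n => 2 * (C * a ^ n * (1 + V 0))) ?_ ?_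
    · intro n m N hn hm
      have hφ : ∀ x, |({y} : Set ℕ).indicator (fun _ => (1 : ℝ)) x| ≤ 1 := fun x => by
        by_cases hx : x = y <;> simp [hx]
      have hr : ∀ k, ∫ x, ({y} : Set ℕ).indicator (fun _ => (1 : ℝ)) x ∂(iterLaw Q k) =
          (iterLaw Q k).real {y} := fun k => by
        rw [integral_indicator (measurableSet_singleton y)]; simp [measureReal_def]
      have b1 := H N (n - N) _ hφ 0
      have b2 := H N (m - N) _ hφ 0
      rw [hr, show N + (n - N) = n by omega] at b1
      rw [hr, show N + (m - N) = m by omega] at b2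
      rw [Real.dist_eq, abs_le]
      rw [abs_le] at b1 b2
      constructor <;> linarith [b1.1, b1.2, b2.1, b2.2]
    · have := tendsto_pow_atTop_nhds_zero_of_lt_one ha.le ha1
      simpa using ((this.const_mul C).mul_const (1 + V 0)).const_mul 2
  choose p hp using hlim
  have hp0 : ∀ y, 0 ≤ p y := fun y => ge_of_tendsto' (hp y) fun n => measureReal_nonneg
  have hconv : ∀ (φ : ℕ → ℝ) (B : ℝ), (∀ x, |φ x| ≤ B) →
      Tendsto (fun n => ∫ x, φ x ∂(iterLaw Q n)) atTop (𝓝 (∑' y, p y * φ y)) := fun φ B hφ => by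
    simp_rw [hint φ B hφ]
    refine tendsto_tsum_of_dominated_convergence (bound := fun y => D * (V y)⁻¹ * B)
      ((hVs.mul_left D).mul_right B) (fun y => (hp y).mul_const _) ?_
    refine Eventually.of_forall fun n y => ?_
    rw [norm_mul, Real.norm_of_nonneg measureReal_nonneg]
    exact mul_le_mul (hbound n y) (hφ y) (abs_nonneg _)
      (measureReal_nonneg.trans (hbound n y))
  have hpb : ∀ y, p y ≤ D * (V y)⁻¹ := fun y => le_of_tendsto' (hp y) fun n => hbound n y
  have hps : Summable p := Summable.of_nonneg_of_le hp0 hpb (hVs.mul_left D)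
  have hsum : HasSum p 1 := by
    have h1 := hconv (fun _ => 1) 1 (by simp)
    simp only [integral_const, probReal_univ, smul_eq_mul, mul_one] at h1
    rw [← tendsto_nhds_unique h1 tendsto_const_nhds]
    exact hps.hasSum
  have hprob := isProbabilityMeasure_massMeasure hp0 hsum
  have hreal : ∀ y, (massMeasure p).real {y} = p y := fun y => by
    rw [measureReal_def, massMeasure_singleton, ENNReal.toReal_ofReal (hp0 y)]
  have hconv' : ∀ (φ : ℕ → ℝ) (B : ℝ), (∀ x, |φ x| ≤ B) →
      Tendsto (fun n => ∫ x, φ x ∂(iterLaw Q n)) atTop (𝓝 (∫ x, φ x ∂(massMeasure p))) := by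
    intro φ B hφ
    rw [hint φ B hφ (massMeasure p)]
    simp_rw [hreal]
    exact hconv φ B hφ
  refine ⟨massMeasure p, hprob, ?_, hconv'⟩
  refine Measure.ext fun A _ => ?_
  have hA : ∀ x, |A.indicator (fun _ => (1 : ℝ)) x| ≤ 1 := fun x => by
    by_cases hx : x ∈ A <;> simp [hx]
  have hr : ∀ (μ : Measure ℕ) [IsProbabilityMeasure μ],
      ∫ x, A.indicator (fun _ => (1 : ℝ)) x ∂μ = μ.real A := fun μ _ => by
    rw [integral_indicator MeasurableSet.of_discrete]; simp [measureReal_def]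
  have l1 := (tendsto_add_atTop_iff_nat 1).2 (hconv' _ 1 hA)
  have l2 := hconv' _ 1 (abs_markovOp_le (Q := Q) hA)
  have e : ∀ n, ∫ x, A.indicator (fun _ => (1 : ℝ)) x ∂(iterLaw Q (n + 1)) =
      ∫ x, markovOp Q (A.indicator fun _ => (1 : ℝ)) x ∂(iterLaw Q n) := fun n =>
    integral_bind_markovOp (integrable_of_bdd_nat hA)
  simp_rw [e] at l1
  have e2 := tendsto_nhds_unique l1 l2
  rw [← integral_bind_markovOp (integrable_of_bdd_nat hA), hr, hr] at e2
  rw [measureReal_def, measureReal_def,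
    ENNReal.toReal_eq_toReal_iff' (measure_ne_top _ _) (measure_ne_top _ _)] at e2
  exact e2.symm

/-- Under a geometric drift and a one-step minorization, a Markov kernel on `ℕ` has a unique
invariant probability measure, and its iterates converge to it geometrically. -/
theorem HarrisPair.geometric_ergodicity (h : HarrisPair Q V γ K) (hV : ∀ x, 0 < V x)
    (hVs : Summable fun x => (V x)⁻¹) :
    ∃ π : Measure ℕ, IsProbabilityMeasure π ∧ Kernel.Invariant Q π ∧
      (∀ π' : Measure ℕ, IsProbabilityMeasure π' → Kernel.Invariant Q π' → π' = π) ∧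
      ∃ C a : ℝ, 0 ≤ C ∧ 0 < a ∧ a < 1 ∧ ∀ (n : ℕ) (φ : ℕ → ℝ), (∀ x, |φ x| ≤ 1) →
        ∀ x, |(markovOp Q)^[n] φ x - ∫ y, φ y ∂π| ≤ C * a ^ n * (1 + V x) := by
  obtain ⟨π, hπ, hinv, hconv⟩ := h.exists_invariant hV hVs
  obtain ⟨C, a, hC, ha, ha1, H⟩ := h.merging_iterLaw
  have hmain : ∀ (n : ℕ) (φ : ℕ → ℝ), (∀ x, |φ x| ≤ 1) →
        ∀ x, |(markovOp Q)^[n] φ x - ∫ y, φ y ∂π| ≤ C * a ^ n * (1 + V x) := fun n φ hφ x => by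
    have l := (tendsto_add_atTop_iff_nat n).2 (hconv φ 1 hφ)
    refine le_of_tendsto' ((tendsto_const_nhds.sub l).abs) fun k => ?_
    rw [add_comm]
    exact H n k φ hφ x
  refine ⟨π, hπ, hinv, fun π' hπ' hinv' => ?_, C, a, hC, ha, ha1, hmain⟩
  refine Measure.ext fun A _ => ?_
  set φ : ℕ → ℝ := A.indicator fun _ => (1 : ℝ) with hφd
  have hA : ∀ x, |φ x| ≤ 1 := fun x => by
    by_cases hx : x ∈ A <;> simp [hφd, hx]
  have hr : ∀ (μ : Measure ℕ) [IsProbabilityMeasure μ], ∫ x, φ x ∂μ = μ.real A := fun μ _ => by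
    rw [hφd, integral_indicator MeasurableSet.of_discrete]; simp
  have hpt : ∀ x, Tendsto (fun n => (markovOp Q)^[n] φ x) atTop (𝓝 (∫ y, φ y ∂π)) := fun x => by
    rw [tendsto_iff_norm_sub_tendsto_zero]
    refine squeeze_zero (fun _ => norm_nonneg _) (fun n => hmain n φ hA x) ?_
    simpa using ((tendsto_pow_atTop_nhds_zero_of_lt_one ha.le ha1).const_mul C).mul_const (1 + V x)
  have l := tendsto_integral_of_dominated_convergence (μ := π') (fun _ => (1 : ℝ))
    (fun n => (measurable_of_countable ((markovOp Q)^[n] φ)).aestronglyMeasurable)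
    (integrable_const _) (fun n => ae_of_all _ (abs_markovOp_iterate_le n hA))
    (ae_of_all _ hpt)
  simp_rw [integral_invariant_iterate hinv' _ hA] at l
  have e := tendsto_nhds_unique l tendsto_const_nhds
  rw [integral_const, probReal_univ, one_smul, hr, hr] at e
  rw [measureReal_def, measureReal_def,
    ENNReal.toReal_eq_toReal_iff' (measure_ne_top _ _) (measure_ne_top _ _)] at e
  exact e.symm

end Harris

/-! ### Exponential moments and negative drift -/

/-- These are slopes of chords of a convex function from a common endpoint, hence monotone in `θ`.
This supplies the domination needed to differentiate the exponential moment at zero. -/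
lemma exp_sub_one_div_le {z θ θ₁ : ℝ} (h0 : 0 < θ) (h1 : θ ≤ θ₁) :
    (Real.exp (θ * z) - 1) / θ ≤ (Real.exp (θ₁ * z) - 1) / θ₁ := by
  have hθ₁ : 0 < θ₁ := h0.trans_le h1
  have hc := convexOn_exp.2 (Set.mem_univ (θ₁ * z)) (Set.mem_univ 0)
    (show 0 ≤ θ / θ₁ by positivity)
    (show 0 ≤ 1 - θ / θ₁ by rw [sub_nonneg, div_le_one hθ₁]; exact h1) (by ring)
  simp only [smul_eq_mul, mul_zero, add_zero, Real.exp_zero, mul_one] at hc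
  rw [show θ / θ₁ * (θ₁ * z) = θ * z by field_simp] at hc
  rw [div_le_div_iff₀ h0 hθ₁]
  have := mul_le_mul_of_nonneg_right hc hθ₁.le
  have e : (θ / θ₁ * Real.exp (θ₁ * z) + (1 - θ / θ₁)) * θ₁ =
      θ * Real.exp (θ₁ * z) + (θ₁ - θ) := by field_simp
  rw [e] at this
  linarith

/-- A variable with negative mean and some exponential moment has an exponential moment less than
one for all small positive exponents. -/
lemma eventually_integral_exp_lt_one {Ω : Type*} [MeasurableSpace Ω] {P : Measure Ω}
    [IsProbabilityMeasure P] {Z : Ω → ℝ} (hZ : Integrable Z P) {θ₁ : ℝ} (hθ₁ : 0 < θ₁)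
    (hexp : Integrable (fun ω => Real.exp (θ₁ * Z ω)) P) (hneg : ∫ ω, Z ω ∂P < 0) :
    ∀ᶠ θ in 𝓝[>] (0 : ℝ), Integrable (fun ω => Real.exp (θ * Z ω)) P ∧
      ∫ ω, Real.exp (θ * Z ω) ∂P < 1 := by
  have hIoo : ∀ᶠ θ in 𝓝[>] (0 : ℝ), θ ∈ Set.Ioo 0 θ₁ := Ioo_mem_nhdsGT hθ₁
  -- The difference quotients lie between `Z` and `g θ₁` and tend to `Z` as `θ` decreases to zero.
  -- Dominated convergence therefore gives their integrals the negative limit `∫ Z`, and `exp (θ *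
  -- Z) = 1 + θ * g θ`.
  set g : ℝ → Ω → ℝ := fun θ ω => (Real.exp (θ * Z ω) - 1) / θ with hg
  have hlow : ∀ θ ω, 0 < θ → Z ω ≤ g θ ω := fun θ ω hθ => by
    rw [hg, le_div_iff₀ hθ]
    linarith [Real.add_one_le_exp (θ * Z ω)]
  set b : Ω → ℝ := fun ω => |Z ω| + |g θ₁ ω| with hb
  have hbi : Integrable b P := hZ.abs.add ((hexp.sub (integrable_const 1)).div_const θ₁).abs
  have hbound : ∀ θ ∈ Set.Ioo 0 θ₁, ∀ ω, ‖g θ ω‖ ≤ b ω := fun θ hθ ω => by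
    have h1 := hlow θ ω hθ.1
    have h2 : g θ ω ≤ g θ₁ ω := exp_sub_one_div_le hθ.1 hθ.2.le
    rw [Real.norm_eq_abs, abs_le]
    have := neg_abs_le (Z ω)
    have := le_abs_self (g θ₁ ω)
    have := abs_nonneg (Z ω)
    have := abs_nonneg (g θ₁ ω)
    constructor <;> simp only [hb] <;> linarith
  have hmeas : ∀ θ, AEStronglyMeasurable (g θ) P := fun θ => by
    have hc : Continuous fun x : ℝ => (Real.exp (θ * x) - 1) / θ := by fun_prop
    exact hc.comp_aestronglyMeasurable hZ.aestronglyMeasurable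
  have hlim : Tendsto (fun θ => ∫ ω, g θ ω ∂P) (𝓝[>] 0) (𝓝 (∫ ω, Z ω ∂P)) := by
    refine tendsto_integral_filter_of_dominated_convergence b (Eventually.of_forall hmeas)
      (hIoo.mono fun θ hθ => ae_of_all _ (hbound θ hθ)) hbi (ae_of_all _ fun ω => ?_)
    have hd : HasDerivAt (fun θ : ℝ => Real.exp (θ * Z ω)) (Z ω) 0 := by
      have := ((hasDerivAt_id (0 : ℝ)).mul_const (Z ω)).exp
      simpa using this
    have := hd.tendsto_slope_zero_right
    refine this.congr fun θ => ?_
    simp [hg, div_eq_inv_mul]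
  filter_upwards [hIoo, hlim.eventually (gt_mem_nhds hneg)] with θ hθ hlt
  have hgi : Integrable (g θ) P := hbi.mono' (hmeas θ) (ae_of_all _ (hbound θ hθ))
  have he : ∀ ω, Real.exp (θ * Z ω) = θ * g θ ω + 1 := fun ω => by
    simp only [hg]; field_simp [hθ.1.ne']; ring
  simp_rw [he]
  refine ⟨(hgi.const_mul θ).add (integrable_const _), ?_⟩
  rw [integral_add (hgi.const_mul θ) (integrable_const _), integral_const_mul]
  simp only [integral_const, probReal_univ, smul_eq_mul, mul_one]
  nlinarith [hθ.1]

/-! ### The linear test function for the unstable orbit -/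

/-- Under the hypotheses on the loads there is a direction `(κ, 1)` in which the drift is positive
whatever orbits are empty. -/
lemma exists_drift_direction {L0 L1 a0 a1 m0 m1 : ℝ} (hL0 : 0 < L0) (hL1 : 0 < L1) (ha0 : 0 < a0)
    (ha1 : 0 < a1) (hm0 : 0 < m0) (hm1 : 0 < m1)
    (h2 : a1 * m1 / (L1 * m1 + a1 * m1) < L0 * m0 + L1 * m1) :
    ∃ κ : ℝ, 0 < κ ∧ a1 < (L0 * m0 + L1 * m1 + a1 * m1) * (L1 + κ * L0) ∧
      a1 + κ * a0 < (L0 * m0 + L1 * m1 + a0 * m0 + a1 * m1) * (L1 + κ * L0) ∧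
      κ * a0 < (L0 * m0 + L1 * m1 + a0 * m0) * (L1 + κ * L0) := by
  have hden : 0 < L1 * m1 + a1 * m1 := by positivity
  rw [div_lt_iff₀ hden] at h2
  -- This form of the second load condition has the common factor `m1` removed.
  have h2' : a1 * (1 - L0 * m0) < L1 * (L0 * m0 + L1 * m1 + a1 * m1) := by
    have : m1 * (a1 * (1 - L0 * m0)) < m1 * (L1 * (L0 * m0 + L1 * m1 + a1 * m1)) := by
      nlinarith
    exact lt_of_mul_lt_mul_left this hm1.le
  set A := L0 * m0 + L1 * m1 + a1 * m1 with hA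
  have hApos : 0 < A := by positivity
  -- The least nonnegative `κ` for which the drift with only the second orbit non-empty is
  -- nonnegative.
  set κ0 := max 0 ((a1 / A - L1) / L0) with hκ0
  have hκ00 : 0 ≤ κ0 := le_max_left _ _
  have hb1 : a1 ≤ A * (L1 + κ0 * L0) := by
    have : (a1 / A - L1) / L0 ≤ κ0 := le_max_right _ _
    rw [div_le_iff₀ hL0] at this
    have h3 : a1 / A ≤ L1 + κ0 * L0 := by linarith
    rw [div_le_iff₀ hApos] at h3
    linarith
  -- Equivalently, a service started from the first orbit raises `x 1 + κ0 * x 0` on average: the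
  -- mean gain `m0 * (L1 + κ0 * L0)` exceeds the loss `κ0`. For `κ0 > 0` this is exactly `h2'`,
  -- after substituting the value of `κ0`.
  have hκm : κ0 * (1 - L0 * m0) < L1 * m0 := by
    rcases le_total ((a1 / A - L1) / L0) 0 with hc | hc
    · rw [hκ0, max_eq_left hc]; simp only [zero_mul]; positivity
    · have e1 : κ0 * L0 = a1 / A - L1 := by
        rw [hκ0, max_eq_right hc]; field_simp
      have e2 : κ0 * L0 * A = a1 - L1 * A := by
        rw [e1]; field_simp
      have e3 : L0 * A * (κ0 * (1 - L0 * m0)) < L0 * A * (L1 * m0) := by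
        have : L0 * A * (κ0 * (1 - L0 * m0)) = (a1 - L1 * A) * (1 - L0 * m0) := by
          rw [← e2]; ring
        rw [this]
        nlinarith
      exact lt_of_mul_lt_mul_left e3 (by positivity)
  have key : κ0 * a0 < a0 * m0 * (L1 + κ0 * L0) := by
    have : a0 * (κ0 * (1 - L0 * m0)) < a0 * (L1 * m0) := mul_lt_mul_of_pos_left hκm ha0
    nlinarith
  have hb2 : a1 + κ0 * a0 < (L0 * m0 + L1 * m1 + a0 * m0 + a1 * m1) * (L1 + κ0 * L0) := by
    have : (L0 * m0 + L1 * m1 + a0 * m0 + a1 * m1) * (L1 + κ0 * L0) =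
        A * (L1 + κ0 * L0) + a0 * m0 * (L1 + κ0 * L0) := by rw [hA]; ring
    rw [this]; linarith
  have hb3 : κ0 * a0 < (L0 * m0 + L1 * m1 + a0 * m0) * (L1 + κ0 * L0) := by
    have : 0 ≤ (L0 * m0 + L1 * m1) * (L1 + κ0 * L0) := by positivity
    nlinarith
  -- The first inequality is only weak at `κ0`. A slight increase of `κ` makes it strict, and the
  -- other two, already strict, persist by continuity.
  have c2 : ∀ᶠ κ in 𝓝[>] κ0,
      a1 + κ * a0 < (L0 * m0 + L1 * m1 + a0 * m0 + a1 * m1) * (L1 + κ * L0) :=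
    (nhdsWithin_le_nhds) ((ContinuousAt.eventually_lt (by fun_prop) (by fun_prop) hb2))
  have c3 : ∀ᶠ κ in 𝓝[>] κ0, κ * a0 < (L0 * m0 + L1 * m1 + a0 * m0) * (L1 + κ * L0) :=
    (nhdsWithin_le_nhds) ((ContinuousAt.eventually_lt (by fun_prop) (by fun_prop) hb3))
  obtain ⟨κ, h2, h3, hκ⟩ := (c2.and (c3.and self_mem_nhdsWithin)).exists
  have hκ' : κ0 < κ := hκ
  refine ⟨κ, hκ00.trans_lt hκ', ?_, h2, h3⟩
  have : A * (κ0 * L0) < A * (κ * L0) := by gcongr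
  nlinarith

/-! ### Service times with failure rate bounded from below -/

/-- The density is at least `c` times the tail, so a window of length `1 / c` carries at least the
mass lying beyond it. Hence the tail at least halves over each such window. -/
lemma ClassD.measure_Ioi_half {μ : Measure ℝ} [IsProbabilityMeasure μ] (h : ClassD μ) :
    ∃ d : ℝ, 0 < d ∧ ∀ n : ℕ, μ (Set.Ioi (n * d)) ≤ (2⁻¹ : ENNReal) ^ n := by
  obtain ⟨-, f, hf, hf0, hμ, c, hc, hfc⟩ := h
  refine ⟨1 / c, by positivity, fun n => ?_⟩
  have hG : ∀ x, 1 - cdf μ x = μ.real (Set.Ioi x) := fun x => by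
    rw [cdf_eq_real, ← probReal_compl_eq_one_sub measurableSet_Iic, Set.compl_Iic]
  have hstep : ∀ x, 0 ≤ x → μ (Set.Ioi (x + 1 / c)) ≤ μ (Set.Ioc x (x + 1 / c)) := by
    intro x hx
    set y := x + 1 / c with hy
    have hxy : y - x = 1 / c := by rw [hy]; ring
    calc μ (Set.Ioi y) = ENNReal.ofReal (c * (1 - cdf μ y)) * volume (Set.Ioc x y) := by
          rw [Real.volume_Ioc, hxy, hG, ← ENNReal.ofReal_mul (by positivity)]
          rw [show c * μ.real (Set.Ioi y) * (1 / c) = μ.real (Set.Ioi y) by field_simp]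
          rw [ofReal_measureReal]
      _ = ∫⁻ _ in Set.Ioc x y, ENNReal.ofReal (c * (1 - cdf μ y)) := by
          rw [setLIntegral_const]
      _ ≤ ∫⁻ t in Set.Ioc x y, ENNReal.ofReal (f t) := by
          refine setLIntegral_mono' measurableSet_Ioc fun t ht => ENNReal.ofReal_le_ofReal ?_
          have hmono : 1 - cdf μ y ≤ 1 - cdf μ t := by
            have := monotone_cdf μ ht.2
            linarith
          by_cases hpos : 0 < 1 - cdf μ t
          · have := hfc t (hx.trans ht.1.le) hpos
            rw [le_div_iff₀ hpos] at this
            nlinarith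
          · push Not at hpos
            have := hf0 t
            nlinarith
      _ = μ (Set.Ioc x y) := by
          conv_rhs => rw [hμ]
          rw [withDensity_apply _ measurableSet_Ioc]
  induction n with
  | zero => simpa using prob_le_one
  | succ n ih =>
    have hx : (0 : ℝ) ≤ n * (1 / c) := by positivity
    have e : ((n + 1 : ℕ) : ℝ) * (1 / c) = n * (1 / c) + 1 / c := by push_cast; ring
    rw [e]
    set x := (n : ℝ) * (1 / c)
    have hun : μ (Set.Ioi x) = μ (Set.Ioc x (x + 1 / c)) + μ (Set.Ioi (x + 1 / c)) := by
      rw [← measure_union _ measurableSet_Ioi, Set.Ioc_union_Ioi_eq_Ioi]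
      · have : 0 < 1 / c := by positivity
        linarith
      · exact Set.disjoint_left.2 fun t ht ht' => absurd ht.2 (not_le.2 ht')
    have h2 : 2 * μ (Set.Ioi (x + 1 / c)) ≤ μ (Set.Ioi x) := by
      rw [hun, two_mul]
      exact add_le_add_left (hstep x hx) _
    rw [pow_succ']
    calc μ (Set.Ioi (x + 1 / c)) = 2⁻¹ * (2 * μ (Set.Ioi (x + 1 / c))) := by
          rw [← mul_assoc, ENNReal.inv_mul_cancel (by simp) (by simp), one_mul]
      _ ≤ 2⁻¹ * (2⁻¹ : ENNReal) ^ n := by gcongr; exact h2.trans ih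

lemma ClassD.exists_lintegral_exp_lt_top {μ : Measure ℝ} [IsProbabilityMeasure μ] (h : ClassD μ) :
    ∃ θ : ℝ, 0 < θ ∧ ∫⁻ x, ENNReal.ofReal (Real.exp (θ * x)) ∂μ < ⊤ := by
  obtain ⟨d, hd, htail⟩ := h.measure_Ioi_half
  have hlog : 0 < Real.log (3 / 2) := Real.log_pos (by norm_num)
  -- With this exponent the exponential grows by a factor `3 / 2` over a length `d` while the tail
  -- halves, leaving a geometric series of ratio `3 / 4`.
  refine ⟨Real.log (3 / 2) / d, by positivity, ?_⟩
  set θ := Real.log (3 / 2) / d with hθ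
  have hθd : θ * d = Real.log (3 / 2) := by rw [hθ]; field_simp
  have hθ0 : 0 < θ := by positivity
  have hpt : ∀ x, ENNReal.ofReal (Real.exp (θ * x)) ≤ 1 + ∑' n : ℕ,
      (Set.Ioi (n * d)).indicator (fun _ => ENNReal.ofReal ((3 / 2) ^ (n + 1))) x := by
    intro x
    rcases le_or_gt x 0 with hx | hx
    · refine le_add_right ?_
      rw [ENNReal.ofReal_le_one, Real.exp_le_one_iff]
      exact mul_nonpos_of_nonneg_of_nonpos hθ0.le hx
    · refine le_add_left ?_
      obtain ⟨n, hn⟩ : ∃ n, ⌈x / d⌉₊ = n + 1 :=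
        Nat.exists_eq_succ_of_ne_zero (Nat.ceil_pos.2 (by positivity)).ne'
      refine le_trans ?_ (ENNReal.le_tsum n)
      have h1 : (n : ℝ) < x / d := Nat.lt_ceil.1 (by omega)
      have h2 : x / d ≤ ((n + 1 : ℕ) : ℝ) := by rw [← hn]; exact Nat.le_ceil _
      rw [lt_div_iff₀ hd] at h1
      rw [div_le_iff₀ hd] at h2
      rw [Set.indicator_of_mem (Set.mem_Ioi.2 h1)]
      refine ENNReal.ofReal_le_ofReal ?_
      calc Real.exp (θ * x) ≤ Real.exp (((n + 1 : ℕ) : ℝ) * Real.log (3 / 2)) := by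
            rw [Real.exp_le_exp, ← hθd]
            nlinarith
        _ = (3 / 2) ^ (n + 1) := by rw [Real.exp_nat_mul, Real.exp_log (by norm_num)]
  refine (lintegral_mono hpt).trans_lt ?_
  rw [lintegral_add_left measurable_const, lintegral_tsum fun n =>
    (measurable_const.indicator measurableSet_Ioi).aemeasurable]
  simp only [lintegral_const, measure_univ, mul_one]
  refine ENNReal.add_lt_top.2 ⟨ENNReal.one_lt_top, ?_⟩
  have hs : Summable fun n : ℕ => (3 / 2 : ℝ) * (3 / 4) ^ n :=
    (summable_geometric_of_lt_one (by norm_num) (by norm_num)).mul_left _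
  refine lt_of_le_of_lt (ENNReal.tsum_le_tsum fun n => ?_) hs.tsum_ofReal_lt_top
  rw [lintegral_indicator_const measurableSet_Ioi]
  calc _ ≤ ENNReal.ofReal ((3 / 2) ^ (n + 1)) * (2⁻¹ : ENNReal) ^ n := by gcongr; exact htail n
    _ = ENNReal.ofReal ((3 / 2) ^ (n + 1)) * ENNReal.ofReal (2⁻¹ ^ n) := by
        rw [ENNReal.ofReal_pow (by norm_num) n (p := 2⁻¹), ENNReal.ofReal_inv_of_pos (by norm_num)]
        simp
    _ = ENNReal.ofReal (3 / 2 * (3 / 4) ^ n) := by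
        rw [← ENNReal.ofReal_mul (by positivity)]
        congr 1
        rw [pow_succ, mul_comm _ (3 / 2 : ℝ), mul_assoc, ← mul_pow]
        norm_num
    _ ≤ _ := le_rfl

lemma ClassD.ae_nonneg {μ : Measure ℝ} (h : ClassD μ) : ∀ᵐ x ∂μ, 0 ≤ x := by
  rw [ae_iff]
  simpa [Set.Iio] using h.1

lemma ClassD.ae_pos {μ : Measure ℝ} (h : ClassD μ) : ∀ᵐ x ∂μ, 0 < x := by
  have h0 : μ {0} = 0 := by
    obtain ⟨-, f, -, -, hμ, -⟩ := h
    rw [hμ]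
    exact withDensity_absolutelyContinuous _ _ (measure_singleton _)
  have h1 : ∀ᵐ x ∂μ, x ≠ 0 := by
    rw [ae_iff]; simpa using h0
  filter_upwards [h.ae_nonneg, h1] with x hx hx'
  exact lt_of_le_of_ne hx hx'.symm

lemma ClassD.integrable_id {μ : Measure ℝ} [IsProbabilityMeasure μ] (h : ClassD μ) :
    Integrable (fun x : ℝ => x) μ := by
  obtain ⟨θ, hθ, hlt⟩ := h.exists_lintegral_exp_lt_top
  have hi : Integrable (fun x => Real.exp (θ * x)) μ := by
    refine ⟨by fun_prop, ?_⟩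
    rw [hasFiniteIntegral_iff_ofReal (ae_of_all _ fun x => (Real.exp_pos _).le)]
    exact hlt
  refine (hi.div_const θ).mono' (by fun_prop) ?_
  filter_upwards [h.ae_nonneg] with x hx
  rw [Real.norm_of_nonneg hx, le_div_iff₀ hθ]
  linarith [Real.add_one_le_exp (θ * x)]

lemma ClassD.integral_id_pos {μ : Measure ℝ} [IsProbabilityMeasure μ] (h : ClassD μ) :
    0 < ∫ x, x ∂μ := by
  rw [integral_pos_iff_support_of_nonneg_ae h.ae_nonneg h.integrable_id]
  have : μ (Function.support fun x : ℝ => x) = 1 := by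
    rw [← mem_ae_iff_prob_eq_one (measurableSet_support measurable_id')]
    filter_upwards [h.ae_pos] with x hx using hx.ne'
  rw [this]
  exact one_pos

lemma ClassD.exists_Icc_pos {μ : Measure ℝ} [IsProbabilityMeasure μ] (h : ClassD μ) :
    ∃ a b : ℝ, 0 < a ∧ 0 < b ∧ 0 < μ (Set.Icc a b) := by
  by_contra! hcon
  have hnull : μ (⋃ n : ℕ, Set.Icc (1 / ((n : ℝ) + 1)) (n + 1)) = 0 :=
    measure_iUnion_null fun n => le_antisymm (hcon _ _ (by positivity) (by positivity)) bot_le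
  have hae : ∀ᵐ x ∂μ, False := by
    filter_upwards [h.ae_pos, measure_eq_zero_iff_ae_notMem.1 hnull] with x hx hx'
    apply hx'
    obtain ⟨n, hn⟩ := exists_nat_gt (max x (1 / x))
    refine Set.mem_iUnion.2 ⟨n, ?_, ?_⟩
    · have := (le_max_right _ _).trans_lt hn
      rw [div_le_iff₀ (by positivity)]
      rw [div_lt_iff₀ hx] at this
      nlinarith
    · linarith [(le_max_left x (1 / x)).trans_lt hn]
  simp at hae
  exact IsProbabilityMeasure.ne_zero μ hae

/-! ### Counting the arrivals of a Poisson stream -/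

/-- Expresses the cardinality through a countable sum of indicators, from which measurability is
visible. The conventions agree for infinite sets: `ncard` and `ENNReal.toReal ⊤` are both zero. -/
lemma arrivalsBy_eq_floor (g : ℕ → ℝ) (s : ℝ) :
    arrivalsBy g s = ⌊(∑' i, {i : ℕ | ∑ l ∈ Finset.range (i + 1), g l ≤ s}.indicator
      (fun _ => (1 : ENNReal)) i).toReal⌋₊ := by
  rw [← tsum_subtype, ENNReal.tsum_set_one, arrivalsBy, Set.ncard_def]
  cases h : {i : ℕ | ∑ l ∈ Finset.range (i + 1), g l ≤ s}.encard <;> simp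

lemma measurable_arrivalsBy : Measurable fun p : ℝ × (ℕ → ℝ) => arrivalsBy p.2 p.1 := by
  simp_rw [arrivalsBy_eq_floor]
  refine Nat.measurable_floor.comp (ENNReal.measurable_toReal.comp (Measurable.tsum fun i => ?_))
  have : MeasurableSet {p : ℝ × (ℕ → ℝ) | ∑ l ∈ Finset.range (i + 1), p.2 l ≤ p.1} :=
    measurableSet_le (by fun_prop) (by fun_prop)
  exact (measurable_const.indicator this : Measurable
    ({p : ℝ × (ℕ → ℝ) | ∑ l ∈ Finset.range (i + 1), p.2 l ≤ p.1}.indicator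
      fun _ => (1 : ENNReal)))

/-- Law of the sequence of gaps of a Poisson stream of rate `r`. -/
noncomputable def gapLaw (r : ℝ) : Measure (ℕ → ℝ) := Measure.infinitePi fun _ => expMeasure r

/-- Law of the number of points of a Poisson stream of rate `r` in an independent time interval
with law `F`. -/
noncomputable def countLaw (r : ℝ) (F : Measure ℝ) : Measure ℕ :=
  (F.prod (gapLaw r)).map fun p => arrivalsBy p.2 p.1

/-- Density of the Erlang law with `n + 1` phases. -/
noncomputable def erlangPDF (r : ℝ) (n : ℕ) (x : ℝ) : ENNReal :=
  ENNReal.ofReal (if 0 ≤ x then r ^ (n + 1) * (x ^ n / n.factorial) * Real.exp (-(r * x)) else 0)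

lemma measurable_erlangPDF (r : ℝ) (n : ℕ) : Measurable (erlangPDF r n) := by
  unfold erlangPDF
  refine ENNReal.measurable_ofReal.comp (Measurable.ite measurableSet_Ici ?_ measurable_const)
  fun_prop

lemma expMeasure_eq_withDensity_erlangPDF (r : ℝ) :
    expMeasure r = volume.withDensity (erlangPDF r 0) := by
  have : erlangPDF r 0 = gammaPDF 1 r := by
    ext x
    change _ = exponentialPDF r x
    rw [exponentialPDF_eq]
    simp [erlangPDF]
  rw [this]
  rfl

lemma setLIntegral_Icc_ofReal {f : ℝ → ℝ} (hf : Continuous f) {x : ℝ} (hx : 0 ≤ x)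
    (h0 : ∀ y, 0 ≤ y → 0 ≤ f y) :
    ∫⁻ y in Set.Icc 0 x, ENNReal.ofReal (f y) = ENNReal.ofReal (∫ y in (0 : ℝ)..x, f y) := by
  rw [← ofReal_integral_eq_lintegral_ofReal (hf.integrableOn_Icc)
    ((ae_restrict_iff' measurableSet_Icc).2 (ae_of_all _ fun y hy => h0 y hy.1)),
    intervalIntegral.integral_of_le hx, integral_Icc_eq_integral_Ioc]

lemma erlangPDF_lconvolution {r : ℝ} (hr : 0 < r) (n : ℕ) :
    erlangPDF r n ⋆ₗ erlangPDF r 0 = erlangPDF r (n + 1) := by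
  ext x
  rw [lconvolution_def]
  have hpt : ∀ y, erlangPDF r n y * erlangPDF r 0 (-y + x) = (Set.Icc 0 x).indicator
      (fun y => ENNReal.ofReal (r ^ (n + 2) / n.factorial * Real.exp (-(r * x)) * y ^ n)) y := by
    intro y
    by_cases h1 : 0 ≤ y
    · by_cases h2 : y ≤ x
      · rw [Set.indicator_of_mem (Set.mem_Icc.2 ⟨h1, h2⟩), erlangPDF, erlangPDF, if_pos h1,
          if_pos (by linarith), ← ENNReal.ofReal_mul (by positivity)]
        congr 1
        have : Real.exp (-(r * x)) = Real.exp (-(r * y)) * Real.exp (-(r * (-y + x))) := by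
          rw [← Real.exp_add]; ring_nf
        rw [this]
        simp only [Nat.factorial_zero, pow_zero]
        push_cast
        ring
      · rw [Set.indicator_of_notMem (fun h => h2 h.2), erlangPDF, erlangPDF,
          if_neg (by linarith : ¬ 0 ≤ -y + x)]
        simp
    · rw [Set.indicator_of_notMem (fun h => h1 h.1), erlangPDF, if_neg h1]
      simp
  simp_rw [hpt]
  rw [lintegral_indicator measurableSet_Icc]
  by_cases hx : 0 ≤ x
  · rw [setLIntegral_Icc_ofReal (by fun_prop) hx (fun y hy => by positivity),
      intervalIntegral.integral_const_mul, integral_pow, erlangPDF, if_pos hx]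
    congr 1
    rw [Nat.factorial_succ]
    push_cast
    field_simp
    ring
  · rw [Set.Icc_eq_empty hx, erlangPDF, if_neg hx]
    simp

lemma isProbabilityMeasure_gapLaw {r : ℝ} (hr : 0 < r) : IsProbabilityMeasure (gapLaw r) := by
  have := isProbabilityMeasure_expMeasure hr
  unfold gapLaw
  infer_instance

/-- The arrival epochs of a Poisson stream have Erlang laws. -/
lemma map_sum_gapLaw {r : ℝ} (hr : 0 < r) (n : ℕ) :
    (gapLaw r).map (fun g => ∑ l ∈ Finset.range (n + 1), g l) =
      volume.withDensity (erlangPDF r n) := by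
  have := isProbabilityMeasure_expMeasure hr
  have hP := isProbabilityMeasure_gapLaw hr
  have hev : ∀ k, (gapLaw r).map (fun g => g k) = expMeasure r := fun k =>
    Measure.infinitePi_map_eval _ k
  have hind : iIndepFun (fun (k : ℕ) (g : ℕ → ℝ) => g k) (gapLaw r) :=
    iIndepFun_infinitePi (X := fun _ x => x) fun _ => measurable_id
  induction n with
  | zero => simp [hev, expMeasure_eq_withDensity_erlangPDF]
  | succ n ih =>
    have hi := hind.indepFun_sum_range_succ (fun k => measurable_pi_apply k) (n + 1)
    have e : (∑ j ∈ Finset.range (n + 1), fun g : ℕ → ℝ => g j) =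
        fun g => ∑ l ∈ Finset.range (n + 1), g l := by
      ext g; simp
    rw [e] at hi
    have hc := hi.map_add_eq_map_conv_map (by fun_prop) (by fun_prop)
    rw [ih, hev, expMeasure_eq_withDensity_erlangPDF,
      conv_withDensity_eq_lconvolution (measurable_erlangPDF r n) (measurable_erlangPDF r 0),
      erlangPDF_lconvolution hr] at hc
    rw [← hc]
    congr 1
    ext g
    rw [Finset.sum_range_succ]
    rfl

/-- Up to the factor `r * exp (-(r * x))`, the terms are those of the exponential series at `r * z *
x`. -/
lemma tsum_pow_mul_erlangPDF {r z : ℝ} (hr : 0 < r) (hz : 0 ≤ z) {x : ℝ} (hx : 0 ≤ x) :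
    ∑' n, ENNReal.ofReal (z ^ n) * erlangPDF r n x =
      ENNReal.ofReal (r * Real.exp (r * (z - 1) * x)) := by
  have h1 : ∀ n : ℕ, ENNReal.ofReal (z ^ n) * erlangPDF r n x =
      ENNReal.ofReal (r * Real.exp (-(r * x)) * ((r * z * x) ^ n / n.factorial)) := fun n => by
    rw [erlangPDF, if_pos hx, ← ENNReal.ofReal_mul (by positivity)]
    congr 1
    rw [mul_pow, mul_pow, pow_succ]
    ring
  have hs : HasSum (fun n : ℕ => r * Real.exp (-(r * x)) * ((r * z * x) ^ n / n.factorial))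
      (r * Real.exp (-(r * x)) * Real.exp (r * z * x)) := by
    have := NormedSpace.expSeries_div_hasSum_exp (r * z * x)
    rw [← Real.exp_eq_exp_ℝ] at this
    exact this.mul_left _
  simp_rw [h1]
  rw [← ENNReal.ofReal_tsum_of_nonneg (fun n => by positivity) hs.summable, hs.tsum_eq, mul_assoc,
    ← Real.exp_add]
  ring_nf

/-- Generating function of the expected arrival epochs in `[0, s]`. -/
lemma lintegral_tsum_pow_arrivals {r z : ℝ} (hr : 0 < r) (hz : 0 ≤ z) {s : ℝ} (hs : 0 ≤ s) :
    ∫⁻ g, ∑' i, {i : ℕ | ∑ l ∈ Finset.range (i + 1), g l ≤ s}.indicator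
      (fun i => ENNReal.ofReal (z ^ i)) i ∂(gapLaw r) =
      ENNReal.ofReal (∫ x in (0 : ℝ)..s, r * Real.exp (r * (z - 1) * x)) := by
  have hset : ∀ i : ℕ, MeasurableSet {g : ℕ → ℝ | ∑ l ∈ Finset.range (i + 1), g l ≤ s} := fun i =>
    measurableSet_le (by fun_prop) measurable_const
  have hind : ∀ (i : ℕ) (g : ℕ → ℝ), {i : ℕ | ∑ l ∈ Finset.range (i + 1), g l ≤ s}.indicator
      (fun i => ENNReal.ofReal (z ^ i)) i = {g : ℕ → ℝ | ∑ l ∈ Finset.range (i + 1), g l ≤ s}.indicator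
      (fun _ => ENNReal.ofReal (z ^ i)) g := fun i g => rfl
  simp_rw [hind]
  rw [lintegral_tsum fun i => (measurable_const.indicator (hset i)).aemeasurable]
  have h1 : ∀ i : ℕ, ∫⁻ g, {g : ℕ → ℝ | ∑ l ∈ Finset.range (i + 1), g l ≤ s}.indicator
      (fun _ => ENNReal.ofReal (z ^ i)) g ∂(gapLaw r) =
      ∫⁻ x in Set.Icc 0 s, ENNReal.ofReal (z ^ i) * erlangPDF r i x := fun i => by
    rw [lintegral_indicator_const (hset i)]
    have : gapLaw r {g | ∑ l ∈ Finset.range (i + 1), g l ≤ s} =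
        ∫⁻ x in Set.Icc 0 s, erlangPDF r i x := by
      have e := map_sum_gapLaw hr i
      calc _ = (gapLaw r).map (fun g => ∑ l ∈ Finset.range (i + 1), g l) (Set.Iic s) := by
            rw [Measure.map_apply (by fun_prop) measurableSet_Iic]; rfl
        _ = ∫⁻ x in Set.Iic s, erlangPDF r i x := by
            rw [e, withDensity_apply _ measurableSet_Iic]
        _ = _ := by
            rw [← lintegral_indicator measurableSet_Iic, ← lintegral_indicator measurableSet_Icc]
            refine lintegral_congr fun x => ?_
            by_cases hx : 0 ≤ x
            · simp [Set.indicator, hx]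
            · simp [Set.indicator, hx, erlangPDF]
    rw [this, lintegral_const_mul _ (measurable_erlangPDF r i)]
  simp_rw [h1]
  rw [← lintegral_tsum fun i => ((measurable_erlangPDF r i).const_mul _).aemeasurable]
  rw [setLIntegral_congr_fun measurableSet_Icc fun x hx => tsum_pow_mul_erlangPDF hr hz hx.1]
  exact setLIntegral_Icc_ofReal (by fun_prop) hs fun y _ => by positivity

/-- Expected number of points of a Poisson stream. -/
lemma lintegral_arrivalsBy {r : ℝ} (hr : 0 < r) {s : ℝ} (hs : 0 ≤ s) :
    ∫⁻ g, (arrivalsBy g s : ENNReal) ∂(gapLaw r) = ENNReal.ofReal (r * s) := by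
  have h := lintegral_tsum_pow_arrivals hr zero_le_one hs
  simp only [one_pow, ENNReal.ofReal_one, sub_self, mul_zero, zero_mul, Real.exp_zero, mul_one,
    intervalIntegral.integral_const, sub_zero, smul_eq_mul] at h
  have hm : Measurable fun g : ℕ → ℝ => ∑' i, {i : ℕ | ∑ l ∈ Finset.range (i + 1), g l ≤ s}.indicator
      (fun _ => (1 : ENNReal)) i := by
    refine Measurable.tsum fun i => ?_
    have : MeasurableSet {g : ℕ → ℝ | ∑ l ∈ Finset.range (i + 1), g l ≤ s} :=
      measurableSet_le (by fun_prop) measurable_const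
    exact (measurable_const.indicator this : Measurable
      ({g : ℕ → ℝ | ∑ l ∈ Finset.range (i + 1), g l ≤ s}.indicator fun _ => (1 : ENNReal)))
  -- Finiteness is needed before counting, since `ncard` would send an infinite set of arrivals to
  -- zero.
  have hfin := ae_lt_top hm (by rw [h]; exact ENNReal.ofReal_ne_top)
  rw [mul_comm r s, ← h]
  refine lintegral_congr_ae ?_
  filter_upwards [hfin] with g hg
  rw [← tsum_subtype, ENNReal.tsum_set_one] at hg ⊢
  have hne : {i : ℕ | ∑ l ∈ Finset.range (i + 1), g l ≤ s}.encard ≠ ⊤ := fun h => by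
    rw [h] at hg; simp at hg
  rw [arrivalsBy, ← (Set.encard_ne_top_iff.1 hne).cast_ncard_eq]
  simp

/-- Equality holds for an initial segment, by the geometric sum; any other set of the same size has
larger elements. The bound thus controls exponential moments of a count through the arrival epochs,
without proving that the counted indices form an initial segment. -/
lemma pow_card_le_one_add_sum {z : ℝ} (hz : 1 ≤ z) (A : Finset ℕ) :
    z ^ A.card ≤ 1 + (z - 1) * ∑ i ∈ A, z ^ i := by
  induction A using Finset.induction_on_max with
  | empty => simp
  | insert m A hm ih =>
    have hmA : m ∉ A := fun h => lt_irrefl _ (hm m h)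
    rw [Finset.card_insert_of_notMem hmA, Finset.sum_insert hmA, pow_succ]
    have hc : A.card ≤ m := by
      have : A ⊆ Finset.range m := fun i hi => Finset.mem_range.2 (hm i hi)
      simpa using Finset.card_le_card this
    have := pow_le_pow_right₀ hz hc
    nlinarith

lemma ofReal_pow_arrivalsBy_le {z : ℝ} (hz : 1 ≤ z) (g : ℕ → ℝ) (s : ℝ) :
    ENNReal.ofReal (z ^ arrivalsBy g s) ≤ 1 + ENNReal.ofReal (z - 1) *
      ∑' i, {i : ℕ | ∑ l ∈ Finset.range (i + 1), g l ≤ s}.indicator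
        (fun i => ENNReal.ofReal (z ^ i)) i := by
  set A := {i : ℕ | ∑ l ∈ Finset.range (i + 1), g l ≤ s} with hA
  by_cases hf : A.Finite
  · have h1 : arrivalsBy g s = hf.toFinset.card := Set.ncard_eq_toFinset_card A hf
    rw [h1]
    have h0 : ∀ i ∈ hf.toFinset, 0 ≤ z ^ i := fun i _ => by positivity
    refine (ENNReal.ofReal_le_ofReal (pow_card_le_one_add_sum hz hf.toFinset)).trans ?_
    rw [ENNReal.ofReal_add one_pos.le (mul_nonneg (by linarith) (Finset.sum_nonneg h0)),
      ENNReal.ofReal_one, ENNReal.ofReal_mul (by linarith), ENNReal.ofReal_sum_of_nonneg h0]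
    gcongr
    refine le_trans (le_of_eq ?_) (ENNReal.sum_le_tsum hf.toFinset)
    refine Finset.sum_congr rfl fun i hi => ?_
    rw [Set.indicator_of_mem (hf.mem_toFinset.1 hi)]
  · have h1 : arrivalsBy g s = 0 := Set.Infinite.ncard hf
    rw [h1]
    simp

variable {r : ℝ} {F : Measure ℝ}

lemma isProbabilityMeasure_countLaw [IsProbabilityMeasure F] (hr : 0 < r) :
    IsProbabilityMeasure (countLaw r F) := by
  have := isProbabilityMeasure_gapLaw hr
  exact Measure.isProbabilityMeasure_map measurable_arrivalsBy.aemeasurable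

lemma lintegral_countLaw (hr : 0 < r) (h : ℕ → ENNReal) :
    ∫⁻ n, h n ∂(countLaw r F) = ∫⁻ s, ∫⁻ g, h (arrivalsBy g s) ∂(gapLaw r) ∂F := by
  have := isProbabilityMeasure_gapLaw hr
  have hm : Measurable fun p : ℝ × (ℕ → ℝ) => h (arrivalsBy p.2 p.1) :=
    (measurable_of_countable h).comp measurable_arrivalsBy
  rw [countLaw, lintegral_map (measurable_of_countable h) measurable_arrivalsBy,
    lintegral_prod _ hm.aemeasurable]

lemma integral_countLaw [IsProbabilityMeasure F] (hr : 0 < r) (hF : ClassD F) :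
    Integrable (fun n : ℕ => (n : ℝ)) (countLaw r F) ∧
      ∫ n : ℕ, (n : ℝ) ∂(countLaw r F) = r * ∫ x, x ∂F := by
  have h1 : ∫⁻ n : ℕ, ENNReal.ofReal (n : ℝ) ∂(countLaw r F) =
      ENNReal.ofReal (r * ∫ x, x ∂F) := by
    rw [lintegral_countLaw hr]
    simp only [ENNReal.ofReal_natCast]
    rw [← integral_const_mul, ofReal_integral_eq_lintegral_ofReal (hF.integrable_id.const_mul r)]
    · refine lintegral_congr_ae ?_
      filter_upwards [hF.ae_nonneg] with s hs using lintegral_arrivalsBy hr hs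
    · filter_upwards [hF.ae_nonneg] with s hs using mul_nonneg hr.le hs
  have hi : Integrable (fun n : ℕ => (n : ℝ)) (countLaw r F) := by
    refine ⟨(measurable_of_countable _).aestronglyMeasurable, ?_⟩
    rw [hasFiniteIntegral_iff_ofReal (ae_of_all _ fun n => Nat.cast_nonneg n), h1]
    exact ENNReal.ofReal_lt_top
  refine ⟨hi, ?_⟩
  rw [integral_eq_lintegral_of_nonneg_ae (ae_of_all _ fun n => Nat.cast_nonneg n)
    hi.aestronglyMeasurable, h1, ENNReal.toReal_ofReal]
  exact mul_nonneg hr.le hF.integral_id_pos.le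

lemma exists_integrable_exp_countLaw [IsProbabilityMeasure F] (hr : 0 < r) (hF : ClassD F) :
    ∃ θ : ℝ, 0 < θ ∧ Integrable (fun n : ℕ => Real.exp (θ * n)) (countLaw r F) := by
  obtain ⟨η, hη, hlt⟩ := hF.exists_lintegral_exp_lt_top
  have hP := isProbabilityMeasure_gapLaw hr
  -- Chosen so that `r * (z - 1) = η`: the moment of `z ^ N` for a Poisson count over a service is
  -- then controlled by the exponential moment of the service time at `η`.
  set z : ℝ := 1 + η / r with hz
  have hz1 : 1 < z := by rw [hz]; linarith [div_pos hη hr]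
  have hrz : r * (z - 1) = η := by rw [hz]; field_simp; ring
  refine ⟨Real.log z, Real.log_pos hz1, ?_⟩
  have e : ∀ n : ℕ, Real.exp (Real.log z * n) = z ^ n := fun n => by
    rw [mul_comm, Real.exp_nat_mul, Real.exp_log (by linarith)]
  simp_rw [e]
  refine ⟨(measurable_of_countable _).aestronglyMeasurable, ?_⟩
  rw [hasFiniteIntegral_iff_ofReal (ae_of_all _ fun n => by positivity), lintegral_countLaw hr]
  have hb : ∀ᵐ s ∂F, ∫⁻ g, ENNReal.ofReal (z ^ arrivalsBy g s) ∂(gapLaw r) ≤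
      1 + ENNReal.ofReal (Real.exp (η * s)) := by
    filter_upwards [hF.ae_nonneg] with s hs
    refine (lintegral_mono fun g => ofReal_pow_arrivalsBy_le hz1.le g s).trans ?_
    rw [lintegral_add_left measurable_const, lintegral_const_mul' _ _ ENNReal.ofReal_ne_top,
      lintegral_tsum_pow_arrivals hr (by linarith) hs, lintegral_const, measure_univ, mul_one, hrz,
      ← ENNReal.ofReal_mul (by linarith)]
    gcongr
    have hint : ∫ x in (0 : ℝ)..s, r * Real.exp (η * x) = r / η * (Real.exp (η * s) - 1) := by
      rw [intervalIntegral.integral_const_mul, intervalIntegral.integral_comp_mul_left (fun x => Real.exp x) hη.ne']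
      simp
      field_simp
    rw [hint, hz]
    have : (1 + η / r - 1) * (r / η * (Real.exp (η * s) - 1)) = Real.exp (η * s) - 1 := by
      field_simp
      ring
    rw [this]
    linarith
  refine (lintegral_mono_ae hb).trans_lt ?_
  rw [lintegral_add_left measurable_const]
  simp only [lintegral_const, measure_univ, mul_one]
  exact ENNReal.add_lt_top.2 ⟨ENNReal.one_lt_top, hlt⟩

lemma expMeasure_Icc_pos (hr : 0 < r) {a b : ℝ} (ha : 0 ≤ a) (hab : a < b) :
    0 < expMeasure r (Set.Icc a b) := by
  rw [expMeasure_eq_withDensity_erlangPDF, withDensity_apply _ measurableSet_Icc,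
    setLIntegral_pos_iff (measurable_erlangPDF r 0)]
  have : Set.Icc a b ⊆ Function.support (erlangPDF r 0) := fun x hx => by
    have hx0 : 0 ≤ x := ha.trans hx.1
    rw [Function.mem_support, erlangPDF, if_pos hx0, ne_eq, ENNReal.ofReal_eq_zero, not_le]
    simp only [Nat.factorial_zero, pow_zero]
    positivity
  rw [Set.inter_eq_right.2 this, Real.volume_Icc, ENNReal.ofReal_pos]
  linarith

lemma expMeasure_ae_nonneg (r : ℝ) : ∀ᵐ x ∂(expMeasure r), 0 ≤ x := by
  rw [ae_iff, expMeasure_eq_withDensity_erlangPDF, withDensity_apply]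
  · rw [setLIntegral_congr_fun (g := fun _ => 0) (by measurability) fun x hx => ?_]
    · simp
    · rw [erlangPDF, if_neg hx]; simp
  · measurability

lemma arrivalsBy_eq_of_box {g : ℕ → ℝ} {s a b : ℝ} {k : ℕ} (hs : s ∈ Set.Icc a b)
    (hg0 : ∀ i, 0 ≤ g i) (hsmall : ∀ i < k, g i ≤ a / (k + 1)) (hbig : b < g k) (ha : 0 < a) :
    arrivalsBy g s = k := by
  have : {i : ℕ | ∑ l ∈ Finset.range (i + 1), g l ≤ s} = (Finset.range k : Set ℕ) := by
    ext i
    simp only [Set.mem_ofPred_eq, Finset.coe_range, Set.mem_Iio]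
    constructor
    · intro h
      by_contra hik
      have h1 : g k ≤ ∑ l ∈ Finset.range (i + 1), g l :=
        Finset.single_le_sum (fun l _ => hg0 l) (Finset.mem_range.2 (by omega))
      linarith [hs.2]
    · intro hik
      have h1 : ∑ l ∈ Finset.range (i + 1), g l ≤ ∑ _l ∈ Finset.range (i + 1), a / (k + 1) :=
        Finset.sum_le_sum fun l hl => hsmall l (by have := Finset.mem_range.1 hl; omega)
      rw [Finset.sum_const, Finset.card_range, nsmul_eq_mul] at h1
      have h2 : ((i + 1 : ℕ) : ℝ) * (a / (k + 1)) ≤ a := by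
        rw [mul_div_assoc', div_le_iff₀ (by positivity), mul_comm]
        have : ((i + 1 : ℕ) : ℝ) ≤ k + 1 := by
          have : i + 1 ≤ k := hik
          calc ((i + 1 : ℕ) : ℝ) ≤ k := by exact_mod_cast this
            _ ≤ k + 1 := by linarith
        exact mul_le_mul_of_nonneg_left this ha.le
      linarith [hs.1]
  rw [arrivalsBy, this, Set.ncard_coe_finset, Finset.card_range]

/-- Confine the service time to `[a, b]`, make the first `k` gaps so short that they sum to at most
`a`, and make the next gap longer than `b`. This box has positive probability and forces exactly `k`
arrivals. -/
lemma countLaw_singleton_pos [IsProbabilityMeasure F] (hr : 0 < r) (hF : ClassD F) (k : ℕ) :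
    0 < countLaw r F {k} := by
  have hE := isProbabilityMeasure_expMeasure hr
  have hP := isProbabilityMeasure_gapLaw hr
  obtain ⟨a, b, ha, hb, hab⟩ := hF.exists_Icc_pos
  set t : ℕ → Set ℝ := fun i => if i < k then Set.Icc 0 (a / (k + 1)) else Set.Icc (b + 1) (b + 2)
    with ht
  have hbox : 0 < gapLaw r ((Finset.range (k + 1) : Set ℕ).pi t) := by
    rw [gapLaw, Measure.infinitePi_pi _ fun i _ => by
      simp only [ht]; split_ifs <;> exact measurableSet_Icc]
    refine CanonicallyOrderedAdd.prod_pos.2 fun i _ => ?_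
    simp only [ht]
    split_ifs
    · exact expMeasure_Icc_pos hr le_rfl (by positivity)
    · exact expMeasure_Icc_pos hr (by linarith) (by linarith)
  have hnn : ∀ᵐ g ∂(gapLaw r), ∀ i, 0 ≤ g i := by
    rw [ae_all_iff]
    intro i
    have h1 := expMeasure_ae_nonneg r
    rw [← Measure.infinitePi_map_eval (fun _ : ℕ => expMeasure r) i] at h1
    exact ae_of_ae_map (measurable_pi_apply i).aemeasurable h1
  rw [countLaw, Measure.map_apply measurable_arrivalsBy (measurableSet_singleton k)]
  have hprod : 0 < (F.prod (gapLaw r)) (Set.Icc a b ×ˢ (Finset.range (k + 1) : Set ℕ).pi t) := by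
    rw [Measure.prod_prod]
    exact ENNReal.mul_pos hab.ne' hbox.ne'
  have hnn' : ∀ᵐ p ∂(F.prod (gapLaw r)), ∀ i, 0 ≤ p.2 i :=
    Measure.quasiMeasurePreserving_snd.ae hnn
  refine hprod.trans_le (measure_mono_ae ?_)
  filter_upwards [hnn'] with p hp hpb
  have h2 : ∀ i, i < k + 1 → p.2 i ∈ t i := fun i hi => hpb.2 i (by simpa using hi)
  refine arrivalsBy_eq_of_box hpb.1 hp (fun i hi => ?_) ?_ ha
  · have := h2 i (by omega)
    simp only [ht, if_pos hi] at this
    exact this.2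
  · have := h2 k (by omega)
    simp only [ht, lt_irrefl, if_false] at this
    linarith [this.1]

/-! ### Competing exponential clocks and the count of arrivals during the next service -/

section Product

lemma comap_reindex_le {I X γ : Type*} [MeasurableSpace X] (k : γ → I) :
    MeasurableSpace.comap (fun (w : I → X) c => w (k c)) MeasurableSpace.pi ≤
      ⨆ i ∈ Set.range k, MeasurableSpace.comap (fun w : I → X => w i) inferInstance := by
  rw [MeasurableSpace.pi, MeasurableSpace.comap_iSup]
  refine iSup_le fun c => ?_
  rw [MeasurableSpace.comap_comp]
  exact le_iSup₂_of_le (k c) ⟨c, rfl⟩ le_rfl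

/-- Two disjoint families of coordinates are independent under a product measure. -/
lemma indepFun_reindex {I X α β : Type*} [MeasurableSpace X] {μ : I → Measure X}
    [∀ i, IsProbabilityMeasure (μ i)] {f : α → I} {g : β → I} (hfg : ∀ a b, f a ≠ g b) :
    IndepFun (fun (w : I → X) a => w (f a)) (fun (w : I → X) b => w (g b))
      (Measure.infinitePi μ) := by
  have hi : iIndep (fun i => MeasurableSpace.comap (fun w : I → X => w i) inferInstance)
      (Measure.infinitePi μ) :=
    (iIndepFun_infinitePi (P := μ) (X := fun _ x => x) fun _ => measurable_id).iIndep
  have hdis : Disjoint (Set.range f) (Set.range g) := by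
    rw [Set.disjoint_left]
    rintro _ ⟨a, rfl⟩ ⟨b, hb⟩
    exact hfg a b hb.symm
  have h := indep_iSup_of_disjoint (fun i => (measurable_pi_apply i).comap_le) hi hdis
  rw [IndepFun_iff_Indep]
  exact indep_of_indep_of_le_left (indep_of_indep_of_le_right h (comap_reindex_le g))
    (comap_reindex_le f)

variable {I O E : Type*} {μ : I → Measure ℝ} [∀ i, IsProbabilityMeasure (μ i)]

lemma measurable_count (g : ℕ → I) (s : I) :
    Measurable fun w : I → ℝ => arrivalsBy (fun i => w (g i)) (w s) :=
  measurable_arrivalsBy.comp (f := fun w : I → ℝ => (w s, fun i => w (g i)))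
    ((measurable_pi_apply s).prodMk (measurable_pi_lambda _ fun i => measurable_pi_apply (g i)))

lemma map_count {g : ℕ → I} (hg : Function.Injective g) {s : I} (hgs : ∀ n, g n ≠ s) {r : ℝ}
    (hr : 0 < r) (hgμ : ∀ n, μ (g n) = expMeasure r) :
    (Measure.infinitePi μ).map (fun w => arrivalsBy (fun i => w (g i)) (w s)) =
      countLaw r (μ s) := by
  have := isProbabilityMeasure_expMeasure hr
  have hi : IndepFun (fun w : I → ℝ => w s) (fun (w : I → ℝ) n => w (g n))
      (Measure.infinitePi μ) :=
    (indepFun_reindex (μ := μ) (f := fun _ : Unit => s) (g := g) fun _ n => (hgs n).symm).comp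
      (φ := fun v : Unit → ℝ => v ()) (ψ := id) (measurable_pi_apply ()) measurable_id
  have hm : Measurable fun (w : I → ℝ) n => w (g n) :=
    measurable_pi_lambda _ fun n => measurable_pi_apply (g n)
  have h1 := (indepFun_iff_map_prod_eq_prod_map_map (measurable_pi_apply s).aemeasurable
    hm.aemeasurable).1 hi
  rw [Measure.infinitePi_map_eval, Measure.map_infinitePi_infinitePi_of_inj hg] at h1
  simp_rw [hgμ] at h1
  rw [countLaw, gapLaw, ← h1, Measure.map_map measurable_arrivalsBy
    ((measurable_pi_apply s).prodMk hm)]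
  rfl

lemma expMeasure_Ici {r : ℝ} (hr : 0 < r) {t : ℝ} (ht : 0 ≤ t) :
    expMeasure r (Set.Ici t) = ENNReal.ofReal (Real.exp (-(r * t))) := by
  have := isProbabilityMeasure_expMeasure hr
  have h0 : expMeasure r {t} = 0 := by
    rw [expMeasure_eq_withDensity_erlangPDF]
    exact withDensity_absolutelyContinuous _ _ (measure_singleton _)
  have h1 : expMeasure r (Set.Ici t) = expMeasure r (Set.Ioi t) := by
    rw [← Set.Ioi_union_left, Set.union_comm]
    refine le_antisymm ((measure_union_le _ _).trans (by rw [h0, zero_add]))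
      (measure_mono Set.subset_union_right)
  rw [h1, ← ofReal_measureReal, ← Set.compl_Iic, probReal_compl_eq_one_sub measurableSet_Iic,
    ← cdf_eq_real, cdf_expMeasure_eq hr, if_pos ht]
  congr 1
  ring

/-- Probability that a given one of several independent exponential clocks rings first. -/
lemma infinitePi_exp_first {rate : O → ℝ} (hrate : ∀ o, 0 < rate o) (S : Finset O) {o : O}
    (ho : o ∈ S) :
    Measure.infinitePi (fun o => expMeasure (rate o)) {c : O → ℝ | ∀ o' ∈ S, c o ≤ c o'} =
      ENNReal.ofReal (rate o / ∑ o' ∈ S, rate o') := by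
  classical
  have := fun o => isProbabilityMeasure_expMeasure (hrate o)
  set W := Measure.infinitePi (fun o => expMeasure (rate o)) with hW
  set T := S.erase o with hT
  have hi : IndepFun (fun c : O → ℝ => c o) (fun (c : O → ℝ) (t : T) => c t) W :=
    (indepFun_reindex (μ := fun o => expMeasure (rate o)) (f := fun _ : Unit => o)
      (g := fun t : T => (t : O)) fun _ t => (Finset.ne_of_mem_erase t.2).symm).comp
      (φ := fun v : Unit → ℝ => v ()) (ψ := id) (measurable_pi_apply ()) measurable_id
  have hm : Measurable fun (c : O → ℝ) (t : T) => c t :=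
    measurable_pi_lambda _ fun t => measurable_pi_apply (t : O)
  have h1 := (indepFun_iff_map_prod_eq_prod_map_map (measurable_pi_apply o).aemeasurable
    hm.aemeasurable).1 hi
  have hset : MeasurableSet {p : ℝ × (T → ℝ) | ∀ t, p.1 ≤ p.2 t} := by
    rw [Set.ofPred_forall]
    exact MeasurableSet.iInter fun t => measurableSet_le (by fun_prop) (by fun_prop)
  have h2 : W {c : O → ℝ | ∀ o' ∈ S, c o ≤ c o'} =
      W.map (fun c => (c o, fun t : T => c t)) {p | ∀ t, p.1 ≤ p.2 t} := by
    rw [Measure.map_apply ((measurable_pi_apply o).prodMk hm) hset]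
    congr 1
    ext c
    simp only [Set.mem_ofPred_eq, Set.mem_preimage]
    constructor
    · exact fun h t => h t (Finset.mem_of_mem_erase t.2)
    · intro h o' ho'
      by_cases hoo : o' = o
      · rw [hoo]
      · exact h ⟨o', Finset.mem_erase.2 ⟨hoo, ho'⟩⟩
  have hev : W.map (fun c => c o) = expMeasure (rate o) := Measure.infinitePi_map_eval _ o
  rw [h2, h1, hev, Measure.prod_apply hset]
  -- Given that clock `o` rings at `t`, the others are all later with probability equal to the
  -- product of their exponential tails. Integrating against the density of clock `o` leaves an
  -- exponential density of rate `Λ` with prefactor `rate o / Λ`.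
  have hinner : ∀ t, 0 ≤ t → (W.map fun c (t : T) => c t) (Prod.mk t ⁻¹' {p | ∀ t, p.1 ≤ p.2 t}) =
      ENNReal.ofReal (Real.exp (-((∑ o' ∈ T, rate o') * t))) := by
    intro t ht
    rw [Measure.map_apply hm (measurable_prodMk_left hset)]
    have e : (fun (c : O → ℝ) (t : T) => c t) ⁻¹' (Prod.mk t ⁻¹' {p | ∀ t, p.1 ≤ p.2 t}) =
        (T : Set O).pi fun _ => Set.Ici t := by
      ext c
      simp [Set.mem_pi]
    rw [e, hW, Measure.infinitePi_pi _ fun _ _ => measurableSet_Ici]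
    rw [Finset.prod_congr rfl fun o' _ => expMeasure_Ici (hrate o') ht,
      ← ENNReal.ofReal_prod_of_nonneg fun _ _ => (Real.exp_pos _).le, ← Real.exp_sum,
      Finset.sum_neg_distrib, Finset.sum_mul]
  have hae : ∀ᵐ t ∂(expMeasure (rate o)),
      (W.map fun c (t : T) => c t) (Prod.mk t ⁻¹' {p | ∀ t, p.1 ≤ p.2 t}) =
      ENNReal.ofReal (Real.exp (-((∑ o' ∈ T, rate o') * t))) := by
    filter_upwards [expMeasure_ae_nonneg (rate o)] with t ht using hinner t ht
  rw [lintegral_congr_ae hae, expMeasure_eq_withDensity_erlangPDF,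
    lintegral_withDensity_eq_lintegral_mul _ (measurable_erlangPDF _ 0) (by fun_prop)]
  have hsum : ∑ o' ∈ S, rate o' = rate o + ∑ o' ∈ T, rate o' :=
    (Finset.add_sum_erase S rate ho).symm
  set Λ := ∑ o' ∈ S, rate o' with hΛ
  have hΛpos : 0 < Λ := Finset.sum_pos (fun o _ => hrate o) ⟨o, ho⟩
  have hpt : ∀ t, (erlangPDF (rate o) 0 *
      fun t => ENNReal.ofReal (Real.exp (-((∑ o' ∈ T, rate o') * t)))) t =
      ENNReal.ofReal (rate o / Λ) * erlangPDF Λ 0 t := fun t => by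
    rw [Pi.mul_apply, erlangPDF, erlangPDF]
    split_ifs with ht
    · have hro := hrate o
      rw [← ENNReal.ofReal_mul (by positivity), ← ENNReal.ofReal_mul (by positivity)]
      congr 1
      have : Real.exp (-(Λ * t)) = Real.exp (-(rate o * t)) *
          Real.exp (-((∑ o' ∈ T, rate o') * t)) := by
        rw [← Real.exp_add, hsum]; ring_nf
      rw [this]
      simp
      field_simp
    · simp
  simp_rw [hpt]
  rw [lintegral_const_mul _ (measurable_erlangPDF _ 0)]
  have hone : ∫⁻ t, erlangPDF Λ 0 t = 1 := by
    have := isProbabilityMeasure_expMeasure hΛpos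
    rw [← setLIntegral_univ, ← withDensity_apply _ MeasurableSet.univ,
      ← expMeasure_eq_withDensity_erlangPDF, measure_univ]
  rw [hone, mul_one]

/-- A selector of the first clock among those in `S` picks each clock with probability proportional
to its rate. -/
lemma infinitePi_exp_selector [Finite O] {rate : O → ℝ} (hrate : ∀ o, 0 < rate o) {S : Finset O}
    {e : (O → ℝ) → O} (he : ∀ o, MeasurableSet {c | e c = o})
    (heS : ∀ c, e c ∈ S ∧ ∀ o' ∈ S, c (e c) ≤ c o') {o : O} (ho : o ∈ S) :
    Measure.infinitePi (fun o => expMeasure (rate o)) {c | e c = o} =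
      ENNReal.ofReal (rate o / ∑ o' ∈ S, rate o') := by
  classical
  have := fun o => isProbabilityMeasure_expMeasure (hrate o)
  set W := Measure.infinitePi (fun o => expMeasure (rate o)) with hW
  -- The event that `o` is selected lies in the event that `o` is a minimizer, which bounds its
  -- probability by the rate share. Both families sum to one over `S`, so every inequality is an
  -- equality; ties need no separate treatment.
  have hle : ∀ o ∈ S, W {c | e c = o} ≤ ENNReal.ofReal (rate o / ∑ o' ∈ S, rate o') :=
    fun o ho => by
      rw [← infinitePi_exp_first hrate S ho]
      exact measure_mono fun c hc o' ho' => hc ▸ (heS c).2 o' ho'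
  have hΛpos : 0 < ∑ o' ∈ S, rate o' := Finset.sum_pos (fun o _ => hrate o) ⟨o, ho⟩
  have hsum1 : ∑ o ∈ S, W {c | e c = o} = 1 := by
    rw [← measure_biUnion_finset (fun a _ b _ hab => Set.disjoint_left.2 fun c hc hc' =>
      hab (hc.symm.trans hc')) fun o _ => he o]
    have : (⋃ o ∈ S, {c | e c = o}) = Set.univ := by
      ext c
      simp [(heS c).1]
    rw [this, measure_univ]
  have hsum2 : ∑ o ∈ S, ENNReal.ofReal (rate o / ∑ o' ∈ S, rate o') = 1 := by
    rw [← ENNReal.ofReal_sum_of_nonneg fun o _ => by have := hrate o; positivity,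
      ← Finset.sum_div, div_self hΛpos.ne', ENNReal.ofReal_one]
  refine le_antisymm (hle o ho) ?_
  by_contra hlt
  push Not at hlt
  have hle' : ∑ o' ∈ S.erase o, W {c | e c = o'} ≤
      ∑ o' ∈ S.erase o, ENNReal.ofReal (rate o' / ∑ o' ∈ S, rate o') :=
    Finset.sum_le_sum fun o' ho' => hle o' (Finset.mem_of_mem_erase ho')
  have hne : ∑ o' ∈ S.erase o, W {c | e c = o'} ≠ ⊤ :=
    (ENNReal.sum_lt_top.2 fun _ _ => measure_lt_top _ _).ne
  have := ENNReal.add_lt_add_of_lt_of_le hne hlt hle'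
  rw [Finset.add_sum_erase S (fun o => W {c | e c = o}) ho, Finset.add_sum_erase S
    (fun o' => ENNReal.ofReal (rate o' / ∑ o' ∈ S, rate o')) ho] at this
  rw [hsum1, hsum2] at this
  exact lt_irrefl _ this

variable [MeasurableSpace E]

lemma measurable_selected [Finite O] {clk : O → I} {e : (O → ℝ) → O}
    (he : ∀ o, MeasurableSet {c | e c = o}) (svc : O → I) (g : ℕ → I) (h : O → ℕ → E) :
    Measurable fun w : I → ℝ => h (e fun o => w (clk o))
      (arrivalsBy (fun i => w (g i)) (w (svc (e fun o => w (clk o))))) := by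
  have hclk : Measurable fun (w : I → ℝ) o => w (clk o) :=
    measurable_pi_lambda _ fun o => measurable_pi_apply (clk o)
  intro A hA
  have : (fun w : I → ℝ => h (e fun o => w (clk o))
      (arrivalsBy (fun i => w (g i)) (w (svc (e fun o => w (clk o)))))) ⁻¹' A =
      ⋃ o, (fun (w : I → ℝ) o => w (clk o)) ⁻¹' {c | e c = o} ∩
        (fun w : I → ℝ => arrivalsBy (fun i => w (g i)) (w (svc o))) ⁻¹' (h o ⁻¹' A) := by
    ext w
    simp
  rw [this]
  exact MeasurableSet.iUnion fun o =>
    (hclk (he o)).inter (measurable_count g (svc o) MeasurableSet.of_discrete)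

/-- Joint law of the selected clock and of the number of arrivals during the corresponding
service. -/
theorem map_selected [Finite O] {clk : O → I} (hclk : Function.Injective clk) {rate : O → ℝ}
    (hrate : ∀ o, 0 < rate o) (hclkμ : ∀ o, μ (clk o) = expMeasure (rate o)) {S : Finset O}
    {e : (O → ℝ) → O} (he : ∀ o, MeasurableSet {c | e c = o})
    (heS : ∀ c, e c ∈ S ∧ ∀ o' ∈ S, c (e c) ≤ c o') {svc : O → I} {g : ℕ → I}
    (hg : Function.Injective g) {r : ℝ} (hr : 0 < r) (hgμ : ∀ n, μ (g n) = expMeasure r)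
    (hsc : ∀ o o', svc o ≠ clk o') (hgc : ∀ n o, g n ≠ clk o) (hgs : ∀ n o, g n ≠ svc o)
    (h : O → ℕ → E) :
    (Measure.infinitePi μ).map (fun w => h (e fun o => w (clk o))
      (arrivalsBy (fun i => w (g i)) (w (svc (e fun o => w (clk o)))))) =
      ∑ o ∈ S, ENNReal.ofReal (rate o / ∑ o' ∈ S, rate o') •
        (countLaw r (μ (svc o))).map (h o) := by
  have hexp := fun o => isProbabilityMeasure_expMeasure (hrate o)
  have hmclk : Measurable fun (w : I → ℝ) o => w (clk o) :=
    measurable_pi_lambda _ fun o => measurable_pi_apply (clk o)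
  refine Measure.ext fun A hA => ?_
  rw [Measure.map_apply (measurable_selected he svc g h) hA, Measure.finsetSum_apply]
  have hun : (fun w : I → ℝ => h (e fun o => w (clk o))
      (arrivalsBy (fun i => w (g i)) (w (svc (e fun o => w (clk o)))))) ⁻¹' A =
      ⋃ o ∈ S, (fun (w : I → ℝ) o => w (clk o)) ⁻¹' {c | e c = o} ∩
        (fun w : I → ℝ => arrivalsBy (fun i => w (g i)) (w (svc o))) ⁻¹' (h o ⁻¹' A) := by
    ext w
    simp [(heS fun o => w (clk o)).1]
  rw [hun, measure_biUnion_finset]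
  rotate_left
  · intro a _ b _ hab
    refine Set.disjoint_left.2 fun w hw hw' => hab (hw.1.symm.trans hw'.1)
  · exact fun o _ => (hmclk (he o)).inter (measurable_count g (svc o) MeasurableSet.of_discrete)
  refine Finset.sum_congr rfl fun o ho => ?_
  -- Once the winner `o` is fixed, the count involves only its service time and the gaps,
  -- coordinates disjoint from the clocks. The index `Option ℕ` packs the service time as `none` and
  -- the gaps as `some i`.
  have hind : IndepFun (fun (w : I → ℝ) o => w (clk o))
      (fun w : I → ℝ => arrivalsBy (fun i => w (g i)) (w (svc o))) (Measure.infinitePi μ) :=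
    (indepFun_reindex (μ := μ) (f := clk) (g := fun k : Option ℕ => k.elim (svc o) g) (by
      rintro o' (_ | n)
      · exact (hsc o o').symm
      · exact (hgc n o').symm)).comp (φ := id)
      (ψ := fun v : Option ℕ → ℝ => arrivalsBy (fun i => v (some i)) (v none))
      measurable_id (measurable_count (fun i => some i) none)
  rw [hind.measure_inter_preimage_eq_mul _ _ (he o) MeasurableSet.of_discrete,
    Measure.smul_apply, smul_eq_mul, Measure.map_apply (measurable_of_countable _) hA]
  congr 1
  · rw [← infinitePi_exp_selector hrate he heS ho, ← Measure.map_apply hmclk (he o),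
      Measure.map_infinitePi_infinitePi_of_inj hclk]
    simp_rw [hclkμ]
  · rw [← map_count hg (fun n => hgs n o) hr hgμ, Measure.map_apply (measurable_count g (svc o))
      MeasurableSet.of_discrete]

lemma integral_selected [Finite O] {clk : O → I} (hclk : Function.Injective clk) {rate : O → ℝ}
    (hrate : ∀ o, 0 < rate o) (hclkμ : ∀ o, μ (clk o) = expMeasure (rate o)) {S : Finset O}
    {e : (O → ℝ) → O} (he : ∀ o, MeasurableSet {c | e c = o})
    (heS : ∀ c, e c ∈ S ∧ ∀ o' ∈ S, c (e c) ≤ c o') {svc : O → I} {g : ℕ → I}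
    (hg : Function.Injective g) {r : ℝ} (hr : 0 < r) (hgμ : ∀ n, μ (g n) = expMeasure r)
    (hsc : ∀ o o', svc o ≠ clk o') (hgc : ∀ n o, g n ≠ clk o) (hgs : ∀ n o, g n ≠ svc o)
    {h : O → ℕ → ℝ} (hi : ∀ o ∈ S, Integrable (h o) (countLaw r (μ (svc o)))) :
    Integrable (fun w => h (e fun o => w (clk o))
      (arrivalsBy (fun i => w (g i)) (w (svc (e fun o => w (clk o)))))) (Measure.infinitePi μ) ∧
    ∫ w, h (e fun o => w (clk o))
      (arrivalsBy (fun i => w (g i)) (w (svc (e fun o => w (clk o))))) ∂(Measure.infinitePi μ) =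
      ∑ o ∈ S, rate o / (∑ o' ∈ S, rate o') * ∫ n, h o n ∂(countLaw r (μ (svc o))) := by
  have hm := measurable_selected (clk := clk) he svc g h
  have hlaw := map_selected hclk hrate hclkμ he heS hg hr hgμ hsc hgc hgs h
  have hi' : ∀ o ∈ S, Integrable (fun z : ℝ => z)
      (ENNReal.ofReal (rate o / ∑ o' ∈ S, rate o') • (countLaw r (μ (svc o))).map (h o)) :=
    fun o ho => Integrable.smul_measure ((integrable_map_measure
      aestronglyMeasurable_id (measurable_of_countable _).aemeasurable).2 (hi o ho))
      ENNReal.ofReal_ne_top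
  constructor
  · refine (integrable_map_measure (g := fun z : ℝ => z) aestronglyMeasurable_id
      hm.aemeasurable).1 ?_
    rw [hlaw, integrable_finsetSum_measure]
    exact hi'
  · rw [← integral_map (f := fun z : ℝ => z) hm.aemeasurable aestronglyMeasurable_id, hlaw,
      integral_finsetSum_measure hi']
    refine Finset.sum_congr rfl fun o ho => ?_
    have h0 : 0 ≤ rate o / ∑ o' ∈ S, rate o' :=
      div_nonneg (hrate o).le (Finset.sum_nonneg fun o _ => (hrate o).le)
    rw [integral_smul_measure, integral_map (f := fun z : ℝ => z)
      (measurable_of_countable _).aemeasurable aestronglyMeasurable_id, ENNReal.toReal_ofReal h0, smul_eq_mul]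

end Product

/-! ### One cycle of the two-orbit system -/

/-- Origins as a sum type. -/
def originEquiv : Fin 2 ⊕ Fin 2 ≃ Origin where
  toFun := Sum.elim Origin.external Origin.orbital
  invFun
    | .external k => Sum.inl k
    | .orbital k => Sum.inr k
  left_inv := by rintro (k | k) <;> rfl
  right_inv := by rintro (k | k) <;> rfl

instance : Fintype Origin := Fintype.ofEquiv _ originEquiv

lemma sum_origin {M : Type*} [AddCommMonoid M] (f : Origin → M) :
    ∑ o, f o = f (.external 0) + f (.external 1) + (f (.orbital 0) + f (.orbital 1)) := by
  rw [← originEquiv.sum_comp, Fintype.sum_sum_type, Fin.sum_univ_two, Fin.sum_univ_two]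
  rfl

/-- The ingredient carrying the clock of an origin. -/
def Origin.ingredient : Origin → Ingredient
  | .external k => .arrival k
  | .orbital k => .retrial k

lemma Origin.ingredient_injective : Function.Injective Origin.ingredient := by
  rintro (k | k) (l | l) h <;> simp_all [Origin.ingredient]

/-- Rate of the clock of an origin. -/
def Origin.rate (lam al : Fin 2 → ℝ) : Origin → ℝ
  | .external k => lam k
  | .orbital k => al k

open Classical in
/-- Active origins in state `x`. -/
noncomputable def activeOrigins (x : Fin 2 → ℕ) : Finset Origin := Finset.univ.filter (·.Active x)

lemma mem_activeOrigins {x : Fin 2 → ℕ} {o : Origin} : o ∈ activeOrigins x ↔ o.Active x := by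
  simp [activeOrigins]

lemma sum_activeOrigins {M : Type*} [AddCommMonoid M] (x : Fin 2 → ℕ) (f : Origin → M) :
    ∑ o ∈ activeOrigins x, f o = f (.external 0) + f (.external 1) +
      ((if 0 < x 0 then f (.orbital 0) else 0) + (if 0 < x 1 then f (.orbital 1) else 0)) := by
  rw [activeOrigins, Finset.sum_filter, sum_origin]
  by_cases h0 : 0 < x 0 <;> by_cases h1 : 0 < x 1 <;> simp [Origin.Active, h0, h1]

/-- Ingredients with prescribed clocks. -/
def liftClock (c : Origin → ℝ) : Ingredient → ℝ
  | .arrival k => c (.external k)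
  | .retrial k => c (.orbital k)
  | .service _ => 0
  | .gap _ _ => 0

lemma clock_liftClock (c : Origin → ℝ) (o : Origin) : o.clock (liftClock c) = c o := by
  cases o <;> rfl

/-- Exhibits the entering customer as a selector depending on the clock coordinates alone, the form
required by `map_selected`. -/
lemma entering_eq_liftClock (x : Fin 2 → ℕ) (w : Ingredient → ℝ) :
    entering x w = entering x (liftClock fun o => w o.ingredient) := by
  have : ∀ o, IsFirst x w o ↔ IsFirst x (liftClock fun o => w o.ingredient) o := fun o => by
    simp only [IsFirst, clock_liftClock]
    have h : ∀ o : Origin, o.clock w = w o.ingredient := by rintro (k | k) <;> rfl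
    simp only [h]
  classical
  unfold entering
  exact if_congr (this _) rfl (if_congr (this _) rfl (if_congr (this _) rfl rfl))

lemma isFirst_entering (x : Fin 2 → ℕ) (w : Ingredient → ℝ) : IsFirst x w (entering x w) := by
  obtain ⟨o, ho, hmin⟩ := Finset.exists_min_image (activeOrigins x) (fun o => o.clock w)
    ⟨.external 0, mem_activeOrigins.2 trivial⟩
  have hfirst : IsFirst x w o :=
    ⟨mem_activeOrigins.1 ho, fun o' ho' => hmin o' (mem_activeOrigins.2 ho')⟩
  unfold entering
  split_ifs with h1 h2 h3
  · exact h1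
  · exact h2
  · exact h3
  -- The default value in `entering` is legitimate: some active origin attains the minimum, and the
  -- other three have been excluded.
  · rcases o with k | k <;> fin_cases k
    · exact absurd hfirst h1
    · exact absurd hfirst h2
    · exact absurd hfirst h3
    · exact hfirst

lemma measurableSet_selector (x : Fin 2 → ℕ) (o : Origin) :
    MeasurableSet {c : Origin → ℝ | entering x (liftClock c) = o} := by
  have hF : ∀ o, MeasurableSet {c : Origin → ℝ | IsFirst x (liftClock c) o} := fun o => by
    simp only [IsFirst, clock_liftClock]
    have : {c : Origin → ℝ | o.Active x ∧ ∀ o' : Origin, o'.Active x → c o ≤ c o'} =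
        {c | o.Active x} ∩ ⋂ o' : Origin, {c | o'.Active x → c o ≤ c o'} := by
      ext c; simp
    rw [this]
    refine (MeasurableSet.const _).inter (MeasurableSet.iInter fun o' => ?_)
    by_cases h : o'.Active x
    · simp only [h, true_imp_iff]
      exact measurableSet_le (measurable_pi_apply o) (measurable_pi_apply o')
    · simp [h]
  let _ : MeasurableSpace Origin := ⊤
  have hm : Measurable fun c : Origin → ℝ => entering x (liftClock c) := by
    unfold entering
    exact Measurable.ite (hF _) measurable_const (Measurable.ite (hF _) measurable_const
      (Measurable.ite (hF _) measurable_const measurable_const))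
  exact hm (MeasurableSpace.measurableSet_top (s := {o}))

lemma selector_spec (x : Fin 2 → ℕ) (c : Origin → ℝ) :
    entering x (liftClock c) ∈ activeOrigins x ∧
      ∀ o' ∈ activeOrigins x, c (entering x (liftClock c)) ≤ c o' := by
  have h := isFirst_entering x (liftClock c)
  refine ⟨mem_activeOrigins.2 h.1, fun o' ho' => ?_⟩
  have := h.2 o' (mem_activeOrigins.1 ho')
  rwa [clock_liftClock, clock_liftClock] at this

section Laws

variable {lam al : Fin 2 → ℝ} {F : Fin 2 → Measure ℝ}

lemma isProbabilityMeasure_ingredientLaw (hlam : ∀ k, 0 < lam k) (hal : ∀ k, 0 < al k)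
    (hF : ∀ k, IsProbabilityMeasure (F k)) (i : Ingredient) :
    IsProbabilityMeasure (ingredientLaw lam al F i) := by
  cases i with
  | arrival k => exact isProbabilityMeasure_expMeasure (hlam k)
  | retrial k => exact isProbabilityMeasure_expMeasure (hal k)
  | service k => exact hF k
  | gap k i => exact isProbabilityMeasure_expMeasure (hlam k)

lemma isProbabilityMeasure_cycleLaw (hlam : ∀ k, 0 < lam k) (hal : ∀ k, 0 < al k)
    (hF : ∀ k, IsProbabilityMeasure (F k)) : IsProbabilityMeasure (cycleLaw lam al F) := by
  have := isProbabilityMeasure_ingredientLaw hlam hal hF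
  unfold cycleLaw
  infer_instance

lemma Origin.rate_pos (hlam : ∀ k, 0 < lam k) (hal : ∀ k, 0 < al k) (o : Origin) :
    0 < o.rate lam al := by
  cases o with
  | external k => exact hlam k
  | orbital k => exact hal k

/-- Number of class-`j` arrivals during the service of the next customer. -/
noncomputable def arrivalCount (x : Fin 2 → ℕ) (j : Fin 2) (w : Ingredient → ℝ) : ℕ :=
  arrivalsBy (fun i => w (.gap j i)) (w (.service (entering x w).cls))

lemma cycle_functional_eq {E : Type*} (x : Fin 2 → ℕ) (j : Fin 2) (h : Origin → ℕ → E) :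
    (fun w => h (entering x w) (arrivalCount x j w)) =
      fun w : Ingredient → ℝ => h (entering x (liftClock fun o => w o.ingredient))
        (arrivalsBy (fun i => w (.gap j i))
          (w (.service (entering x (liftClock fun o => w o.ingredient)).cls))) := by
  ext w
  rw [arrivalCount, ← entering_eq_liftClock]

lemma measurable_cycle_functional {E : Type*} [MeasurableSpace E] (x : Fin 2 → ℕ) (j : Fin 2)
    (h : Origin → ℕ → E) :
    Measurable fun w => h (entering x w) (arrivalCount x j w) := by
  rw [cycle_functional_eq x j h]
  exact measurable_selected (clk := Origin.ingredient) (e := fun c => entering x (liftClock c))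
    (measurableSet_selector x) (fun o => .service o.cls) (fun i => .gap j i) h

lemma map_cycle_functional (hlam : ∀ k, 0 < lam k) (hal : ∀ k, 0 < al k)
    (hF : ∀ k, IsProbabilityMeasure (F k)) {E : Type*} [MeasurableSpace E] (x : Fin 2 → ℕ)
    (j : Fin 2) (h : Origin → ℕ → E) :
    (cycleLaw lam al F).map (fun w => h (entering x w) (arrivalCount x j w)) =
      ∑ o ∈ activeOrigins x, ENNReal.ofReal (o.rate lam al / ∑ o' ∈ activeOrigins x,
        o'.rate lam al) • (countLaw (lam j) (F o.cls)).map (h o) := by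
  have := isProbabilityMeasure_ingredientLaw hlam hal hF
  rw [cycle_functional_eq x j h]
  exact map_selected (μ := ingredientLaw lam al F) Origin.ingredient_injective
    (Origin.rate_pos hlam hal) (by rintro (k | k) <;> rfl)
    (e := fun c => entering x (liftClock c)) (measurableSet_selector x)
    (selector_spec x) (svc := fun o => .service o.cls) (g := fun i => .gap j i)
    (fun a b hab => by simpa using hab) (hlam j) (fun _ => rfl)
    (by rintro o (k | k) <;> simp [Origin.ingredient])
    (by rintro n (k | k) <;> simp [Origin.ingredient]) (by simp) h

lemma integral_cycle_functional (hlam : ∀ k, 0 < lam k) (hal : ∀ k, 0 < al k)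
    (hF : ∀ k, IsProbabilityMeasure (F k)) (x : Fin 2 → ℕ) (j : Fin 2) {h : Origin → ℕ → ℝ}
    (hi : ∀ o : Origin, Integrable (h o) (countLaw (lam j) (F o.cls))) :
    Integrable (fun w => h (entering x w) (arrivalCount x j w)) (cycleLaw lam al F) ∧
      ∫ w, h (entering x w) (arrivalCount x j w) ∂(cycleLaw lam al F) =
      ∑ o ∈ activeOrigins x, o.rate lam al / (∑ o' ∈ activeOrigins x, o'.rate lam al) *
        ∫ n, h o n ∂(countLaw (lam j) (F o.cls)) := by
  have := isProbabilityMeasure_ingredientLaw hlam hal hF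
  rw [cycle_functional_eq x j h]
  exact integral_selected (μ := ingredientLaw lam al F) Origin.ingredient_injective
    (Origin.rate_pos hlam hal) (by rintro (k | k) <;> rfl)
    (e := fun c => entering x (liftClock c)) (measurableSet_selector x)
    (selector_spec x) (svc := fun o => .service o.cls) (g := fun i => .gap j i)
    (fun a b hab => by simpa using hab) (hlam j) (fun _ => rfl)
    (by rintro o (k | k) <;> simp [Origin.ingredient])
    (by rintro n (k | k) <;> simp [Origin.ingredient]) (by simp) (fun o _ => hi o)

/-! ### One cycle of the single-orbit system -/

/-- The ingredient carrying a clock of the single-orbit system; `none` is the retrial clock. -/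
def auxClock : Option (Fin 2) → AuxIngredient
  | none => .retrial
  | some k => .arrival k

/-- Rates of the clocks of the single-orbit system. -/
def auxRate (lam al : Fin 2 → ℝ) : Option (Fin 2) → ℝ
  | none => al 0
  | some 0 => lam 0
  | some 1 => lam 1 + al 1

/-- Class of the customer supplied by a clock of the single-orbit system. -/
def auxClass (o : Option (Fin 2)) : Fin 2 := o.getD 0

/-- Orbit size after a cycle of the single-orbit system. -/
def auxNext (x : ℕ) (o : Option (Fin 2)) (n : ℕ) : ℕ := (x - if o = none then 1 else 0) + n

/-- Active clocks of the single-orbit system. -/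
def auxActive (x : ℕ) : Finset (Option (Fin 2)) :=
  if 0 < x then Finset.univ else {some 0, some 1}

lemma sum_auxActive {M : Type*} [AddCommMonoid M] (x : ℕ) (f : Option (Fin 2) → M) :
    ∑ o ∈ auxActive x, f o = (if 0 < x then f none else 0) + (f (some 0) + f (some 1)) := by
  unfold auxActive
  split_ifs with h
  · rw [Fintype.sum_option, Fin.sum_univ_two]
  · rw [Finset.sum_pair (by simp), zero_add]

open Classical in
/-- The clock of the single-orbit system that rings first. -/
noncomputable def auxSelector (x : ℕ) (c : Option (Fin 2) → ℝ) : Option (Fin 2) :=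
  if 0 < x ∧ c none < c (some 0) ∧ c none < c (some 1) then none
  else if c (some 0) ≤ c (some 1) then some 0 else some 1

lemma measurableSet_auxSelector (x : ℕ) (o : Option (Fin 2)) :
    MeasurableSet {c : Option (Fin 2) → ℝ | auxSelector x c = o} := by
  let _ : MeasurableSpace (Option (Fin 2)) := ⊤
  have hm : Measurable (auxSelector x) := by
    unfold auxSelector
    have h1 : MeasurableSet {c : Option (Fin 2) → ℝ |
        0 < x ∧ c none < c (some 0) ∧ c none < c (some 1)} := by
      refine (MeasurableSet.const _).inter (MeasurableSet.inter
        (measurableSet_lt (f := fun c : Option (Fin 2) → ℝ => c none) (g := fun c => c (some 0))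
          (by fun_prop) (by fun_prop))
        (measurableSet_lt (f := fun c : Option (Fin 2) → ℝ => c none) (g := fun c => c (some 1))
          (by fun_prop) (by fun_prop)))
    exact Measurable.ite h1 measurable_const (Measurable.ite (measurableSet_le
      (measurable_pi_apply _) (measurable_pi_apply _)) measurable_const measurable_const)
  exact hm (MeasurableSpace.measurableSet_top (s := {o}))

lemma auxSelector_spec (x : ℕ) (c : Option (Fin 2) → ℝ) :
    auxSelector x c ∈ auxActive x ∧ ∀ o' ∈ auxActive x, c (auxSelector x c) ≤ c o' := by
  have hall : ∀ p : Option (Fin 2) → Prop, (0 < x → p none) → p (some 0) → p (some 1) →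
      ∀ o ∈ auxActive x, p o := by
    intro p h1 h2 h3 o ho
    rcases o with _ | k
    · refine h1 ?_
      by_contra hx
      simp [auxActive, hx] at ho
    · fin_cases k
      · exact h2
      · exact h3
  unfold auxSelector
  split_ifs with h1 h2
  · refine ⟨by simp [auxActive, h1.1], hall _ (fun _ => le_rfl) h1.2.1.le h1.2.2.le⟩
  · refine ⟨by unfold auxActive; split_ifs <;> simp, hall _ (fun hx => ?_) le_rfl h2⟩
    by_contra hlt
    push Not at hlt
    exact h1 ⟨hx, hlt, hlt.trans_le h2⟩
  · push Not at h2
    refine ⟨by unfold auxActive; split_ifs <;> simp, hall _ (fun hx => ?_) h2.le le_rfl⟩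
    by_contra hlt
    push Not at hlt
    exact h1 ⟨hx, hlt.trans h2, hlt⟩

lemma auxStep_eq (x : ℕ) (w : AuxIngredient → ℝ) :
    auxStep x w = auxNext x (auxSelector x fun o => w (auxClock o))
      (arrivalsBy (fun i => w (.gap i))
        (w (.service (auxClass (auxSelector x fun o => w (auxClock o)))))) := by
  by_cases h1 : 0 < x ∧ w .retrial < w (.arrival 0) ∧ w .retrial < w (.arrival 1)
  · have e : (auxSelector x fun o => w (auxClock o)) = none := if_pos h1
    rw [e, auxStep, if_pos h1]
    rfl
  · by_cases h2 : w (.arrival 0) ≤ w (.arrival 1)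
    · have e : (auxSelector x fun o => w (auxClock o)) = some 0 := (if_neg h1).trans (if_pos h2)
      rw [e, auxStep, if_neg h1, if_pos h2]
      rfl
    · have e : (auxSelector x fun o => w (auxClock o)) = some 1 := (if_neg h1).trans (if_neg h2)
      rw [e, auxStep, if_neg h1, if_neg h2]
      rfl

lemma measurable_auxStep (x : ℕ) : Measurable (auxStep x) := by
  have : auxStep x = _ := funext (auxStep_eq x)
  rw [this]
  exact measurable_selected (clk := auxClock) (measurableSet_auxSelector x)
    (fun o => .service (auxClass o)) (fun i => .gap i) (auxNext x)

lemma isProbabilityMeasure_auxIngredientLaw (hlam : ∀ k, 0 < lam k) (hal : ∀ k, 0 < al k)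
    (hF : ∀ k, IsProbabilityMeasure (F k)) (i : AuxIngredient) :
    IsProbabilityMeasure (auxIngredientLaw lam al F i) := by
  rcases i with k | _ | k | i
  · fin_cases k
    · exact isProbabilityMeasure_expMeasure (hlam 0)
    · exact isProbabilityMeasure_expMeasure (add_pos (hlam 1) (hal 1))
  · exact isProbabilityMeasure_expMeasure (hal 0)
  · exact hF k
  · exact isProbabilityMeasure_expMeasure (hlam 0)

lemma map_auxStep (hlam : ∀ k, 0 < lam k) (hal : ∀ k, 0 < al k)
    (hF : ∀ k, IsProbabilityMeasure (F k)) (x : ℕ) :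
    (auxCycleLaw lam al F).map (auxStep x) =
      ∑ o ∈ auxActive x, ENNReal.ofReal (auxRate lam al o / ∑ o' ∈ auxActive x,
        auxRate lam al o') • (countLaw (lam 0) (F (auxClass o))).map (auxNext x o) := by
  have := isProbabilityMeasure_auxIngredientLaw hlam hal hF
  have e : auxStep x = _ := funext (auxStep_eq x)
  rw [e]
  refine map_selected (μ := auxIngredientLaw lam al F) (clk := auxClock) ?_ ?_ ?_
    (measurableSet_auxSelector x) (auxSelector_spec x) (svc := fun o => .service (auxClass o))
    (g := fun i => .gap i) (fun a b hab => by simpa using hab) (hlam 0) (fun _ => rfl)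
    ?_ ?_ (by simp) (auxNext x)
  · rintro (_ | k) (_ | l) h <;> simp_all [auxClock]
  · rintro (_ | k)
    · exact hal 0
    · fin_cases k
      · exact hlam 0
      · exact add_pos (hlam 1) (hal 1)
  · rintro (_ | k)
    · rfl
    · fin_cases k <;> rfl
  · rintro o (_ | k) <;> simp [auxClock]
  · rintro n (_ | k) <;> simp [auxClock]

lemma step_apply_eq (x : Fin 2 → ℕ) (w : Ingredient → ℝ) (j : Fin 2) [DecidableEq Origin] :
    step x w j = (x j - if entering x w = .orbital j then 1 else 0) + arrivalCount x j w := by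
  unfold step arrivalCount
  congr!

lemma measurable_step_apply (x : Fin 2 → ℕ) (j : Fin 2) : Measurable fun w => step x w j := by
  classical
  simp_rw [step_apply_eq]
  exact measurable_cycle_functional x j
    fun o n => (x j - if o = .orbital j then 1 else 0) + n

lemma measurable_step (x : Fin 2 → ℕ) : Measurable (step x) :=
  measurable_pi_lambda _ (measurable_step_apply x)

/-- While the second orbit is not empty, the first orbit evolves like the single-orbit system. -/
theorem map_step_zero_eq_map_auxStep (hlam : ∀ k, 0 < lam k) (hal : ∀ k, 0 < al k)
    (hF : ∀ k, IsProbabilityMeasure (F k)) {x : Fin 2 → ℕ} (hx : 0 < x 1) :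
    (cycleLaw lam al F).map (fun w => step x w 0) = (auxCycleLaw lam al F).map (auxStep (x 0)) := by
  classical
  simp_rw [step_apply_eq]
  rw [map_auxStep hlam hal hF, map_cycle_functional hlam hal hF x 0
    fun o n => (x 0 - if o = .orbital 0 then 1 else 0) + n]
  simp only [sum_activeOrigins, sum_auxActive, hx, if_true]
  have hΛ : lam 0 + lam 1 + ((if 0 < x 0 then al 0 else 0) + al 1) =
      (if 0 < x 0 then al 0 else 0) + (lam 0 + (lam 1 + al 1)) := by ring
  simp only [Origin.rate, auxRate, Origin.cls, auxClass, hΛ]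
  set Λ := (if 0 < x 0 then al 0 else 0) + (lam 0 + (lam 1 + al 1)) with hΛd
  have hΛpos : 0 < Λ := by
    have := hlam 0
    have := hlam 1
    have := hal 1
    have : 0 ≤ (if 0 < x 0 then al 0 else 0) := by split_ifs <;> linarith [hal 0]
    positivity
  -- The weight of the enlarged class-2 stream splits into its `λ₂` and `α₂` shares. These are the
  -- weights of an external and an orbital class-2 customer, whose effects on the first orbit
  -- coincide.
  rw [add_div, ENNReal.ofReal_add (div_pos (hlam 1) hΛpos).le (div_pos (hal 1) hΛpos).le, add_smul]
  have e0 : auxNext (x 0) none = fun n => x 0 - 1 + n := by ext; simp [auxNext]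
  have e1 : ∀ k, auxNext (x 0) (some k) = fun n => x 0 + n := fun k => by ext; simp [auxNext]
  simp only [e0, e1]
  simp
  abel

lemma auxKernel_apply (x : ℕ) :
    auxKernel lam al F x = (auxCycleLaw lam al F).map (auxStep x) := rfl

lemma isMarkovKernel_auxKernel (hlam : ∀ k, 0 < lam k) (hal : ∀ k, 0 < al k)
    (hF : ∀ k, IsProbabilityMeasure (F k)) : IsMarkovKernel (auxKernel lam al F) := by
  have := isProbabilityMeasure_auxIngredientLaw hlam hal hF
  refine ⟨fun x => ?_⟩
  rw [auxKernel_apply]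
  unfold auxCycleLaw
  exact Measure.isProbabilityMeasure_map (measurable_auxStep x).aemeasurable

/-- An external class-1 customer may win, with exactly `r - x` class-1 arrivals during its service.
This provides the common atom for the minorization. -/
lemma auxKernel_singleton_pos (hlam : ∀ k, 0 < lam k) (hal : ∀ k, 0 < al k)
    (hF : ∀ k, IsProbabilityMeasure (F k)) (hD : ∀ k, ClassD (F k)) {x r : ℕ} (hxr : x ≤ r) :
    0 < auxKernel lam al F x {r} := by
  rw [auxKernel_apply, map_auxStep hlam hal hF, Measure.finsetSum_apply]
  have hmem : some 0 ∈ auxActive x := by unfold auxActive; split_ifs <;> simp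
  refine lt_of_lt_of_le ?_ (Finset.single_le_sum (fun _ _ => bot_le) hmem)
  rw [Measure.smul_apply, smul_eq_mul, Measure.map_apply (measurable_of_countable _)
    (measurableSet_singleton r)]
  have hpre : auxNext x (some 0) ⁻¹' {r} = {r - x} := by
    ext n
    simp [auxNext]
    omega
  rw [hpre]
  have hden : 0 < ∑ o' ∈ auxActive x, auxRate lam al o' := by
    refine Finset.sum_pos (fun o _ => ?_) ⟨_, hmem⟩
    rcases o with _ | k
    · exact hal 0
    · fin_cases k
      · exact hlam 0
      · exact add_pos (hlam 1) (hal 1)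
  refine ENNReal.mul_pos ?_ (countLaw_singleton_pos (hlam 0) (hD _) _).ne'
  rw [ne_eq, ENNReal.ofReal_eq_zero, not_le]
  exact div_pos (hlam 0) hden

end Laws

/-! ### Drift of the two-orbit system -/

/-- The pattern of empty orbits of a state. -/
def pattern (x : Fin 2 → ℕ) : Fin 2 → ℕ := fun j => min 1 (x j)

lemma pattern_pos_iff {x : Fin 2 → ℕ} (j : Fin 2) : 0 < pattern x j ↔ 0 < x j := by
  simp [pattern]

lemma finite_patterns : (Set.Iic (1 : Fin 2 → ℕ)).Finite := Set.finite_Iic _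

lemma pattern_mem (x : Fin 2 → ℕ) : pattern x ∈ Set.Iic (1 : Fin 2 → ℕ) :=
  fun _ => min_le_left _ _

lemma entering_pattern (x : Fin 2 → ℕ) (w : Ingredient → ℝ) :
    entering (pattern x) w = entering x w := by
  classical
  have hA : ∀ o : Origin, o.Active (pattern x) ↔ o.Active x := by
    rintro (k | k)
    · rfl
    · exact pattern_pos_iff k
  have : ∀ o, IsFirst (pattern x) w o ↔ IsFirst x w o := fun o => by
    simp only [IsFirst, hA]
  unfold entering
  exact if_congr (this _) rfl (if_congr (this _) rfl (if_congr (this _) rfl rfl))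

open Classical in
/-- Increment of the size of orbit `j` in one cycle. -/
noncomputable def jump (x : Fin 2 → ℕ) (j : Fin 2) (w : Ingredient → ℝ) : ℝ :=
  arrivalCount x j w - if entering x w = .orbital j then 1 else 0

lemma jump_pattern (x : Fin 2 → ℕ) (j : Fin 2) : jump (pattern x) j = jump x j := by
  ext w
  unfold jump arrivalCount
  rw [entering_pattern]

lemma step_cast (x : Fin 2 → ℕ) (j : Fin 2) (w : Ingredient → ℝ) :
    (step x w j : ℝ) = x j + jump x j w := by
  classical
  rw [step_apply_eq, jump]
  split_ifs with h
  -- Truncated subtraction is exact here: an orbit can supply the customer only if it is active,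
  -- hence non-empty.
  · have hpos : 0 < x j := by
      have := (isFirst_entering x w).1
      rw [h] at this
      exact this
    rw [Nat.cast_add, Nat.cast_sub hpos]
    push_cast
    ring
  · simp

lemma neg_one_le_jump (x : Fin 2 → ℕ) (j : Fin 2) (w : Ingredient → ℝ) : -1 ≤ jump x j w := by
  unfold jump
  have : (0 : ℝ) ≤ arrivalCount x j w := Nat.cast_nonneg _
  split_ifs <;> linarith

/-- Uniformity of the exponential bound over states when increments depend only on the pattern. -/
lemma exists_uniform_exp_bound {Ω : Type*} [MeasurableSpace Ω] {P : Measure Ω}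
    [IsProbabilityMeasure P] {Z : (Fin 2 → ℕ) → Ω → ℝ} (hZ : ∀ x, Z (pattern x) = Z x)
    {p : (Fin 2 → ℕ) → Prop} (hp : ∀ x, p (pattern x) ↔ p x) (hint : ∀ x, Integrable (Z x) P)
    {θ₁ : ℝ} (hθ₁ : 0 < θ₁) (hexp : ∀ x, Integrable (fun ω => Real.exp (θ₁ * Z x ω)) P)
    (hneg : ∀ x, p x → ∫ ω, Z x ω ∂P < 0) :
    ∃ θ γ K : ℝ, 0 < θ ∧ 0 ≤ γ ∧ γ < 1 ∧ 0 ≤ K ∧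
      (∀ x, Integrable (fun ω => Real.exp (θ * Z x ω)) P) ∧
      (∀ x, ∫ ω, Real.exp (θ * Z x ω) ∂P ≤ K) ∧
      ∀ x, p x → ∫ ω, Real.exp (θ * Z x ω) ∂P ≤ γ := by
  -- The finitely many patterns allow one small `θ` to serve all states; `K` and `γ` below come from
  -- bounds over this finite set as well.
  have h1 : ∀ᶠ θ in 𝓝[>] (0 : ℝ), ∀ x ∈ Set.Iic (1 : Fin 2 → ℕ), p x →
      ∫ ω, Real.exp (θ * Z x ω) ∂P < 1 := by
    rw [eventually_all_finite finite_patterns]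
    intro x _
    by_cases hx : p x
    · filter_upwards [eventually_integral_exp_lt_one (hint x) hθ₁ (hexp x) (hneg x hx)]
        with θ h _ using h.2
    · exact Eventually.of_forall fun _ h => absurd h hx
  obtain ⟨θ, hθ, hθI⟩ := (h1.and (Ioo_mem_nhdsGT hθ₁)).exists
  have hi : ∀ x, Integrable (fun ω => Real.exp (θ * Z x ω)) P := fun x => by
    have hc : Continuous fun z : ℝ => Real.exp (θ * z) := by fun_prop
    refine ((integrable_const (1 : ℝ)).add (hexp x)).mono'
      (hc.comp_aestronglyMeasurable (hint x).aestronglyMeasurable) (ae_of_all _ fun ω => ?_)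
    rw [Real.norm_of_nonneg (Real.exp_pos _).le, Pi.add_apply]
    rcases le_total (Z x ω) 0 with h | h
    · have : Real.exp (θ * Z x ω) ≤ 1 :=
        Real.exp_le_one_iff.2 (mul_nonpos_of_nonneg_of_nonpos hθI.1.le h)
      linarith [Real.exp_pos (θ₁ * Z x ω)]
    · have : Real.exp (θ * Z x ω) ≤ Real.exp (θ₁ * Z x ω) :=
        Real.exp_le_exp.2 (mul_le_mul_of_nonneg_right hθI.2.le h)
      linarith
  set G : (Fin 2 → ℕ) → ℝ := fun x => ∫ ω, Real.exp (θ * Z x ω) ∂P with hG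
  have hG0 : ∀ x, 0 ≤ G x := fun x => integral_nonneg fun _ => (Real.exp_pos _).le
  have hGp : ∀ x, G (pattern x) = G x := fun x => by simp only [hG, hZ]
  obtain ⟨K, hK⟩ := (finite_patterns.image G).bddAbove
  have hK' : ∀ x, G x ≤ K := fun x => hGp x ▸ hK ⟨_, pattern_mem x, rfl⟩
  have hγ : ∃ γ : ℝ, 0 ≤ γ ∧ γ < 1 ∧ ∀ x, p x → G x ≤ γ := by
    by_cases hne : ({x | x ∈ Set.Iic (1 : Fin 2 → ℕ) ∧ p x}).Nonempty
    · obtain ⟨x, hx, hmax⟩ := Set.exists_max_image _ G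
        (finite_patterns.subset fun x (hx : x ∈ Set.Iic (1 : Fin 2 → ℕ) ∧ p x) => hx.1) hne
      exact ⟨G x, hG0 x, hθ x hx.1 hx.2, fun y hy =>
        hGp y ▸ hmax _ ⟨pattern_mem y, (hp y).2 hy⟩⟩
    · exact ⟨0, le_rfl, one_pos, fun y hy => absurd ⟨pattern y, pattern_mem y, (hp y).2 hy⟩ hne⟩
  obtain ⟨γ, hγ0, hγ1, hγ⟩ := hγ
  exact ⟨θ, γ, K, hθI.1, hγ0, hγ1, (hG0 0).trans (hK' 0), hi, hK', hγ⟩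

section Drift

variable {lam al : Fin 2 → ℝ} {F : Fin 2 → Measure ℝ}

open Classical in
lemma integral_jump (hlam : ∀ k, 0 < lam k) (hal : ∀ k, 0 < al k)
    (hF : ∀ k, IsProbabilityMeasure (F k)) (hD : ∀ k, ClassD (F k)) (x : Fin 2 → ℕ) (j : Fin 2) :
    Integrable (jump x j) (cycleLaw lam al F) ∧
      ∫ w, jump x j w ∂(cycleLaw lam al F) =
      (∑ o ∈ activeOrigins x, o.rate lam al * (lam j * (∫ s, s ∂(F o.cls)) -
        if o = .orbital j then 1 else 0)) / ∑ o' ∈ activeOrigins x, o'.rate lam al := by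
  have hc : ∀ k, Integrable (fun n : ℕ => (n : ℝ)) (countLaw (lam j) (F k)) ∧
      ∫ n : ℕ, (n : ℝ) ∂(countLaw (lam j) (F k)) = lam j * ∫ s, s ∂(F k) := fun k =>
    integral_countLaw (hlam j) (hD k)
  have hprob := fun k => isProbabilityMeasure_countLaw (F := F k) (hlam j)
  have h := integral_cycle_functional hlam hal hF x j
    (h := fun o n => (n : ℝ) - if o = .orbital j then 1 else 0)
    fun o => (hc o.cls).1.sub (integrable_const _)
  refine ⟨h.1, h.2.trans ?_⟩
  rw [Finset.sum_div]
  refine Finset.sum_congr rfl fun o _ => ?_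
  rw [integral_sub (hc o.cls).1 (integrable_const _), (hc o.cls).2]
  simp only [integral_const, probReal_univ, smul_eq_mul, one_mul]
  ring

lemma sum_rate_pos (hlam : ∀ k, 0 < lam k) (hal : ∀ k, 0 < al k) (x : Fin 2 → ℕ) :
    0 < ∑ o ∈ activeOrigins x, o.rate lam al :=
  Finset.sum_pos (fun o _ => Origin.rate_pos hlam hal o)
    ⟨.external 0, mem_activeOrigins.2 trivial⟩

lemma exists_integrable_exp_jump (hlam : ∀ k, 0 < lam k) (hal : ∀ k, 0 < al k)
    (hF : ∀ k, IsProbabilityMeasure (F k)) (hD : ∀ k, ClassD (F k)) (j : Fin 2) :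
    ∃ θ : ℝ, 0 < θ ∧ ∀ x, Integrable (fun w => Real.exp (θ * jump x j w))
      (cycleLaw lam al F) := by
  classical
  have hprob := fun k => isProbabilityMeasure_countLaw (F := F k) (hlam j)
  choose θ hθ hi using fun k => exists_integrable_exp_countLaw (hlam j) (hD k)
  refine ⟨min (θ 0) (θ 1), lt_min (hθ 0) (hθ 1), fun x => ?_⟩
  set t := min (θ 0) (θ 1) with ht
  have htpos : 0 < t := lt_min (hθ 0) (hθ 1)
  have hle : ∀ k, t ≤ θ k := fun k => by
    fin_cases k
    · exact min_le_left _ _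
    · exact min_le_right _ _
  refine (integral_cycle_functional hlam hal hF x j
    (h := fun o n => Real.exp (t * ((n : ℝ) - if o = .orbital j then 1 else 0))) fun o => ?_).1
  refine (hi o.cls).mono' (measurable_of_countable _).aestronglyMeasurable
    (ae_of_all _ fun n => ?_)
  rw [Real.norm_of_nonneg (Real.exp_pos _).le, Real.exp_le_exp]
  have h1 : (0 : ℝ) ≤ if o = .orbital j then 1 else 0 := by split_ifs <;> norm_num
  have h2 : (0 : ℝ) ≤ n := Nat.cast_nonneg n
  have h3 := mul_le_mul_of_nonneg_right (hle o.cls) h2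
  nlinarith

/-- Multiplied by the total clock rate, the drift with both orbits non-empty is the left side of
`h1` minus `al 0`. Emptying the second orbit only removes the positive term `lam 0 * al 1 * ∫ s, s
∂(F 1)`. -/
lemma integral_jump_zero_neg (hlam : ∀ k, 0 < lam k) (hal : ∀ k, 0 < al k)
    (hF : ∀ k, IsProbabilityMeasure (F k)) (hD : ∀ k, ClassD (F k))
    (h1 : lam 0 * (lam 0 * (∫ s, s ∂(F 0)) + lam 1 * (∫ s, s ∂(F 1)) +
      al 0 * (∫ s, s ∂(F 0)) + al 1 * (∫ s, s ∂(F 1))) < al 0)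
    {x : Fin 2 → ℕ} (hx : 0 < x 0) : ∫ w, jump x 0 w ∂(cycleLaw lam al F) < 0 := by
  classical
  rw [(integral_jump hlam hal hF hD x 0).2]
  refine div_neg_of_neg_of_pos ?_ (sum_rate_pos hlam hal x)
  have hp : 0 < lam 0 * (al 1 * ∫ s, s ∂(F 1)) :=
    mul_pos (hlam 0) (mul_pos (hal 1) (hD 1).integral_id_pos)
  rw [sum_activeOrigins]
  by_cases hx1 : 0 < x 1
  · simp [hx, hx1, Origin.rate, Origin.cls]
    nlinarith
  · simp [hx, hx1, Origin.rate, Origin.cls]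
    nlinarith

/-- The hypotheses `h01`, `h11` and `h10` are the rate-weighted drift conditions for the three
patterns with a non-empty orbit, the digits telling whether the first and second orbits are
occupied. When both are empty nothing can leave an orbit, and positivity is automatic. -/
lemma integral_direction_pos (hlam : ∀ k, 0 < lam k) (hal : ∀ k, 0 < al k)
    (hF : ∀ k, IsProbabilityMeasure (F k)) (hD : ∀ k, ClassD (F k)) {m : Fin 2 → ℝ}
    (hm : ∀ k, m k = ∫ s, s ∂(F k)) {κ : ℝ} (hκ : 0 < κ)
    (h01 : al 1 < (lam 0 * m 0 + lam 1 * m 1 + al 1 * m 1) * (lam 1 + κ * lam 0))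
    (h11 : al 1 + κ * al 0 <
      (lam 0 * m 0 + lam 1 * m 1 + al 0 * m 0 + al 1 * m 1) * (lam 1 + κ * lam 0))
    (h10 : κ * al 0 < (lam 0 * m 0 + lam 1 * m 1 + al 0 * m 0) * (lam 1 + κ * lam 0))
    (x : Fin 2 → ℕ) : 0 < ∫ w, (jump x 1 w + κ * jump x 0 w) ∂(cycleLaw lam al F) := by
  classical
  have i0 := integral_jump hlam hal hF hD x 0
  have i1 := integral_jump hlam hal hF hD x 1
  rw [integral_add i1.1 (i0.1.const_mul κ), integral_const_mul, i0.2, i1.2, mul_div_assoc',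
    ← add_div]
  refine div_pos ?_ (sum_rate_pos hlam hal x)
  have m0 : 0 < m 0 := hm 0 ▸ (hD 0).integral_id_pos
  have m1 : 0 < m 1 := hm 1 ▸ (hD 1).integral_id_pos
  have l0 := hlam 0
  have l1 := hlam 1
  rw [sum_activeOrigins, sum_activeOrigins]
  have h00 : 0 < (lam 0 * m 0 + lam 1 * m 1) * (lam 1 + κ * lam 0) := by positivity
  by_cases hx0 : 0 < x 0 <;> by_cases hx1 : 0 < x 1 <;>
    simp [hx0, hx1, Origin.rate, Origin.cls, ← hm] <;> nlinarith

/-- The exponential turns an increment into a factor, whose mean is at most `γ` when the first orbit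
is non-empty; states with an empty first orbit contribute only the constant `K`. -/
lemma exists_drift_orbit_zero (hlam : ∀ k, 0 < lam k) (hal : ∀ k, 0 < al k)
    (hF : ∀ k, IsProbabilityMeasure (F k)) (hD : ∀ k, ClassD (F k))
    (h1 : lam 0 * (lam 0 * (∫ s, s ∂(F 0)) + lam 1 * (∫ s, s ∂(F 1)) +
      al 0 * (∫ s, s ∂(F 0)) + al 1 * (∫ s, s ∂(F 1))) < al 0) :
    ∃ θ γ K : ℝ, 0 < θ ∧ 0 ≤ γ ∧ γ < 1 ∧ 0 ≤ K ∧ ∀ x,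
      Integrable (fun w => Real.exp (θ * step x w 0)) (cycleLaw lam al F) ∧
      ∫ w, Real.exp (θ * step x w 0) ∂(cycleLaw lam al F) ≤ γ * Real.exp (θ * x 0) + K := by
  have := isProbabilityMeasure_cycleLaw hlam hal hF
  obtain ⟨θ₁, hθ₁, hexp⟩ := exists_integrable_exp_jump hlam hal hF hD 0
  obtain ⟨θ, γ, K, hθ, hγ0, hγ1, hK, hi, hbK, hbγ⟩ := exists_uniform_exp_bound
    (Z := fun x => jump x 0) (fun x => jump_pattern x 0) (p := fun x => 0 < x 0)
    (fun x => pattern_pos_iff 0) (fun x => (integral_jump hlam hal hF hD x 0).1) hθ₁ hexp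
    (fun x hx => integral_jump_zero_neg hlam hal hF hD h1 hx)
  refine ⟨θ, γ, K, hθ, hγ0, hγ1, hK, fun x => ?_⟩
  have he : ∀ w, Real.exp (θ * step x w 0) =
      Real.exp (θ * x 0) * Real.exp (θ * jump x 0 w) := fun w => by
    rw [step_cast, mul_add, Real.exp_add]
  simp_rw [he]
  refine ⟨(hi x).const_mul _, ?_⟩
  rw [integral_const_mul]
  have hpos := Real.exp_pos (θ * x 0)
  by_cases hx : 0 < x 0
  · have := mul_le_mul_of_nonneg_left (hbγ x hx) hpos.le
    linarith
  · have h0 : x 0 = 0 := by omega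
    have := hbK x
    simp only [h0, Nat.cast_zero, mul_zero, Real.exp_zero, one_mul]
    linarith

/-- Since the drift is positive in every state, including those with empty orbits, no additive
constant appears, and iteration yields geometric decay to zero. -/
lemma exists_contraction_direction (hlam : ∀ k, 0 < lam k) (hal : ∀ k, 0 < al k)
    (hF : ∀ k, IsProbabilityMeasure (F k)) (hD : ∀ k, ClassD (F k)) {m : Fin 2 → ℝ}
    (hm : ∀ k, m k = ∫ s, s ∂(F k))
    (h2 : al 1 * m 1 / (lam 1 * m 1 + al 1 * m 1) < lam 0 * m 0 + lam 1 * m 1) :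
    ∃ κ θ γ : ℝ, 0 < κ ∧ 0 < θ ∧ 0 ≤ γ ∧ γ < 1 ∧ ∀ x,
      Integrable (fun w => Real.exp (-θ * (step x w 1 + κ * step x w 0))) (cycleLaw lam al F) ∧
      ∫ w, Real.exp (-θ * (step x w 1 + κ * step x w 0)) ∂(cycleLaw lam al F) ≤
        γ * Real.exp (-θ * (x 1 + κ * x 0)) := by
  have := isProbabilityMeasure_cycleLaw hlam hal hF
  have m0 : 0 < m 0 := hm 0 ▸ (hD 0).integral_id_pos
  have m1 : 0 < m 1 := hm 1 ▸ (hD 1).integral_id_pos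
  obtain ⟨κ, hκ, h01, h11, h10⟩ :=
    exists_drift_direction (hlam 0) (hlam 1) (hal 0) (hal 1) m0 m1 h2
  have hint : ∀ x, Integrable (fun w => -(jump x 1 w + κ * jump x 0 w)) (cycleLaw lam al F) :=
    fun x => ((integral_jump hlam hal hF hD x 1).1.add
      ((integral_jump hlam hal hF hD x 0).1.const_mul κ)).neg
  obtain ⟨θ, γ, K, hθ, hγ0, hγ1, -, hi, -, hbγ⟩ := exists_uniform_exp_bound
    (Z := fun x w => -(jump x 1 w + κ * jump x 0 w)) (P := cycleLaw lam al F)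
    (fun x => by simp only [jump_pattern]) (p := fun _ => True) (fun x => Iff.rfl) hint one_pos
    -- Both jumps are at least `-1`, so the exponential at exponent `1` is bounded by `exp (1 + κ)`.
    (fun x => by
      have hc : Continuous fun z : ℝ => Real.exp (1 * z) := by fun_prop
      refine Integrable.of_bound (hc.comp_aestronglyMeasurable (hint x).aestronglyMeasurable)
        (Real.exp (1 + κ)) (ae_of_all _ fun w => ?_)
      rw [Real.norm_of_nonneg (Real.exp_pos _).le, Real.exp_le_exp]
      have := neg_one_le_jump x 1 w
      have := mul_le_mul_of_nonneg_left (neg_one_le_jump x 0 w) hκ.le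
      linarith)
    (fun x _ => by
      rw [integral_neg, neg_lt_zero]
      exact integral_direction_pos hlam hal hF hD hm hκ h01 h11 h10 x)
  refine ⟨κ, θ, γ, hκ, hθ, hγ0, hγ1, fun x => ?_⟩
  have he : ∀ w, Real.exp (-θ * (step x w 1 + κ * step x w 0)) =
      Real.exp (-θ * (x 1 + κ * x 0)) * Real.exp (θ * -(jump x 1 w + κ * jump x 0 w)) :=
    fun w => by
      rw [step_cast, step_cast, ← Real.exp_add]
      ring_nf
  simp_rw [he]
  refine ⟨(hi x).const_mul _, ?_⟩
  rw [integral_const_mul, mul_comm γ]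
  exact mul_le_mul_of_nonneg_left (hbγ x trivial) (Real.exp_pos _).le

/-! ### The single-orbit system is geometrically ergodic -/

/-- Starting the two-orbit system from `![x, 1]` makes its first orbit perform a step of
`auxKernel`, so the drift inequality transfers without a second computation. -/
lemma harrisPair_auxKernel (hlam : ∀ k, 0 < lam k) (hal : ∀ k, 0 < al k)
    (hF : ∀ k, IsProbabilityMeasure (F k)) (hD : ∀ k, ClassD (F k)) {θ γ K : ℝ} (hθ : 0 < θ)
    (hγ0 : 0 ≤ γ) (hγ1 : γ < 1) (hK : 0 ≤ K)
    (h : ∀ x, Integrable (fun w => Real.exp (θ * step x w 0)) (cycleLaw lam al F) ∧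
      ∫ w, Real.exp (θ * step x w 0) ∂(cycleLaw lam al F) ≤ γ * Real.exp (θ * x 0) + K) :
    HarrisPair (auxKernel lam al F) (fun x => Real.exp (θ * x)) γ K := by
  have hmk := isMarkovKernel_auxKernel hlam hal hF
  have hker : ∀ x : ℕ, auxKernel lam al F x =
      (cycleLaw lam al F).map fun w => step ![x, 1] w 0 := fun x => by
    rw [map_step_zero_eq_map_auxStep hlam hal hF (by simp)]
    rfl
  refine ⟨fun x => (Real.exp_pos _).le, fun x => ?_, fun x => ?_, hγ0, hγ1, hK, fun R => ?_⟩
  · rw [hker, integrable_map_measure (measurable_of_countable _).aestronglyMeasurable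
      (measurable_step_apply _ 0).aemeasurable]
    exact (h ![x, 1]).1
  · rw [hker, integral_map (measurable_step_apply _ 0).aemeasurable
      (measurable_of_countable _).aestronglyMeasurable]
    exact (h ![x, 1]).2
  -- The target `r` lies above the whole sublevel set, so every state of that set can jump to it in
  -- one step; finiteness makes the probability uniformly positive. Replacing `R` by `max R 1` keeps
  -- the logarithm valid.
  · obtain ⟨r, hr⟩ := exists_nat_gt (Real.log (max R 1) / θ)
    have hpos : ∀ x ∈ Finset.range (r + 1), 0 < (auxKernel lam al F x).real {r} := fun x hx => by
      rw [measureReal_def]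
      exact ENNReal.toReal_pos (auxKernel_singleton_pos hlam hal hF hD
        (by have := Finset.mem_range.1 hx; omega)).ne' (measure_ne_top _ _)
    obtain ⟨y, hy, hmin⟩ := Finset.exists_min_image (Finset.range (r + 1))
      (fun x => (auxKernel lam al F x).real {r}) ⟨0, by simp⟩
    refine ⟨r, _, hpos y hy, fun x hx => hmin x ?_⟩
    rw [Finset.mem_range]
    by_contra hxr
    push Not at hxr
    have hxr' : (r : ℝ) < x := by exact_mod_cast (by omega : r < x)
    have h1 : Real.exp (θ * x) ≤ max R 1 := hx.trans (le_max_left _ _)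
    have h2 := Real.log_le_log (Real.exp_pos _) h1
    rw [Real.log_exp] at h2
    rw [div_lt_iff₀ hθ] at hr
    nlinarith

lemma summable_inv_exp {θ : ℝ} (hθ : 0 < θ) : Summable fun x : ℕ => (Real.exp (θ * x))⁻¹ := by
  have : ∀ x : ℕ, (Real.exp (θ * x))⁻¹ = Real.exp (-θ) ^ x := fun x => by
    rw [← Real.exp_neg, ← Real.exp_nat_mul]
    ring_nf
  simp_rw [this]
  exact summable_geometric_of_lt_one (Real.exp_pos _).le (Real.exp_lt_one_iff.2 (by linarith))

end Drift

/-! ### The Markov chain of the two-orbit system -/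

section Chain

variable {lam al : Fin 2 → ℝ} {F : Fin 2 → Measure ℝ}

/-- Transition kernel of the two orbit sizes at departure instants. -/
noncomputable def stepKernel (lam al : Fin 2 → ℝ) (F : Fin 2 → Measure ℝ) :
    Kernel (Fin 2 → ℕ) (Fin 2 → ℕ) :=
  Kernel.ofFunOfCountable fun x => (cycleLaw lam al F).map (step x)

lemma stepKernel_apply (x : Fin 2 → ℕ) :
    stepKernel lam al F x = (cycleLaw lam al F).map (step x) := rfl

/-- Law of the orbit sizes after `n` departures. -/
noncomputable def orbitLaw (lam al : Fin 2 → ℝ) (F : Fin 2 → Measure ℝ) :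
    ℕ → Measure (Fin 2 → ℕ)
  | 0 => Measure.dirac 0
  | n + 1 => (orbitLaw lam al F n).bind (stepKernel lam al F)

lemma isMarkovKernel_stepKernel (hlam : ∀ k, 0 < lam k) (hal : ∀ k, 0 < al k)
    (hF : ∀ k, IsProbabilityMeasure (F k)) : IsMarkovKernel (stepKernel lam al F) := by
  have := isProbabilityMeasure_cycleLaw hlam hal hF
  refine ⟨fun x => ?_⟩
  rw [stepKernel_apply]
  exact Measure.isProbabilityMeasure_map (measurable_step x).aemeasurable

lemma isProbabilityMeasure_orbitLaw (hlam : ∀ k, 0 < lam k) (hal : ∀ k, 0 < al k)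
    (hF : ∀ k, IsProbabilityMeasure (F k)) (n : ℕ) :
    IsProbabilityMeasure (orbitLaw lam al F n) := by
  have := isMarkovKernel_stepKernel hlam hal hF
  induction n with
  | zero => unfold orbitLaw; infer_instance
  | succ n ih => unfold orbitLaw; infer_instance

lemma measurable_step_uncurry :
    Measurable fun p : (Fin 2 → ℕ) × (Ingredient → ℝ) => step p.1 p.2 :=
  measurable_from_prod_countable_right measurable_step

lemma measurable_orbits_coord (n : ℕ) :
    Measurable fun v : ℕ → Ingredient → ℝ => orbits (fun i v => v i) n v := by
  induction n with
  | zero => exact measurable_const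
  | succ n ih => exact measurable_step_uncurry.comp (ih.prodMk (measurable_pi_apply n))

lemma orbits_coord_congr {v v' : ℕ → Ingredient → ℝ} (n : ℕ) (h : ∀ i < n, v i = v' i) :
    orbits (fun i v => v i) n v = orbits (fun i v => v i) n v' := by
  induction n with
  | zero => rfl
  | succ n ih =>
    simp only [orbits]
    rw [ih fun i hi => h i (by omega), h n (by omega)]

/-- The path is a deterministic functional of the driving sequence, so its law can be computed on
the canonical product space. -/
lemma orbits_eq_coord {Ω : Type*} (ξ : ℕ → Ω → Ingredient → ℝ) (n : ℕ) (ω : Ω) :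
    orbits ξ n ω = orbits (fun i v => v i) n fun i => ξ i ω := by
  induction n with
  | zero => rfl
  | succ n ih => simp only [orbits, ih]

lemma indepFun_orbits_coord [IsProbabilityMeasure (cycleLaw lam al F)] (n : ℕ) :
    IndepFun (fun v : ℕ → Ingredient → ℝ => orbits (fun i v => v i) n v)
      (fun v : ℕ → Ingredient → ℝ => v n)
      (Measure.infinitePi fun _ : ℕ => cycleLaw lam al F) := by
  have h := indepFun_reindex (μ := fun _ : ℕ => cycleLaw lam al F)
    (f := fun i : Set.Iio n => (i : ℕ)) (g := fun _ : Unit => n) fun a _ => ne_of_lt a.2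
  -- The first `n` cycles are extended by zero to a full sequence; the state at time `n` does not
  -- see the extension.
  have hext : Measurable fun (u : Set.Iio n → Ingredient → ℝ) (i : ℕ) =>
      if hi : i < n then u ⟨i, hi⟩ else 0 := by
    refine measurable_pi_lambda _ fun i => ?_
    split_ifs with hi
    · exact measurable_pi_apply _
    · exact measurable_const
  have h2 := h.comp ((measurable_orbits_coord n).comp hext)
    (measurable_pi_apply (X := fun _ : Unit => Ingredient → ℝ) ())
  convert! h2 using 1
  ext1 v
  refine orbits_coord_congr n fun i hi => ?_
  simp [hi]

lemma map_orbits_coord (hlam : ∀ k, 0 < lam k) (hal : ∀ k, 0 < al k)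
    (hF : ∀ k, IsProbabilityMeasure (F k)) (n : ℕ) :
    (Measure.infinitePi fun _ : ℕ => cycleLaw lam al F).map
      (fun v => orbits (fun i v => v i) n v) = orbitLaw lam al F n := by
  have := isProbabilityMeasure_cycleLaw hlam hal hF
  induction n with
  | zero =>
    simp only [orbits, orbitLaw]
    rw [Measure.map_const, measure_univ, one_smul]
  | succ n ih =>
    have h := (indepFun_iff_map_prod_eq_prod_map_map (measurable_orbits_coord n).aemeasurable
      (measurable_pi_apply n).aemeasurable).1 (indepFun_orbits_coord (lam := lam) (al := al)
        (F := F) n)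
    rw [ih, Measure.infinitePi_map_eval] at h
    have hcomp : (Measure.infinitePi fun _ : ℕ => cycleLaw lam al F).map
        (fun v => orbits (fun i v => v i) (n + 1) v) =
        ((orbitLaw lam al F n).prod (cycleLaw lam al F)).map fun p => step p.1 p.2 := by
      rw [← h, Measure.map_map measurable_step_uncurry
        ((measurable_orbits_coord n).prodMk (measurable_pi_apply n))]
      rfl
    rw [hcomp, orbitLaw]
    refine Measure.ext fun A hA => ?_
    rw [Measure.map_apply measurable_step_uncurry hA,
      Measure.prod_apply (measurable_step_uncurry hA),
      Measure.bind_apply hA (Kernel.aemeasurable _)]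
    refine lintegral_congr fun x => ?_
    rw [stepKernel_apply, Measure.map_apply (measurable_step x) hA]
    rfl

/-- The orbit sizes driven by independent cycles have the law of the Markov chain. -/
lemma map_orbits_eq_orbitLaw (hlam : ∀ k, 0 < lam k) (hal : ∀ k, 0 < al k)
    (hF : ∀ k, IsProbabilityMeasure (F k)) {Ω : Type*} [MeasurableSpace Ω] {P : Measure Ω}
    {ξ : ℕ → Ω → Ingredient → ℝ} (hlaw : ∀ n, HasLaw (ξ n) (cycleLaw lam al F) P)
    (hindep : iIndepFun ξ P) (n : ℕ) :
    AEMeasurable (orbits ξ n) P ∧ P.map (orbits ξ n) = orbitLaw lam al F n := by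
  have hm : AEMeasurable (fun ω i => ξ i ω) P := aemeasurable_pi_iff.2 fun i => (hlaw i).aemeasurable
  have h := (hindep.hasLaw_infinitePi hlaw hm).map_eq
  have e : orbits ξ n = (fun v : ℕ → Ingredient → ℝ => orbits (fun i v => v i) n v) ∘
      fun ω i => ξ i ω := funext fun ω => orbits_eq_coord ξ n ω
  rw [e]
  refine ⟨(measurable_orbits_coord n).comp_aemeasurable hm, ?_⟩
  rw [← AEMeasurable.map_map_of_aemeasurable (measurable_orbits_coord n).aemeasurable hm, h,
    map_orbits_coord hlam hal hF]

/-- A geometric drift inequality for the transitions bounds the expectations along the chain. -/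
lemma integral_orbitLaw_le (hlam : ∀ k, 0 < lam k) (hal : ∀ k, 0 < al k)
    (hF : ∀ k, IsProbabilityMeasure (F k)) {V : (Fin 2 → ℕ) → ℝ} (hV : ∀ x, 0 ≤ V x)
    {γ K : ℝ} (hγ : 0 ≤ γ) (hK : 0 ≤ K)
    (h : ∀ x, Integrable (fun w => V (step x w)) (cycleLaw lam al F) ∧
      ∫ w, V (step x w) ∂(cycleLaw lam al F) ≤ γ * V x + K) (n : ℕ) :
    ∫⁻ x, ENNReal.ofReal (V x) ∂(orbitLaw lam al F (n + 1)) ≤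
      ENNReal.ofReal γ * ∫⁻ x, ENNReal.ofReal (V x) ∂(orbitLaw lam al F n) + ENNReal.ofReal K := by
  have := isProbabilityMeasure_orbitLaw hlam hal hF n
  rw [orbitLaw, Measure.lintegral_bind (Kernel.aemeasurable _)
    (measurable_of_countable _).aemeasurable]
  calc _ ≤ ∫⁻ x, (ENNReal.ofReal γ * ENNReal.ofReal (V x) + ENNReal.ofReal K)
        ∂(orbitLaw lam al F n) := by
        refine lintegral_mono fun x => ?_
        rw [stepKernel_apply, lintegral_map (measurable_of_countable _) (measurable_step x),
          ← ofReal_integral_eq_lintegral_ofReal (h x).1 (ae_of_all _ fun w => hV _),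
          ← ENNReal.ofReal_mul hγ, ← ENNReal.ofReal_add (mul_nonneg hγ (hV x)) hK]
        exact ENNReal.ofReal_le_ofReal (h x).2
    _ = _ := by
        rw [lintegral_add_right _ measurable_const, lintegral_const_mul' _ _ ENNReal.ofReal_ne_top]
        simp

/-- The bound is preserved by `t ↦ γ * t + K` and covers the initial value `1`, giving tightness of
the first orbit uniformly in time. -/
lemma lintegral_exp_orbit_zero_le (hlam : ∀ k, 0 < lam k) (hal : ∀ k, 0 < al k)
    (hF : ∀ k, IsProbabilityMeasure (F k)) {θ γ K : ℝ} (hγ : 0 ≤ γ) (hγ1 : γ < 1)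
    (hK : 0 ≤ K) (h : ∀ x, Integrable (fun w => Real.exp (θ * step x w 0)) (cycleLaw lam al F) ∧
      ∫ w, Real.exp (θ * step x w 0) ∂(cycleLaw lam al F) ≤ γ * Real.exp (θ * x 0) + K) (n : ℕ) :
    ∫⁻ x, ENNReal.ofReal (Real.exp (θ * x 0)) ∂(orbitLaw lam al F n) ≤
      ENNReal.ofReal (1 + K / (1 - γ)) := by
  have h1 : 0 < 1 - γ := by linarith
  have h2 : 0 ≤ K / (1 - γ) := div_nonneg hK h1.le
  induction n with
  | zero =>
    rw [orbitLaw, lintegral_dirac]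
    refine ENNReal.ofReal_le_ofReal ?_
    simp [h2]
  | succ n ih =>
    refine (integral_orbitLaw_le hlam hal hF (V := fun x => Real.exp (θ * x 0))
      (fun x => (Real.exp_pos _).le) hγ hK h n).trans ?_
    calc _ ≤ ENNReal.ofReal γ * ENNReal.ofReal (1 + K / (1 - γ)) + ENNReal.ofReal K := by gcongr
      _ = ENNReal.ofReal (γ * (1 + K / (1 - γ)) + K) := by
          rw [← ENNReal.ofReal_mul hγ, ← ENNReal.ofReal_add (by positivity) hK]
      _ ≤ _ := by
          refine ENNReal.ofReal_le_ofReal ?_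
          have h3 : (1 - γ) * (K / (1 - γ)) = K := by field_simp
          nlinarith

lemma lintegral_exp_direction_le (hlam : ∀ k, 0 < lam k) (hal : ∀ k, 0 < al k)
    (hF : ∀ k, IsProbabilityMeasure (F k)) {κ θ γ : ℝ} (hγ : 0 ≤ γ)
    (h : ∀ x, Integrable (fun w => Real.exp (-θ * (step x w 1 + κ * step x w 0)))
        (cycleLaw lam al F) ∧
      ∫ w, Real.exp (-θ * (step x w 1 + κ * step x w 0)) ∂(cycleLaw lam al F) ≤
        γ * Real.exp (-θ * (x 1 + κ * x 0))) (n : ℕ) :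
    ∫⁻ x, ENNReal.ofReal (Real.exp (-θ * (x 1 + κ * x 0))) ∂(orbitLaw lam al F n) ≤
      ENNReal.ofReal (γ ^ n) := by
  induction n with
  | zero =>
    rw [orbitLaw, lintegral_dirac]
    simp
  | succ n ih =>
    refine (integral_orbitLaw_le hlam hal hF (V := fun x => Real.exp (-θ * (x 1 + κ * x 0)))
      (fun x => (Real.exp_pos _).le) hγ le_rfl (fun x => ⟨(h x).1, by
        rw [add_zero]; exact (h x).2⟩) n).trans ?_
    rw [ENNReal.ofReal_zero, add_zero, pow_succ', ENNReal.ofReal_mul hγ]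
    gcongr

/-- If the first orbit is tight and `x 1 + κ * x 0` drifts to infinity, the second orbit is
eventually not empty, in probability. -/
lemma tendsto_orbitLaw_orbit_one_empty {κ θ θ' γ C : ℝ} (hκ : 0 < κ) (hθ : 0 < θ) (hθ' : 0 < θ')
    (hγ : 0 ≤ γ) (hγ1 : γ < 1)
    (h0 : ∀ n, ∫⁻ x, ENNReal.ofReal (Real.exp (θ * x 0)) ∂(orbitLaw lam al F n) ≤
      ENNReal.ofReal C)
    (h1 : ∀ n, ∫⁻ x, ENNReal.ofReal (Real.exp (-θ' * (x 1 + κ * x 0)))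
      ∂(orbitLaw lam al F n) ≤ ENNReal.ofReal (γ ^ n)) :
    Tendsto (fun n => orbitLaw lam al F n {x | x 1 = 0}) atTop (𝓝 0) := by
  -- When `x 1 = 0`, either `x 0 ≥ R` and the first exponential term is at least one, or `x 0 ≤ R`
  -- and the second is. Choosing `R` large and then `n` large makes both expectations small.
  have hbound : ∀ (R : ℕ) n, orbitLaw lam al F n {x | x 1 = 0} ≤
      ENNReal.ofReal (Real.exp (-(θ * R))) * ENNReal.ofReal C +
        ENNReal.ofReal (Real.exp (θ' * κ * R)) * ENNReal.ofReal (γ ^ n) := by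
    intro R n
    calc orbitLaw lam al F n {x | x 1 = 0}
        = ∫⁻ x, ({x | x 1 = 0} : Set (Fin 2 → ℕ)).indicator 1 x ∂(orbitLaw lam al F n) := by
          rw [lintegral_indicator_one MeasurableSet.of_discrete]
      _ ≤ ∫⁻ x, (ENNReal.ofReal (Real.exp (-(θ * R))) * ENNReal.ofReal (Real.exp (θ * x 0)) +
            ENNReal.ofReal (Real.exp (θ' * κ * R)) *
              ENNReal.ofReal (Real.exp (-θ' * (x 1 + κ * x 0)))) ∂(orbitLaw lam al F n) := by
          refine lintegral_mono fun x => ?_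
          by_cases hx : x 1 = 0
          · rw [Set.indicator_of_mem (by exact hx), Pi.one_apply,
              ← ENNReal.ofReal_mul (Real.exp_pos _).le, ← ENNReal.ofReal_mul (Real.exp_pos _).le,
              ← Real.exp_add, ← Real.exp_add]
            rcases le_total (R : ℝ) (x 0) with hR | hR
            · refine le_add_right ?_
              rw [ENNReal.one_le_ofReal, Real.one_le_exp_iff]
              nlinarith
            · refine le_add_left ?_
              rw [ENNReal.one_le_ofReal, Real.one_le_exp_iff, hx]
              have : 0 ≤ θ' * κ * (R - x 0) := mul_nonneg (by positivity) (by linarith)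
              push_cast
              linarith
          · rw [Set.indicator_of_notMem (by exact hx)]
            exact bot_le
      _ = ENNReal.ofReal (Real.exp (-(θ * R))) *
            ∫⁻ x, ENNReal.ofReal (Real.exp (θ * x 0)) ∂(orbitLaw lam al F n) +
          ENNReal.ofReal (Real.exp (θ' * κ * R)) *
            ∫⁻ x, ENNReal.ofReal (Real.exp (-θ' * (x 1 + κ * x 0))) ∂(orbitLaw lam al F n) := by
          rw [lintegral_add_left (measurable_of_countable _),
            lintegral_const_mul' _ _ ENNReal.ofReal_ne_top,
            lintegral_const_mul' _ _ ENNReal.ofReal_ne_top]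
      _ ≤ _ := by gcongr <;> apply_assumption
  have l1 : Tendsto (fun R : ℕ => ENNReal.ofReal (Real.exp (-(θ * R))) * ENNReal.ofReal C)
      atTop (𝓝 0) := by
    have : Tendsto (fun R : ℕ => ENNReal.ofReal (Real.exp (-(θ * R)))) atTop (𝓝 0) := by
      rw [← ENNReal.ofReal_zero]
      refine ENNReal.tendsto_ofReal ?_
      exact Real.tendsto_exp_neg_atTop_nhds_zero.comp
        (tendsto_natCast_atTop_atTop.const_mul_atTop hθ)
    simpa using ENNReal.Tendsto.mul_const this (Or.inr ENNReal.ofReal_ne_top)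
  have l2 : ∀ R : ℕ, Tendsto (fun n : ℕ => ENNReal.ofReal (Real.exp (θ' * κ * R)) *
      ENNReal.ofReal (γ ^ n)) atTop (𝓝 0) := fun R => by
    have : Tendsto (fun n : ℕ => ENNReal.ofReal (γ ^ n)) atTop (𝓝 0) := by
      rw [← ENNReal.ofReal_zero]
      exact ENNReal.tendsto_ofReal (tendsto_pow_atTop_nhds_zero_of_lt_one hγ hγ1)
    simpa using ENNReal.Tendsto.const_mul this (Or.inr ENNReal.ofReal_ne_top)
  rw [ENNReal.tendsto_nhds_zero]
  intro ε hε
  have hε2 : 0 < ε / 2 := ENNReal.half_pos hε.ne'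
  obtain ⟨R, hR⟩ := ((ENNReal.tendsto_nhds_zero.1 l1) _ hε2).exists
  filter_upwards [(ENNReal.tendsto_nhds_zero.1 (l2 R)) _ hε2] with n hn
  exact (hbound R n).trans ((add_le_add hR hn).trans (ENNReal.add_halves ε).le)

end Chain

/-! ### Comparison of the first orbit with the single-orbit chain -/

section Convergence

variable {lam al : Fin 2 → ℝ} {F : Fin 2 → Measure ℝ}

lemma integrable_of_bdd_orbits {μ : Measure (Fin 2 → ℕ)} [IsFiniteMeasure μ]
    {φ : (Fin 2 → ℕ) → ℝ} {B : ℝ} (h : ∀ x, |φ x| ≤ B) : Integrable φ μ :=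
  Integrable.of_bound (measurable_of_countable φ).aestronglyMeasurable B (ae_of_all _ h)

/-- One step of the first orbit, compared with one step of the single-orbit system. -/
lemma abs_integral_orbitLaw_succ_sub_le (hlam : ∀ k, 0 < lam k) (hal : ∀ k, 0 < al k)
    (hF : ∀ k, IsProbabilityMeasure (F k)) {φ : ℕ → ℝ} (hφ : ∀ x, |φ x| ≤ 1) (n : ℕ) :
    |∫ x, φ (x 0) ∂(orbitLaw lam al F (n + 1)) -
      ∫ x, markovOp (auxKernel lam al F) φ (x 0) ∂(orbitLaw lam al F n)| ≤
      2 * (orbitLaw lam al F n).real {x | x 1 = 0} := by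
  have hc := isProbabilityMeasure_cycleLaw hlam hal hF
  have hk := isMarkovKernel_stepKernel hlam hal hF
  have hq := isMarkovKernel_auxKernel hlam hal hF
  have hL := isProbabilityMeasure_orbitLaw hlam hal hF
  set S : (Fin 2 → ℕ) → ℝ := fun x => ∫ w, φ (step x w 0) ∂(cycleLaw lam al F) with hS
  have hS1 : ∀ x, |S x| ≤ 1 := fun x => by
    have hi : Integrable (fun w => φ (step x w 0)) (cycleLaw lam al F) :=
      Integrable.of_bound ((measurable_of_countable φ).comp
        (measurable_step_apply x 0)).aestronglyMeasurable 1 (ae_of_all _ fun w => hφ _)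
    refine abs_integral_le_integral_abs.trans
      ((integral_mono hi.abs (integrable_const 1) fun w => hφ _).trans ?_)
    simp
  have hT1 : ∀ x, |markovOp (auxKernel lam al F) φ x| ≤ 1 := abs_markovOp_le hφ
  have e1 : ∫ x, φ (x 0) ∂(orbitLaw lam al F (n + 1)) = ∫ x, S x ∂(orbitLaw lam al F n) := by
    have hi : Integrable (fun x : Fin 2 → ℕ => φ (x 0)) (orbitLaw lam al F (n + 1)) :=
      integrable_of_bdd_orbits fun x => hφ _
    rw [orbitLaw, Measure.comp_eq_comp_const_apply] at hi ⊢
    rw [Kernel.integral_comp hi]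
    simp only [Kernel.const_apply]
    refine integral_congr_ae (ae_of_all _ fun x => ?_)
    simp only [stepKernel_apply, hS]
    rw [integral_map (measurable_step x).aemeasurable
      (measurable_of_countable _).aestronglyMeasurable]
  -- The two one-step expectations agree when the second orbit is non-empty; elsewhere both are
  -- bounded by one, which costs at most `2`.
  have e2 : ∀ x : Fin 2 → ℕ, 0 < x 1 → S x = markovOp (auxKernel lam al F) φ (x 0) := by
    intro x hx
    simp only [hS, markovOp]
    rw [auxKernel_apply, ← map_step_zero_eq_map_auxStep hlam hal hF hx,
      integral_map (measurable_step_apply x 0).aemeasurable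
        (measurable_of_countable _).aestronglyMeasurable]
  rw [e1, ← integral_sub (integrable_of_bdd_orbits hS1)
    (integrable_of_bdd_orbits fun x => hT1 (x 0))]
  have hind : Integrable (({x | x 1 = 0} : Set (Fin 2 → ℕ)).indicator fun _ => (2 : ℝ))
      (orbitLaw lam al F n) := (integrable_const _).indicator MeasurableSet.of_discrete
  refine abs_integral_le_integral_abs.trans ((integral_mono
    ((integrable_of_bdd_orbits hS1).sub (integrable_of_bdd_orbits fun x => hT1 (x 0))).abs hind
    fun x => ?_).trans ?_)
  · by_cases hx : x 1 = 0
    · rw [Set.indicator_of_mem (by exact hx)]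
      have := abs_sub (S x) (markovOp (auxKernel lam al F) φ (x 0))
      have := hS1 x
      have := hT1 (x 0)
      change |S x - markovOp (auxKernel lam al F) φ (x 0)| ≤ 2
      linarith
    · rw [Set.indicator_of_notMem (by exact hx)]
      simp [e2 x (by omega)]
  · rw [integral_indicator_const _ MeasurableSet.of_discrete, smul_eq_mul, mul_comm]

/-- Telescoping: each induction step replaces the last true transition by `auxKernel`, and the new
test function keeps its bound. -/
lemma abs_integral_orbitLaw_add_sub_le (hlam : ∀ k, 0 < lam k) (hal : ∀ k, 0 < al k)
    (hF : ∀ k, IsProbabilityMeasure (F k)) (n m : ℕ) : ∀ {φ : ℕ → ℝ}, (∀ x, |φ x| ≤ 1) →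
    |∫ x, φ (x 0) ∂(orbitLaw lam al F (n + m)) -
      ∫ x, (markovOp (auxKernel lam al F))^[m] φ (x 0) ∂(orbitLaw lam al F n)| ≤
      ∑ j ∈ Finset.range m, 2 * (orbitLaw lam al F (n + j)).real {x | x 1 = 0} := by
  have hq := isMarkovKernel_auxKernel hlam hal hF
  induction m with
  | zero => intro φ _; simp
  | succ m ih =>
    intro φ hφ
    rw [Finset.sum_range_succ, Function.iterate_succ_apply, add_comm (Finset.sum _ _)]
    exact (abs_sub_le _ _ _).trans (add_le_add
      (abs_integral_orbitLaw_succ_sub_le hlam hal hF hφ (n + m)) (ih (abs_markovOp_le hφ)))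

/-- Averages the pointwise ergodicity estimate over the first orbit at time `n`. A moment bound `D`
independent of `n` makes the result uniform in time. -/
lemma abs_integral_iterate_sub_le (hlam : ∀ k, 0 < lam k) (hal : ∀ k, 0 < al k)
    (hF : ∀ k, IsProbabilityMeasure (F k)) {V : ℕ → ℝ} {D C a b : ℝ}
    (hV : ∀ x, 0 ≤ V x) (hCa : 0 ≤ C * a) (hD : 0 ≤ D) {n : ℕ}
    (hbV : ∫⁻ x, ENNReal.ofReal (V (x 0)) ∂(orbitLaw lam al F n) ≤ ENNReal.ofReal D)
    {ψ : ℕ → ℝ} (hψ : ∀ x, |ψ x| ≤ 1) (h : ∀ x, |ψ x - b| ≤ C * a * (1 + V x)) :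
    |∫ x, ψ (x 0) ∂(orbitLaw lam al F n) - b| ≤ C * a * (1 + D) := by
  have hL := isProbabilityMeasure_orbitLaw hlam hal hF n
  have hVi : Integrable (fun x : Fin 2 → ℕ => V (x 0)) (orbitLaw lam al F n) := by
    refine ⟨(measurable_of_countable _).aestronglyMeasurable, ?_⟩
    rw [hasFiniteIntegral_iff_ofReal (ae_of_all _ fun x => hV _)]
    exact hbV.trans_lt ENNReal.ofReal_lt_top
  have hVD : ∫ x, V (x 0) ∂(orbitLaw lam al F n) ≤ D := by
    rw [integral_eq_lintegral_of_nonneg_ae (ae_of_all _ fun x => hV _) hVi.aestronglyMeasurable]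
    exact ENNReal.toReal_le_of_le_ofReal hD hbV
  have hψi : Integrable (fun x : Fin 2 → ℕ => ψ (x 0)) (orbitLaw lam al F n) :=
    integrable_of_bdd_orbits fun x => hψ _
  have e : ∫ x, ψ (x 0) ∂(orbitLaw lam al F n) - b =
      ∫ x, (ψ (x 0) - b) ∂(orbitLaw lam al F n) := by
    rw [integral_sub hψi (integrable_const _)]; simp
  rw [e]
  refine abs_integral_le_integral_abs.trans ((integral_mono (hψi.sub (integrable_const _)).abs
    (((integrable_const (1 : ℝ)).add hVi).const_mul (C * a)) fun x => h (x 0)).trans ?_)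
  rw [integral_const_mul]
  refine mul_le_mul_of_nonneg_left ?_ hCa
  simp only [Pi.add_apply]
  rw [integral_add (integrable_const _) hVi]
  simpa using hVD

end Convergence

end Retrial

/-! ### The convergence theorem -/

theorem theorem3
    (lam al : Fin 2 → ℝ) (hlam : ∀ k, 0 < lam k) (hal : ∀ k, 0 < al k)
    (F : Fin 2 → Measure ℝ) (hF : ∀ k, IsProbabilityMeasure (F k))
    (hD : ∀ k, Retrial.ClassD (F k))
    (ρ ρh : Fin 2 → ℝ) (hρ : ρ = Retrial.rho lam F) (hρh : ρh = Retrial.rhoHat al F)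
    (h1 : ρ 0 * ((ρ 0 + ρ 1) + (ρh 0 + ρh 1)) < ρh 0)
    (h2 : ρh 1 / (ρ 1 + ρh 1) < ρ 0 + ρ 1)
    {Ω : Type*} [MeasurableSpace Ω] (P : Measure Ω) [IsProbabilityMeasure P]
    (ξ : ℕ → Ω → Retrial.Ingredient → ℝ)
    (hlaw : ∀ n, HasLaw (ξ n) (Retrial.cycleLaw lam al F) P)
    (hindep : iIndepFun ξ P) :
    ∃ π : Measure ℕ, Retrial.IsStationary lam al F π ∧
      (∀ π' : Measure ℕ, Retrial.IsStationary lam al F π' → π' = π) ∧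
      Tendsto (fun n => Retrial.tvDist (P.map (fun ω => Retrial.orbits ξ n ω 0)) π)
        atTop (𝓝 0) := by
  have hρ' : ∀ k, ρ k = lam k * ∫ s, s ∂(F k) := fun k => by
    rw [hρ, Retrial.rho, Retrial.serviceRate, div_div_eq_mul_div, div_one]
  have hρh' : ∀ k, ρh k = al k * ∫ s, s ∂(F k) := fun k => by
    rw [hρh, Retrial.rhoHat, Retrial.serviceRate, div_div_eq_mul_div, div_one]
  have m0 := (hD 0).integral_id_pos
  have h1' : lam 0 * (lam 0 * (∫ s, s ∂(F 0)) + lam 1 * (∫ s, s ∂(F 1)) +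
      al 0 * (∫ s, s ∂(F 0)) + al 1 * (∫ s, s ∂(F 1))) < al 0 := by
    simp only [hρ', hρh'] at h1
    -- The load condition is the rate condition multiplied by the mean of `F 0`.
    refine lt_of_mul_lt_mul_right (lt_of_eq_of_lt ?_ h1) m0.le
    ring
  obtain ⟨θ, γ, K, hθ, hγ0, hγ1, hK, hdrift⟩ :=
    Retrial.exists_drift_orbit_zero hlam hal hF hD h1'
  obtain ⟨κ, θ', γ', hκ, hθ', hγ'0, hγ'1, hcontr⟩ :=
    Retrial.exists_contraction_direction hlam hal hF hD (m := fun k => ∫ s, s ∂(F k))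
      (fun _ => rfl) (by simpa only [hρ', hρh'] using h2)
  have hq := Retrial.isMarkovKernel_auxKernel hlam hal hF
  have hharris := Retrial.harrisPair_auxKernel hlam hal hF hD hθ hγ0 hγ1 hK hdrift
  obtain ⟨π, hπ, hinv, huniq, C, a, hC, ha, ha1, hconv⟩ :=
    hharris.geometric_ergodicity (fun _ => Real.exp_pos _) (Retrial.summable_inv_exp hθ)
  refine ⟨π, ⟨hπ, hinv⟩, fun π' hπ' => huniq π' hπ'.1 hπ'.2, ?_⟩
  have h0 := Retrial.lintegral_exp_orbit_zero_le hlam hal hF hγ0 hγ1 hK hdrift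
  have hempty := Retrial.tendsto_orbitLaw_orbit_one_empty hκ hθ hθ' hγ'0 hγ'1 h0
    (Retrial.lintegral_exp_direction_le hlam hal hF hγ'0 hcontr)
  set D : ℝ := 1 + K / (1 - γ) with hDdef
  have hD0 : 0 ≤ D := by
    have : 0 < 1 - γ := by linarith
    positivity
  have hL := Retrial.isProbabilityMeasure_orbitLaw hlam hal hF
  have hempty' : Tendsto (fun n => (Retrial.orbitLaw lam al F n).real {x | x 1 = 0})
      atTop (𝓝 0) := by
    have := (ENNReal.tendsto_toReal ENNReal.zero_ne_top).comp hempty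
    simpa [Function.comp_def, measureReal_def] using this
  -- Time is split in two: after `n` cycles the second orbit is rarely empty, and the remaining `m`
  -- cycles let the single-orbit chain mix.
  have hbound : ∀ n m, Retrial.tvDist (P.map (fun ω => Retrial.orbits ξ (n + m) ω 0)) π ≤
      ∑ j ∈ Finset.range m, 2 * (Retrial.orbitLaw lam al F (n + j)).real {x | x 1 = 0} +
        C * a ^ m * (1 + D) := by
    intro n m
    have : Nonempty {A : Set ℕ // MeasurableSet A} := ⟨⟨∅, MeasurableSet.empty⟩⟩
    refine ciSup_le fun A => ?_
    set φ : ℕ → ℝ := A.1.indicator fun _ => (1 : ℝ) with hφd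
    have hφ : ∀ x, |φ x| ≤ 1 := fun x => by
      by_cases hx : x ∈ A.1 <;> simp [hφd, hx]
    obtain ⟨hm, hmap⟩ := Retrial.map_orbits_eq_orbitLaw hlam hal hF hlaw hindep (n + m)
    have hm0 : Measurable fun x : Fin 2 → ℕ => x 0 := measurable_pi_apply 0
    have e1 : P.map (fun ω => Retrial.orbits ξ (n + m) ω 0) =
        (Retrial.orbitLaw lam al F (n + m)).map fun x => x 0 := by
      rw [← hmap, AEMeasurable.map_map_of_aemeasurable hm0.aemeasurable hm]
      rfl
    have e2 : (P.map (fun ω => Retrial.orbits ξ (n + m) ω 0)).real A.1 =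
        ∫ x, φ (x 0) ∂(Retrial.orbitLaw lam al F (n + m)) := by
      rw [e1, ← integral_map (f := φ) hm0.aemeasurable
        (measurable_of_countable _).aestronglyMeasurable, hφd,
        integral_indicator_const _ A.2, smul_eq_mul, mul_one]
    have e3 : π.real A.1 = ∫ x, φ x ∂π := by
      rw [hφd, integral_indicator_const _ A.2, smul_eq_mul, mul_one]
    rw [e2, e3]
    refine (abs_sub_le _ _ _).trans (add_le_add
      (Retrial.abs_integral_orbitLaw_add_sub_le hlam hal hF n m hφ) ?_)
    exact Retrial.abs_integral_iterate_sub_le hlam hal hF (fun _ => (Real.exp_pos _).le)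
      (by positivity) hD0 (h0 n) (Retrial.abs_markovOp_iterate_le m hφ) (hconv m φ hφ)
  have hnonneg : ∀ n, 0 ≤ Retrial.tvDist (P.map (fun ω => Retrial.orbits ξ n ω 0)) π := fun n =>
    Real.iSup_nonneg fun _ => abs_nonneg _
  have hgeom : Tendsto (fun m : ℕ => C * a ^ m * (1 + D)) atTop (𝓝 0) := by
    simpa using ((tendsto_pow_atTop_nhds_zero_of_lt_one ha.le ha1).const_mul C).mul_const (1 + D)
  rw [Metric.tendsto_atTop]
  intro ε hε
  -- The mixing length `m` is fixed first, so that the comparison error is a finite sum of terms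
  -- tending to zero.
  obtain ⟨m, hm⟩ := (hgeom.eventually (gt_mem_nhds (half_pos hε))).exists
  have hsum : Tendsto (fun n => ∑ j ∈ Finset.range m,
      2 * (Retrial.orbitLaw lam al F (n + j)).real {x | x 1 = 0}) atTop (𝓝 0) := by
    have := tendsto_finsetSum (Finset.range m) fun j _ =>
      ((tendsto_add_atTop_iff_nat j).2 hempty').const_mul 2
    simpa using this
  obtain ⟨N, hN⟩ := eventually_atTop.1 (hsum.eventually (gt_mem_nhds (half_pos hε)))
  refine ⟨N + m, fun n hn => ?_⟩
  rw [Real.dist_eq, sub_zero, abs_of_nonneg (hnonneg n)]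
  have h3 := hbound (n - m) m
  rw [Nat.sub_add_cancel (by omega)] at h3
  have h4 := hN (n - m) (by omega)
  linarith
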